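/- **Theorem.** Computing a stationary Nash equilibrium of a 4-player discounted perfect-information stochastic game is $\textsc{SqrtSum}$-hard. Here $\textsc{SqrtSum}$ is the problem of deciding, for positive integers $a_1,\dots,a_n,t$ written in binary, whether $\sum_{i=1}^n\sqrt{a_i}\le t$. A discounted perfect-information stochastic game has finitely many states, each controlled by one player, who chooses there from a finite nonempty set of actions; playing action $a$ in state $k$ gives each player $i$ a reward $r^i_{ka}\in[0,1]$ and moves play to state $l$ with probability $p^{kl}_a$. There is a discount factor $0\le\gamma<1$, and a player's payoff is the expectation of $(1-\gamma)\sum_{t\ge1}\gamma^{t-1}r_t$, where $r_t$ is the player's reward in round $t$. All rewards, probabilities and $\gamma$ are rational numbers, given as fractions of integers in binary. A stationary strategy profile $x$ gives for every state $k$ a probability distribution $(x_{ka})_a$ on its actions; it is a Nash equilibrium if, for every initial state, no player can gain by changing to any (behavioral, history-dependent) strategy. The hardness means: there is a polynomial-time computable map that sends every instance $(a_1,\dots,a_n,t)$ to a 4-player game $G$ together with a state $k$ and an action $a$ of that state, such that $G$ has a stationary Nash equilibrium and every stationary Nash equilibrium $x$ of $G$ satisfies $x_{ka}=1$ if $\sum_{i=1}^n\sqrt{a_i}\le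 t$, and $x_{ka}=0$ if $\sum_{i=1}^n\sqrt{a_i}>t$. -/

import Mathlib

open MeasureTheory ProbabilityTheory
open scoped NNReal ENNReal

namespace StochasticGames

noncomputable section

/-! ## Binary encodings -/

/-- A finite sequence of natural numbers, each written in binary and followed by a comma. -/
def encodeNats (l : List ℕ) : List Computability.Γ' :=
  l.flatMap fun n =>
    (Computability.encodeNat n).map Computability.Γ'.bit ++ [Computability.Γ'.comma]

theorem bits_comma_inj {x y : List Bool} {u v : List Computability.Γ'}
    (h : x.map Computability.Γ'.bit ++ Computability.Γ'.comma :: u =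
      y.map Computability.Γ'.bit ++ Computability.Γ'.comma :: v) : x = y ∧ u = v := by
  induction x generalizing y with
  | nil => cases y <;> simp_all
  | cons a x ih =>
    cases y with
    | nil => simp at h
    | cons b y =>
      simp only [List.map_cons, List.cons_append, List.cons.injEq,
        Computability.Γ'.bit.injEq] at h
      obtain ⟨h1, h2⟩ := ih h.2
      exact ⟨by rw [h.1, h1], h2⟩

theorem encodeNats_injective : Function.Injective encodeNats := by
  intro l
  induction l with
  | nil =>
    intro l' h
    cases l' with
    | nil => rfl
    | cons b l' => simp [encodeNats] at h
  | cons a l ih =>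
    intro l' h
    cases l' with
    | nil => simp [encodeNats] at h
    | cons b l' =>
      simp only [encodeNats, List.flatMap_cons, List.append_assoc, List.cons_append,
        List.nil_append] at h
      obtain ⟨h1, h2⟩ := bits_comma_inj h
      have h3 : a = b := by
        rw [← Computability.decode_encodeNat a, h1, Computability.decode_encodeNat]
      rw [h3, ih h2]

/-- A nonnegative rational number, given as a numerator and a positive denominator (not
necessarily in lowest terms). -/
abbrev Frac : Type := ℕ × ℕ+

/-- The number that a fraction denotes. -/
def Frac.val (q : Frac) : ℝ≥0 := (q.1 : ℝ≥0) / ((q.2 : ℕ) : ℝ≥0)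

/-- Numerator and denominator. -/
def Frac.code (q : Frac) : List ℕ := [q.1, (q.2 : ℕ)]

/-! ## Discounted perfect-information stochastic games -/

/-- A finite discounted perfect-information stochastic game with `N` players and rational data,
given explicitly. In every state the controlling player chooses an action; the other players have
nothing to choose there. -/
structure Game (N : ℕ) where
  /-- number of states; the states are `0, …, numStates - 1` -/
  numStates : ℕ
  /-- the discount factor -/
  discount : Frac
  discount_lt_one : discount.val < 1
  /-- the player who controls a state -/
  ctrl : Fin numStates → Fin N
  /-- number of actions in a state -/
  numActions : Fin numStates → ℕ
  numActions_pos : ∀ k, 0 < numActions k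
  /-- `reward k a i` is the reward to player `i` when action `a` is played in state `k` -/
  reward : (k : Fin numStates) → Fin (numActions k) → Fin N → Frac
  reward_le_one : ∀ k a i, (reward k a i).val ≤ 1
  /-- `trans k a l` is the probability that play moves from `k` to `l` when `a` is played -/
  trans : (k : Fin numStates) → Fin (numActions k) → Fin numStates → Frac
  trans_sum : ∀ k a, ∑ l, (trans k a l).val = 1

namespace Game

variable {N : ℕ} (G : Game N)

/-- A state together with one of its actions: what happens in one round of play. -/
abbrev Step : Type := Σ k : Fin G.numStates, Fin (G.numActions k)

/-- The distribution of the next state. -/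
def next (p : G.Step) : PMF (Fin G.numStates) :=
  PMF.ofFintype (fun l => ((G.trans p.1 p.2 l).val : ℝ≥0∞)) (by
    exact_mod_cast G.trans_sum p.1 p.2)

/-- A behavioral strategy profile: after any finite play, consisting of the `n` completed rounds
and the current state `k`, the player who controls `k` draws an action from a distribution. As
each state is controlled by exactly one player, one function describes the strategies of all
players; the strategy of player `i` is its restriction to the states that `i` controls. -/
abbrev Profile : Type :=
  (n : ℕ) → (Fin n → G.Step) → (k : Fin G.numStates) → PMF (Fin (G.numActions k))

/-- `τ` arises from `σ` by changing the strategy of player `i` only. -/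
def IsDeviation (i : Fin N) (σ τ : G.Profile) : Prop :=
  ∀ (n : ℕ) (h : Fin n → G.Step) (k : Fin G.numStates), G.ctrl k ≠ i → τ n h k = σ n h k

/-- The distribution of the state-action pair of a round in state `k`. -/
def actIn (k : Fin G.numStates) (α : PMF (Fin (G.numActions k))) : PMF G.Step :=
  α.map fun a => ⟨k, a⟩

/-- The distribution of the state-action pair of round `n + 1`, given those of rounds
`0, …, n`. -/
def stepPMF (σ : G.Profile) (n : ℕ) (h : Fin (n + 1) → G.Step) : PMF G.Step :=
  (G.next (h (Fin.last n))).bind fun k => G.actIn k (σ (n + 1) h k)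

instance : DiscreteMeasurableSpace G.Step :=
  ⟨fun s => MeasurableSpace.measurableSet_iInf.2 fun k =>
    MeasurableSet.of_discrete (s := Sigma.mk k ⁻¹' s)⟩

/-- `stepPMF` as a Markov kernel. -/
def stepKernel (σ : G.Profile) (n : ℕ) :
    Kernel ((_ : Finset.Iic n) → G.Step) G.Step :=
  Kernel.ofFunOfCountable fun h =>
    (G.stepPMF σ n fun j =>
      h ⟨j, Finset.mem_Iic.2 (Nat.lt_succ_iff.1 j.isLt)⟩).toMeasure

instance (σ : G.Profile) (n : ℕ) : IsMarkovKernel (G.stepKernel σ n) :=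
  ⟨fun h => by
    change IsProbabilityMeasure (PMF.toMeasure _)
    infer_instance⟩

/-- The law of the infinite play `(s⁰, a⁰), (s¹, a¹), …` under the profile `σ` from the initial
state `s`. -/
def playMeasure (s : Fin G.numStates) (σ : G.Profile) : Measure (ℕ → G.Step) :=
  Kernel.trajMeasure (X := fun _ => G.Step)
    (G.actIn s (σ 0 (fun j => j.elim0) s)).toMeasure (G.stepKernel σ)

/-- The normalized expected discounted payoff of player `i` from the initial state `s`. -/
def payoff (i : Fin N) (s : Fin G.numStates) (σ : G.Profile) : ℝ :=
  ∫ ω, (1 - (G.discount.val : ℝ)) *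
    ∑' t : ℕ, (G.discount.val : ℝ) ^ t * ((G.reward (ω t).1 (ω t).2 i).val : ℝ)
    ∂(G.playMeasure s σ)

/-- `σ` is a Nash equilibrium (for play starting in any state): no player gains by a behavioral
deviation. -/
def IsNash (σ : G.Profile) : Prop :=
  ∀ (s : Fin G.numStates) (i : Fin N) (τ : G.Profile), G.IsDeviation i σ τ →
    G.payoff i s τ ≤ G.payoff i s σ

/-- A stationary strategy profile: the action depends on the current state only. -/
abbrev Stationary : Type := (k : Fin G.numStates) → PMF (Fin (G.numActions k))

/-- A stationary profile as a behavioral profile. -/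
def Stationary.toProfile {G : Game N} (x : G.Stationary) : G.Profile := fun _ _ k => x k

/-! ### Encoding of games -/

/-- The rewards to all players and the transition probabilities for one state and action. -/
def actionCode (k : Fin G.numStates) (a : Fin (G.numActions k)) : List ℕ :=
  ((List.finRange N).flatMap fun i => (G.reward k a i).code) ++
    (List.finRange G.numStates).flatMap fun l => (G.trans k a l).code

/-- Controlling player, number of actions, and the data of all actions of a state. -/
def stateCode (k : Fin G.numStates) : List ℕ :=
  (G.ctrl k : ℕ) :: G.numActions k ::
    (List.finRange (G.numActions k)).flatMap (G.actionCode k)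

/-- All the data of the game. -/
def code : List ℕ :=
  G.numStates :: (G.discount.code ++ (List.finRange G.numStates).flatMap G.stateCode)

end Game

theorem flatMap_append_inj {α : Type} {P : α → Prop} {e e' : α → List ℕ}
    (he : ∀ x (u v : List ℕ), e x ++ u = e' x ++ v → P x ∧ u = v) (L : List α)
    (u v : List ℕ) (h : L.flatMap e ++ u = L.flatMap e' ++ v) :
    (∀ x ∈ L, P x) ∧ u = v := by
  induction L with
  | nil => simpa using h
  | cons x L ih =>
    simp only [List.flatMap_cons, List.append_assoc] at h
    obtain ⟨h1, h2⟩ := he x _ _ h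
    obtain ⟨h3, h4⟩ := ih h2
    exact ⟨by simpa using ⟨h1, h3⟩, h4⟩

theorem Frac.code_append_inj {p q : Frac} {u v : List ℕ} (h : p.code ++ u = q.code ++ v) :
    p = q ∧ u = v := by
  simp only [Frac.code, List.cons_append, List.nil_append, List.cons.injEq, PNat.coe_inj] at h
  exact ⟨Prod.ext h.1 h.2.1, h.2.2⟩

theorem Game.code_injective {N : ℕ} : Function.Injective (Game.code (N := N)) := by
  rintro ⟨m, γ, hγ, c, na, hna, r, hr, q, hq⟩ ⟨m', γ', hγ', c', na', hna', r', hr', q', hq'⟩ h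
  simp only [Game.code, List.cons.injEq] at h
  obtain ⟨rfl, h⟩ := h
  obtain ⟨rfl, h⟩ := Frac.code_append_inj h
  have key := flatMap_append_inj
    (P := fun k => c k = c' k ∧ ∃ e : na k = na' k,
      ∀ a, r k a = r' k (Fin.cast e a) ∧ q k a = q' k (Fin.cast e a))
    (e := Game.stateCode ⟨m, γ, hγ, c, na, hna, r, hr, q, hq⟩)
    (e' := Game.stateCode ⟨m, γ, hγ', c', na', hna', r', hr', q', hq'⟩)
    (fun k u v hk => by
      simp only [Game.stateCode, List.cons_append, List.cons.injEq] at hk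
      obtain ⟨h1, h2, h3⟩ := hk
      have hc : c k = c' k := Fin.ext h1
      have gen : ∀ (n n' : ℕ) (R : Fin n → Fin N → Frac) (Q : Fin n → Fin m → Frac)
          (R' : Fin n' → Fin N → Frac) (Q' : Fin n' → Fin m → Frac) (e : n = n'),
          (List.finRange n).flatMap (fun a =>
            ((List.finRange N).flatMap fun i => (R a i).code) ++
              (List.finRange m).flatMap fun l => (Q a l).code) ++ u =
          (List.finRange n').flatMap (fun a =>
            ((List.finRange N).flatMap fun i => (R' a i).code) ++
              (List.finRange m).flatMap fun l => (Q' a l).code) ++ v →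
          (∀ a, R a = R' (Fin.cast e a) ∧ Q a = Q' (Fin.cast e a)) ∧ u = v := by
        intro n n' R Q R' Q' e hh
        subst e
        have := flatMap_append_inj (P := fun a => R a = R' a ∧ Q a = Q' a)
          (fun a u v ha => by
            simp only [List.append_assoc] at ha
            obtain ⟨t1, ha⟩ := flatMap_append_inj (P := fun i => R a i = R' a i)
              (fun i u v hi => Frac.code_append_inj hi) _ _ _ ha
            obtain ⟨t2, ha⟩ := flatMap_append_inj (P := fun l => Q a l = Q' a l)
              (fun i u v hi => Frac.code_append_inj hi) _ _ _ ha
            exact ⟨⟨funext fun i => t1 i (List.mem_finRange i),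
              funext fun l => t2 l (List.mem_finRange l)⟩, ha⟩) _ _ _ hh
        exact ⟨fun a => this.1 a (List.mem_finRange a), this.2⟩
      obtain ⟨h4, h5⟩ := gen _ _ _ _ _ _ h2 h3
      exact ⟨⟨hc, h2, h4⟩, h5⟩)
    (List.finRange m) [] [] (by simpa using h)
  have key' := fun k => key.1 k (List.mem_finRange k)
  obtain rfl : c = c' := funext fun k => (key' k).1
  obtain rfl : na = na' := funext fun k => (key' k).2.1
  obtain rfl : r = r' := funext fun k => funext fun a => ((key' k).2.2 a).1
  obtain rfl : q = q' := funext fun k => funext fun a => ((key' k).2.2 a).2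
  rfl

/-! ## Search problems with real-valued solutions -/

/-- A search problem whose solutions are vectors of real numbers. -/
structure SearchProblem where
  /-- the instances -/
  Inst : Type
  /-- the coordinates of the solutions of an instance -/
  Coord : Inst → Type
  /-- the solutions of an instance -/
  IsSol : (I : Inst) → (Coord I → ℝ) → Prop
  /-- binary encoding of an instance together with one of its coordinates -/
  encode : (Σ I : Inst, Coord I) → List Computability.Γ'
  encode_injective : Function.Injective encode

/-- Computing a stationary Nash equilibrium of an `N`-player discounted perfect-information
stochastic game: a solution lists the probabilities of all actions in all states. -/
def stationaryNash (N : ℕ) : SearchProblem where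
  Inst := Game N
  Coord G := G.Step
  IsSol G v := ∃ x : G.Stationary, G.IsNash x.toProfile ∧ ∀ p : G.Step, v p = (x p.1 p.2).toReal
  encode := fun ⟨G, p⟩ => encodeNats ((p.1 : ℕ) :: (p.2 : ℕ) :: G.code)
  encode_injective := by
    rintro ⟨G, k, a⟩ ⟨G', k', a'⟩ h
    have h' := encodeNats_injective h
    simp only [List.cons.injEq] at h'
    obtain ⟨h1, h2, h3⟩ := h'
    obtain rfl := Game.code_injective h3
    obtain rfl := Fin.ext h1
    obtain rfl := Fin.ext h2
    rfl

/-! ## The sum-of-square-roots problem -/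

/-- An instance: positive integers `a₁, …, aₙ` and `t`. -/
structure SqrtSumInstance where
  a : List ℕ+
  t : ℕ+

/-- The yes-instances: the sum of the square roots is at most `t`. -/
def SqrtSumInstance.IsYes (I : SqrtSumInstance) : Prop :=
  (I.a.map fun z => Real.sqrt ((z : ℕ) : ℝ)).sum ≤ ((I.t : ℕ) : ℝ)

/-- The integers `t, a₁, …, aₙ` in binary. -/
def SqrtSumInstance.encode (I : SqrtSumInstance) : List Computability.Γ' :=
  encodeNats ((I.t : ℕ) :: I.a.map fun z => (z : ℕ))

/-- A search problem `P` is hard for the sum-of-square-roots problem: some polynomial-time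
computable function maps every instance `I` to an instance of `P` that has a solution, together
with a coordinate, such that in every solution this coordinate equals `1` if `I` is a yes-instance
and `0` otherwise. -/
def SqrtSumHard (P : SearchProblem) : Prop :=
  ∃ f : SqrtSumInstance → Σ J : P.Inst, P.Coord J,
    Nonempty (Turing.TM2ComputableInPolyTime SqrtSumInstance.encode P.encode f) ∧
    ∀ I : SqrtSumInstance,
      (∃ v, P.IsSol (f I).1 v) ∧
      ∀ v, P.IsSol (f I).1 v →
        (I.IsYes → v (f I).2 = 1) ∧ (¬ I.IsYes → v (f I).2 = 0)

end

end StochasticGames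

namespace StochasticGames

/-! ## The square root gadget -/

/-! The reduction rests on a gadget with rational data in which, at every stationary equilibrium,
one player's value is a fixed rational multiple of the square root of a reward. It has four states
A, B, C, D, owned by players 0, 1, 2, 1, and discount factor 1/2. Players 0 and 1 play matching
pennies on the cycle A–B, players 2 and 1 on the cycle C–D; quitting at A may lead to D and quitting
at C leads to B, which couples the cycles. In matching pennies both players must mix, hence both are
indifferent (`matching_pennies`). Indifference of player 1 at B and D fixes the quitting
probabilities 1/2 at A and 1/4 at C. Indifference of players 0 and 2 leaves polynomial equations for
the quitting probabilities at B and D, the value of player 0 at D and the value `u` of player 2 at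
B. Elimination yields `u ^ 2 = 400 / 9 * b`, where `b` is the reward of player 2 for quitting at B
(`gadget_elimination`). The delicate point of `GadgetEq.value` is that neither cycle can degenerate;
`exists_gadgetEq` solves the equations in the other direction.

The game has one gadget per radicand, an absorbing state of value zero owned by player 3, and a
state in which player 2 chooses between a sure reward proportional to `t` and a uniform lottery over
the states B of all gadgets and the absorbing state. The lottery is worth a multiple of the sum of
the square roots, so the choice decides the instance unless there is a tie. A sum of square roots of
positive integers is rational only if all radicands are squares (`isSquare_of_sum_sqrt_eq`, by a
trace argument). In that case the sum is an integer, and replacing `2 * t` by `2 * t + 1` in the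
comparison of doubled quantities avoids the tie. Whether all radicands are squares can be tested in
polynomial time.

Behavioral deviations reduce to deviations in a single round by the one-shot deviation principle
(`Game.isNash_iff`), so equilibria are exactly the solutions of the equations and inequalities
above.

For polynomial time, string functions are built from closure properties, the main one being folds
with polynomially bounded intermediate results (`PolyTime.foldl`). They are realized by structured
stack programs, which compile to the stack machines of `Turing.TM2`. Scaling by powers of two and
writing digits with the least significant first leaves almost no arithmetic in the code of the game.
-/

theorem convex_comb_le {t x y z : ℝ} (h0 : 0 ≤ t) (h1 : t ≤ 1) (hz : z = t * x + (1 - t) * y) :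
    z ≤ x ∨ z ≤ y := by
  rcases le_total x y with h | h
  · right; rw [hz]; nlinarith
  · left; rw [hz]; nlinarith

/-- An action played with positive probability must be optimal. This lemma and `eq_right_of_optimal`
turn equilibrium inequalities into equations. -/
theorem eq_left_of_optimal {t x y z : ℝ} (h0 : 0 < t) (h1 : t ≤ 1)
    (hz : z = t * x + (1 - t) * y) (hx : x ≤ z) (hy : y ≤ z) : z = x := by
  rcases eq_or_lt_of_le hx with h | h
  · exact h.symm
  · nlinarith [mul_pos h0 (sub_pos.2 h), mul_nonneg (sub_nonneg.2 h1) (sub_nonneg.2 hy)]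

theorem eq_right_of_optimal {t x y z : ℝ} (h0 : 0 ≤ t) (h1 : t < 1)
    (hz : z = t * x + (1 - t) * y) (hx : x ≤ z) (hy : y ≤ z) : z = y := by
  rcases eq_or_lt_of_le hy with h | h
  · exact h.symm
  · nlinarith [mul_nonneg h0 (sub_nonneg.2 hx), mul_pos (sub_pos.2 h1) (sub_pos.2 h)]

/-- In a matching-pennies cycle both players mix, and so both are indifferent. -/
theorem matching_pennies {p q A B α μ A' B' ξ : ℝ} (hp0 : 0 ≤ p) (hp1 : p ≤ 1)
    (hq0 : 0 ≤ q) (hq1 : q ≤ 1) (hA : A = p * α + (1 - p) * (B / 2)) (hA1 : α ≤ A)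
    (hA2 : B / 2 ≤ A) (hB : B = q * μ + (1 - q) * (A / 2)) (hα : 0 < α) (hαμ : α < μ / 2)
    (hA' : A' = p * ξ + (1 - p) * (1 + B' / 2)) (hB' : B' = q * (1 / 2) + (1 - q) * (A' / 2))
    (hB1 : 1 / 2 ≤ B') (hB2 : A' / 2 ≤ B') (hξ : ξ < 1) :
    A = α ∧ B = 2 * α ∧ A' = 1 ∧ B' = 1 / 2 ∧ 0 < q := by
  -- If `p = 1`, then `A' = ξ < 1`, so the player at B strictly prefers to quit; then `B = μ`, and
  -- `μ / 2 > α` makes continuing at A profitable.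
  have hp1' : p < 1 := by
    rcases eq_or_lt_of_le hp1 with rfl | h
    · exfalso
      have : q = 1 := by
        rcases eq_or_lt_of_le hq1 with h | h
        · exact h
        · have := eq_right_of_optimal hq0 h hB' hB1 hB2
          linarith
      subst this
      linarith
    · exact h
  -- If `p = 0`, waiting at B is worth at least `5 / 8`, so nobody ever quits; then `A = B / 2 = A /
  -- 4` forces `A = 0 < α`.
  have hp0' : 0 < p := by
    rcases eq_or_lt_of_le hp0 with rfl | h
    · exfalso
      have : q = 0 := by
        rcases eq_or_lt_of_le hq0 with h | h
        · exact h.symm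
        · have := eq_left_of_optimal h hq1 hB' hB1 hB2
          linarith
      subst this
      linarith
    · exact h
  have e1 := eq_left_of_optimal hp0' hp1 hA hA1 hA2
  have e2 := eq_right_of_optimal hp0 hp1' hA hA1 hA2
  have hq0' : 0 < q := by
    rcases eq_or_lt_of_le hq0 with rfl | h
    · linarith
    · exact h
  have hq1' : q < 1 := by
    rcases eq_or_lt_of_le hq1 with rfl | h
    · linarith
    · exact h
  have e3 := eq_left_of_optimal hq0' hq1 hB' hB1 hB2
  have e4 := eq_right_of_optimal hq0 hq1' hB' hB1 hB2
  exact ⟨e1, by linarith, by linarith, e3, hq0'⟩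

/-- The equilibrium conditions of the gadget. `p`, `q`, `r`, `w` are the probabilities to quit in
the four states, and `A`, `B`, `C`, `D` are the values of the states for the first three players,
before normalization. -/
structure GadgetEq (a b : ℝ) (p q r w : ℝ) (A B C D : Fin 3 → ℝ) : Prop where
  p0 : 0 ≤ p
  p1 : p ≤ 1
  q0 : 0 ≤ q
  q1 : q ≤ 1
  r0 : 0 ≤ r
  r1 : r ≤ 1
  w0 : 0 ≤ w
  w1 : w ≤ 1
  hA0 : A 0 = p * (D 0 / 4) + (1 - p) * (B 0 / 2)
  hA1 : A 1 = p * (5 / 8 + D 1 / 4) + (1 - p) * (1 + B 1 / 2)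
  hA2 : A 2 = p * (a + D 2 / 4) + (1 - p) * (B 2 / 2)
  hB0 : B 0 = q * (16 / 25) + (1 - q) * (A 0 / 2)
  hB1 : B 1 = q * (1 / 2) + (1 - q) * (A 1 / 2)
  hB2 : B 2 = q * b + (1 - q) * (1 + A 2 / 2)
  hC0 : C 0 = r * (B 0 / 2) + (1 - r) * (D 0 / 2)
  hC1 : C 1 = r * (B 1 / 2) + (1 - r) * (1 + D 1 / 2)
  hC2 : C 2 = r * (B 2 / 2) + (1 - r) * (D 2 / 2)
  hD0 : D 0 = w * (7 / 25) + (1 - w) * (1 + C 0 / 2)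
  hD1 : D 1 = w * (1 / 2) + (1 - w) * (C 1 / 2)
  hD2 : D 2 = w * 1 + (1 - w) * (C 2 / 2)
  optAq : D 0 / 4 ≤ A 0
  optAc : B 0 / 2 ≤ A 0
  optBq : 1 / 2 ≤ B 1
  optBc : A 1 / 2 ≤ B 1
  optCq : B 2 / 2 ≤ C 2
  optCc : D 2 / 2 ≤ C 2
  optDq : 1 / 2 ≤ D 1
  optDc : C 1 / 2 ≤ D 1

theorem le_convex_comb {t x y z : ℝ} (h0 : 0 ≤ t) (h1 : t ≤ 1)
    (hz : z = t * x + (1 - t) * y) : x ≤ z ∨ y ≤ z := by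
  rcases le_total x y with h | h
  · left; rw [hz]; nlinarith
  · right; rw [hz]; nlinarith

/-- A value lies below one of the two alternatives that it averages. Following these alternatives
from state to state, discounting closes every one of the sixteen linear systems. The two lemmas
below use the same argument for lower bounds. -/
theorem cycle_bounds_one {A B C D : ℝ} (hA : A ≤ 5 / 8 + D / 4 ∨ A ≤ 1 + B / 2)
    (hB : B ≤ 1 / 2 ∨ B ≤ A / 2) (hC : C ≤ B / 2 ∨ C ≤ 1 + D / 2) (hD : D ≤ 1 / 2 ∨ D ≤ C / 2) :
    B ≤ 1 ∧ D ≤ 1 := by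
  rcases hA with hA | hA <;> rcases hB with hB | hB <;> rcases hC with hC | hC <;>
  rcases hD with hD | hD <;> constructor <;> linarith

theorem cycle_bounds_zero {A B C D : ℝ} (hA : D / 4 ≤ A ∨ B / 2 ≤ A)
    (hB : 16 / 25 ≤ B ∨ A / 2 ≤ B) (hC : B / 2 ≤ C ∨ D / 2 ≤ C)
    (hD : 7 / 25 ≤ D ∨ 1 + C / 2 ≤ D) : 0 ≤ A ∧ 0 ≤ B ∧ 0 ≤ C ∧ 0 ≤ D := by
  rcases hA with hA | hA <;> rcases hB with hB | hB <;> rcases hC with hC | hC <;>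
  rcases hD with hD | hD <;> refine ⟨?_, ?_, ?_, ?_⟩ <;> linarith

theorem cycle_bounds_two {a b A B C D : ℝ} (ha : 0 < a) (hb : 0 < b)
    (hA : a + D / 4 ≤ A ∨ B / 2 ≤ A) (hB : b ≤ B ∨ 1 + A / 2 ≤ B) (hC : B / 2 ≤ C ∨ D / 2 ≤ C)
    (hD : 1 ≤ D ∨ C / 2 ≤ D) : 0 ≤ A ∧ 0 < B ∧ 0 ≤ C ∧ 0 ≤ D := by
  rcases hA with hA | hA <;> rcases hB with hB | hB <;> rcases hC with hC | hC <;>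
  rcases hD with hD | hD <;> refine ⟨?_, ?_, ?_, ?_⟩ <;> linarith

/-- The first three equations make `w`, then `D`, then `q` linear fractional functions of `u`, with
`1 - q = 100 * u / (100 + 21 * u)`. In the last one the terms linear in `u` cancel, and the
coefficient `79 / 25` is chosen so that the terms in `u * b` cancel too. -/
theorem gadget_elimination {b q w u D : ℝ}
    (hw : u = w * 1 + (1 - w) * (u / 2 / 2))
    (hD : D = w * (7 / 25) + (1 - w) * (1 + 7 / 16 * D / 2))
    (hq : 2 * (D / 4) = q * (16 / 25) + (1 - q) * (D / 4 / 2))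
    (hu : u = q * b + (1 - q) * (1 + (79 / 25 * b / 2 + 3 / 8 * u) / 2)) :
    u ^ 2 = 400 / 9 * b := by
  have hw' : w * (4 - u) = 3 * u := by linarith
  have hD' : D * (100 - 4 * u) = 32 / 25 * (100 - 79 * u) := by
    linear_combination (4 - u) * 32 * hD - (7 * D + 576 / 25) * hw'
  have hq' : q * (100 + 21 * u) = 100 - 79 * u := by
    linear_combination -(25 / 12) * (100 - 4 * u) * hq + 25 / 96 * (3 + q) * hD'
  linear_combination 4 / 9 * ((100 + 21 * u) * hu + (b - (1 + 79 / 100 * b + 3 / 16 * u)) * hq')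

theorem GadgetEq.value {a b p q r w : ℝ} {A B C D : Fin 3 → ℝ}
    (h : GadgetEq a b p q r w A B C D) (hb : 0 < b) (hb1 : b ≤ 1 / 6241) (hab : a = 79 / 25 * b) :
    B 2 = 20 / 3 * Real.sqrt b := by
  obtain ⟨p0, p1, q0, q1, r0, r1, w0, w1, hA0, hA1, hA2, hB0, hB1, hB2, hC0, hC1, hC2, hD0, hD1,
    hD2, optAq, optAc, optBq, optBc, optCq, optCc, optDq, optDc⟩ := h
  generalize A 0 = A0, A 1 = A1, A 2 = A2, B 0 = B0, B 1 = B1, B 2 = u, C 0 = C0, C 1 = C1,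
    C 2 = C2, D 0 = D0, D 1 = D1, D 2 = D2 at *
  have ha : 0 < a := by rw [hab]; positivity
  have bd2 : B1 ≤ 1 ∧ D1 ≤ 1 := cycle_bounds_one (convex_comb_le p0 p1 hA1)
    (convex_comb_le q0 q1 hB1) (convex_comb_le r0 r1 hC1) (convex_comb_le w0 w1 hD1)
  have bd0 : 0 ≤ A0 ∧ 0 ≤ B0 ∧ 0 ≤ C0 ∧ 0 ≤ D0 := cycle_bounds_zero
    (le_convex_comb p0 p1 hA0) (le_convex_comb q0 q1 hB0) (le_convex_comb r0 r1 hC0)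
    (le_convex_comb w0 w1 hD0)
  have bd3 : 0 ≤ A2 ∧ 0 < u ∧ 0 ≤ C2 ∧ 0 ≤ D2 := cycle_bounds_two ha hb
    (le_convex_comb p0 p1 hA2) (le_convex_comb q0 q1 hB2) (le_convex_comb r0 r1 hC2)
    (le_convex_comb w0 w1 hD2)
  have hD0pos : 0 < D0 := by
    rcases le_convex_comb w0 w1 hD0 with h4 | h4 <;> linarith
  -- The cycle A–B is a genuine game of matching pennies once quitting at A pays player 0 less than
  -- waiting for B to quit. For the cycle C–D the corresponding condition is `u < 1`. Both
  -- conditions have to be derived.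
  have X : D0 / 4 < 8 / 25 → A0 = D0 / 4 ∧ B0 = 2 * (D0 / 4) ∧ A1 = 1 ∧ B1 = 1 / 2 ∧ 0 < q := by
    intro hα
    exact matching_pennies p0 p1 q0 q1 hA0 optAq optAc hB0 (by linarith) (by linarith) hA1 hB1
      optBq optBc (by linarith)
  have hu1 : u < 1 := by
    by_contra hu
    push Not at hu
    -- If `w < 1`, then `D2 < u`, so player 2 strictly prefers B at C and `C1 = B1 / 2 ≤ 1 / 2`. But
    -- player 1 continues at D with positive probability, hence `D1 = C1 / 2 ≤ 1 / 4`, less than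
    -- quitting gives.
    have hw : w = 1 := by
      by_contra hw
      have hw1 : w < 1 := lt_of_le_of_ne w1 hw
      have hDu : D2 < u := by
        by_contra hDu
        push Not at hDu
        have hC : C2 ≤ D2 / 2 := by
          rcases convex_comb_le r0 r1 hC2 with h | h <;> linarith
        rcases convex_comb_le w0 w1 hD2 with h | h
        · have : D2 ≤ w * 1 + (1 - w) * (D2 / 4) := by
            linarith [mul_nonneg (sub_nonneg.2 w1) (sub_nonneg.2 hC)]
          linarith [mul_nonneg (sub_nonneg.2 (hu.trans hDu)) (by linarith : (0 : ℝ) ≤ 3 + w)]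
        · linarith
      have hr : r = 1 := by
        by_contra hr
        have := eq_right_of_optimal r0 (lt_of_le_of_ne r1 hr) hC2 optCq optCc
        linarith
      subst hr
      have := eq_right_of_optimal w0 hw1 hD1 optDq optDc
      linarith
    subst hw
    -- With D always quitting, the first cycle is nondegenerate and all its probabilities are
    -- explicit. The resulting linear equation for `u` has a solution below 1 since `b` is small.
    have hD0' : D0 = 7 / 25 := by linarith
    obtain ⟨e1, e2, e3, e4, -⟩ := X (by rw [hD0']; norm_num)
    have hD1' : D1 = 1 / 2 := by linarith
    have hp : p = 1 / 2 := by rw [e3, e4, hD1'] at hA1; linarith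
    have hq : q = 21 / 121 := by rw [e1, e2, hD0'] at hB0; linarith
    subst hp hq
    linarith
  obtain ⟨e1, e2, e3, e4, hw⟩ : C2 = u / 2 ∧ D2 = 2 * (u / 2) ∧ C1 = 1 ∧ D1 = 1 / 2 ∧ 0 < w :=
    matching_pennies r0 r1 w0 w1 hC2 optCq optCc hD2 (by linarith) (by linarith) hC1 hD1
      optDq optDc (by linarith)
  -- Otherwise `D0 ≥ 32 / 25`. Player 1's indifference at C–D forces `r ≥ 1 / 4`, and B is worth at
  -- most `D0 / 2` to player 0, so `C0 ≤ 7 / 16 * D0`. Since `32 / 25` is the fixed point of `D ↦ 1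
  -- + 7 / 32 * D` and D quits with positive probability, `D0` would be smaller than that.
  have hα : D0 / 4 < 8 / 25 := by
    by_contra hα
    push Not at hα
    have hB : B0 / 2 ≤ D0 / 4 := by
      rcases convex_comb_le p0 p1 hA0 with h1 | h1 <;>
      rcases convex_comb_le q0 q1 hB0 with h2 | h2 <;> linarith
    have hr : 1 / 4 ≤ r := by
      rw [e3, e4] at hC1
      linarith [mul_nonneg r0 (sub_nonneg.2 optBq)]
    have hC : C0 ≤ D0 * (7 / 16) := by
      linarith [mul_nonneg r0 (sub_nonneg.2 hB), mul_nonneg (sub_nonneg.2 hr) hD0pos.le]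
    have : D0 ≤ w * (7 / 25) + (1 - w) * (1 + D0 * (7 / 32)) := by
      linarith [mul_nonneg (sub_nonneg.2 w1) (sub_nonneg.2 hC)]
    linarith [mul_nonneg (sub_nonneg.2 hα) (by linarith : (0 : ℝ) ≤ 25 + 7 * w)]
  obtain ⟨f1, f2, f3, f4, hq⟩ := X hα
  have hp : p = 1 / 2 := by rw [f3, f4, e4] at hA1; linarith
  have hr : r = 1 / 4 := by rw [e3, f4, e4] at hC1; linarith
  subst hp hr
  have hC0' : C0 = 7 / 16 * D0 := by rw [hC0, f2]; ring
  have hA2' : A2 = a / 2 + 3 / 8 * u := by rw [hA2, e2]; ring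
  rw [hC0'] at hD0
  rw [e2, e1, mul_div_cancel₀ _ two_ne_zero] at hD2
  rw [f1, f2] at hB0
  rw [hA2', hab] at hB2
  have hu2 : u ^ 2 = 400 / 9 * b := gadget_elimination hD2 hD0 hB0 hB2
  have : u = Real.sqrt (400 / 9 * b) := by
    rw [← hu2, Real.sqrt_sq bd3.2.1.le]
  rw [this, Real.sqrt_mul (by norm_num)]
  congr 1
  rw [show (400 / 9 : ℝ) = (20 / 3) ^ 2 by norm_num, Real.sqrt_sq (by norm_num)]

theorem exists_gadgetEq {a b : ℝ} (hb : 0 < b) (hb1 : b ≤ 1 / 6241) (hab : a = 79 / 25 * b) :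
    ∃ p q r w A B C D, GadgetEq a b p q r w A B C D := by
  set u : ℝ := 20 / 3 * Real.sqrt b with hu
  have hs : 0 < Real.sqrt b := Real.sqrt_pos.2 hb
  have hu0 : 0 < u := by positivity
  have hb2 : b = 9 / 400 * u ^ 2 := by
    rw [hu, mul_pow, Real.sq_sqrt hb.le]; ring
  have hu1 : u ≤ 1 / 10 := by
    have : u ^ 2 ≤ (1 / 10) ^ 2 := by nlinarith
    exact (pow_le_pow_iff_left₀ hu0.le (by norm_num) two_ne_zero).1 this
  have h4 : 0 < 4 - u := by linarith
  have h1 : 0 < 25 - u := by linarith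
  have h2 : 0 < 100 + 21 * u := by linarith
  have h3 : 0 < 100 - 79 * u := by linarith
  clear_value u
  obtain ⟨D0, hD0⟩ : ∃ D0, D0 = 8 / 25 * ((100 - 79 * u) / (25 - u)) := ⟨_, rfl⟩
  -- These are the solutions of the indifference equations, as in `gadget_elimination`. The bound `u
  -- ≤ 1 / 10` keeps the probabilities in the unit interval.
  refine ⟨1 / 2, (100 - 79 * u) / (100 + 21 * u), 1 / 4, 3 * u / (4 - u),
    ![D0 / 4, 1, a / 2 + 3 / 8 * u], ![D0 / 2, 1 / 2, u], ![7 / 16 * D0, 1, u / 2],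
    ![D0, 1 / 2, u], ?_⟩
  have hD0' : D0 / 2 = (4 / 25) * ((100 - 79 * u) / (25 - u)) := by rw [hD0]; ring
  constructor <;> try simp only [Matrix.cons_val_zero, Matrix.cons_val_one, Matrix.cons_val]
  all_goals first | positivity | (norm_num; done) | skip
  all_goals first | linarith | skip
  · rw [div_le_one h2]; linarith
  · rw [div_le_one h4]; linarith
  · rw [hD0]
    field_simp
    ring
  · rw [hab, hb2]
    field_simp
    ring
  · rw [hD0]
    field_simp
    ring
  · field_simp
    ring

end StochasticGames

namespace StochasticGames

noncomputable section

/-! ## Stack programs -/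

/-- Structured programs that work on stacks indexed by the natural numbers. -/
inductive StackProg (Γ : Type) : Type
  /-- do nothing -/
  | skip : StackProg Γ
  /-- push a symbol -/
  | push (k : ℕ) (s : Γ) : StackProg Γ
  /-- pop a symbol and branch on it -/
  | pop (k : ℕ) (f : Option Γ → StackProg Γ) : StackProg Γ
  /-- sequential composition -/
  | seq (p q : StackProg Γ) : StackProg Γ
  /-- as long as a stack is nonempty, pop a symbol from it and act on it -/
  | loop (k : ℕ) (f : Γ → StackProg Γ) : StackProg Γ

namespace StackProg

variable {Γ : Type}

/-- Big-step semantics with running time. -/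
inductive Exec : StackProg Γ → (ℕ → List Γ) → (ℕ → List Γ) → ℕ → Prop
  | skip (S) : Exec skip S S 1
  | push (k s S) : Exec (push k s) S (Function.update S k (s :: S k)) 1
  | pop {k f S S' n} :
      Exec (f (S k).head?) (Function.update S k (S k).tail) S' n → Exec (pop k f) S S' (n + 1)
  | seq {p q S S' S'' n n'} : Exec p S S' n → Exec q S' S'' n' → Exec (seq p q) S S'' (n + n')
  | loop_nil {k f S} : S k = [] → Exec (loop k f) S S 1
  | loop_cons {k f S s l S' S'' n n'} : S k = s :: l →
      Exec (f s) (Function.update S k l) S' n → Exec (loop k f) S' S'' n' →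
      Exec (loop k f) S S'' (n + n' + 1)

/-! ### Compilation to stack machines -/

/-- A bound for the indices of the stacks that a program uses. -/
def bound [Fintype Γ] : StackProg Γ → ℕ
  | skip => 0
  | push k _ => k + 1
  | pop k f => max (k + 1) (Finset.univ.sup fun o => (f o).bound)
  | seq p q => max p.bound q.bound
  | loop k f => max (k + 1) (Finset.univ.sup fun s => (f s).bound)

/-- The labels of the compiled program. -/
def Label : StackProg Γ → Type
  | skip => Unit
  | push _ _ => Unit
  | pop _ f => Option (Σ o, (f o).Label)
  | seq p q => p.Label ⊕ q.Label
  | loop _ f => Option (Σ s, (f s).Label)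

instance [Fintype Γ] : (p : StackProg Γ) → Fintype p.Label
  | skip => inferInstanceAs (Fintype Unit)
  | push _ _ => inferInstanceAs (Fintype Unit)
  | pop _ f => by
      haveI := fun o => instFintypeLabel (f o)
      exact inferInstanceAs (Fintype (Option (Σ o, (f o).Label)))
  | seq p q => by
      haveI := instFintypeLabel p
      haveI := instFintypeLabel q
      exact inferInstanceAs (Fintype (p.Label ⊕ q.Label))
  | loop _ f => by
      haveI := fun o => instFintypeLabel (f o)
      exact inferInstanceAs (Fintype (Option (Σ s, (f s).Label)))

/-- The label where execution starts. -/
def entry : (p : StackProg Γ) → p.Label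
  | skip => ()
  | push _ _ => ()
  | pop _ _ => none
  | seq p _ => .inl p.entry
  | loop _ _ => none

/-- The statements of a stack machine that executes a program and continues at the label `exit`. -/
def compile {K Λ : Type} (κ : ℕ → K) (exit : Λ) :
    (p : StackProg Γ) → (p.Label → Λ) → p.Label → Turing.TM2.Stmt (fun _ : K => Γ) Λ (Option Γ)
  | skip, _, _ => .goto fun _ => exit
  | push k s, _, _ => .push (κ k) (fun _ => s) (.goto fun _ => exit)
  | pop k f, e, none => .pop (κ k) (fun _ o => o) (.goto fun o => e (some ⟨o, (f o).entry⟩))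
  | pop _ f, e, some ⟨o, l⟩ => compile κ exit (f o) (fun l => e (some ⟨o, l⟩)) l
  | seq p q, e, .inl l => compile κ (e (.inr q.entry)) p (fun l => e (.inl l)) l
  | seq _ q, e, .inr l => compile κ exit q (fun l => e (.inr l)) l
  | loop k f, e, none => .pop (κ k) (fun _ o => o) (.goto fun o =>
      o.elim exit fun s => e (some ⟨s, (f s).entry⟩))
  | loop _ f, e, some ⟨s, l⟩ => compile κ (e none) (f s) (fun l => e (some ⟨s, l⟩)) l

theorem update_comp_fin {N : ℕ} (S : ℕ → List Γ) (k : ℕ) (hk : k < N) (x : List Γ) :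
    (fun i : Fin N => Function.update S k x i) =
      Function.update (fun i : Fin N => S i) ⟨k, hk⟩ x := by
  funext i
  by_cases h : i = ⟨k, hk⟩
  · subst h; simp
  · have : (i : ℕ) ≠ k := fun h' => h (Fin.ext h')
    rw [Function.update_of_ne h, Function.update_of_ne this]

/-- The time in `Exec` charges one unit for each machine statement, so it is the exact number of
steps. The label type, the embedding `e` and the exit are arbitrary because the induction descends
into subprograms, whose labels are part of a larger machine and whose exit is the entry of what
follows. -/
theorem iterate_step_of_exec [Fintype Γ] {p : StackProg Γ} {S S' : ℕ → List Γ} {n : ℕ}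
    (h : Exec p S S' n) {N : ℕ} (hN : p.bound ≤ N) {κ : ℕ → Fin N}
    (hκ : ∀ k (hk : k < N), κ k = ⟨k, hk⟩) {Λ : Type}
    (M : Λ → Turing.TM2.Stmt (fun _ : Fin N => Γ) Λ (Option Γ)) (e : p.Label → Λ) (exit : Λ)
    (hM : ∀ l, M (e l) = compile κ exit p e l) (v : Option Γ) :
    ∃ v', (flip bind (Turing.TM2.step M))^[n] (some ⟨some (e p.entry), v, fun i => S i⟩) =
      some ⟨some exit, v', fun i => S' i⟩ := by
  induction h generalizing Λ exit v with
  | skip S =>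
    have h0 : M (e (entry skip)) = .goto fun _ => exit := hM _
    exact ⟨v, by simp [flip, h0]⟩
  | push k s S =>
    have hk : k < N := hN
    have h0 : M (e (entry (push k s))) = .push (κ k) (fun _ => s) (.goto fun _ => exit) := hM _
    refine ⟨v, ?_⟩
    rw [hκ k hk] at h0
    simp [flip, h0, update_comp_fin _ _ hk]
  | @pop k f S S' n _ ih =>
    have hk : k < N := (le_max_left _ _).trans hN
    have hf : (f (S k).head?).bound ≤ N :=
      ((Finset.le_sup (f := fun o => (f o).bound) (Finset.mem_univ _)).trans
        (le_max_right _ _)).trans hN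
    have h0 : M (e (entry (pop k f))) = .pop (κ k) (fun _ o => o)
      (.goto fun o => e (some ⟨o, (f o).entry⟩)) := hM none
    obtain ⟨v', h⟩ := ih hf M (fun l => e (some ⟨_, l⟩)) exit (fun l => hM (some ⟨_, l⟩))
      (S k).head?
    refine ⟨v', ?_⟩
    rw [Function.iterate_succ_apply, ← h]
    congr 1
    rw [hκ k hk] at h0
    simp [flip, h0, update_comp_fin _ _ hk]
  | @seq p q S S' S'' n n' _ _ ih1 ih2 =>
    obtain ⟨v1, h1⟩ := ih1 ((le_max_left _ _).trans hN) M (fun l => e (.inl l))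
      (e (.inr q.entry)) (fun l => hM (.inl l)) v
    obtain ⟨v2, h2⟩ := ih2 ((le_max_right _ _).trans hN) M (fun l => e (.inr l)) exit
      (fun l => hM (.inr l)) v1
    refine ⟨v2, ?_⟩
    rw [add_comm, Function.iterate_add_apply]
    exact (congrArg _ h1).trans h2
  | @loop_nil k f S hS =>
    have hk : k < N := (le_max_left _ _).trans hN
    have h0 : M (e (entry (loop k f))) = .pop (κ k) (fun _ o => o) (.goto fun o =>
      o.elim exit fun s => e (some ⟨s, (f s).entry⟩)) := hM none
    refine ⟨none, ?_⟩
    have h2 : Function.update (fun i : Fin N => S i) ⟨k, hk⟩ [] = fun i : Fin N => S i := by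
      rw [← update_comp_fin, ← hS, Function.update_eq_self]
    rw [hκ k hk] at h0
    simp [flip, h0, hS, h2]
  | @loop_cons k f S s l S' S'' n n' hS _ _ ih1 ih2 =>
    have hk : k < N := (le_max_left _ _).trans hN
    have hf : (f s).bound ≤ N :=
      ((Finset.le_sup (f := fun o => (f o).bound) (Finset.mem_univ _)).trans
        (le_max_right _ _)).trans hN
    have h0 : M (e (entry (loop k f))) = .pop (κ k) (fun _ o => o) (.goto fun o =>
      o.elim exit fun s => e (some ⟨s, (f s).entry⟩)) := hM none
    obtain ⟨v1, h1⟩ := ih1 hf M (fun l => e (some ⟨s, l⟩)) (e none)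
      (fun l => hM (some ⟨s, l⟩)) (some s)
    obtain ⟨v2, h2⟩ := ih2 hN M e exit hM v1
    refine ⟨v2, ?_⟩
    rw [Function.iterate_succ_apply, add_comm, Function.iterate_add_apply, ← h2]
    congr 1
    refine Eq.trans ?_ h1
    congr 1
    rw [hκ k hk] at h0
    simp [flip, h0, update_comp_fin _ _ hk, hS]

/-- The stack machine that executes a program, with input on stack `0` and output on stack `1`. -/
def machine [Fintype Γ] (p : StackProg Γ) : Turing.FinTM2 where
  K := Fin (p.bound + 2)
  k₀ := 0
  k₁ := 1
  Γ _ := Γ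
  Λ := Option p.Label
  main := some p.entry
  σ := Option Γ
  initialState := none
  Γk₀Fin := inferInstanceAs (Fintype Γ)
  m
    -- A final configuration must carry the initial internal state, so the last popped symbol is
    -- erased. This is the extra step in `machine_outputs`.
    | none => .load (fun _ => none) .halt
    | some l => compile (Fin.ofNat (p.bound + 2)) none p some l

theorem machine_outputs [Fintype Γ] {p : StackProg Γ} {x y : List Γ} {n : ℕ}
    (h : Exec p (Function.update (fun _ => []) 0 x) (Function.update (fun _ => []) 1 y) n) :
    Nonempty (Turing.TM2OutputsInTime p.machine x (some y) (n + 1)) := by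
  obtain ⟨v, hv⟩ := iterate_step_of_exec h (N := p.bound + 2) (by omega)
    (κ := Fin.ofNat (p.bound + 2)) (fun k hk => Fin.ext (Nat.mod_eq_of_lt hk)) p.machine.m some none
    (fun l => rfl) none
  refine ⟨⟨⟨n + 1, ?_⟩, le_rfl⟩⟩
  have e1 : Turing.initList p.machine x = ⟨some (some p.entry), none,
      fun i : Fin (p.bound + 2) => Function.update (fun _ => []) 0 x (i : ℕ)⟩ := by
    unfold Turing.initList
    congr 1
    funext i
    by_cases hi : i = (0 : Fin (p.bound + 2))
    · exact (dif_pos hi).trans (by subst hi; rfl)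
    · have : Fin.val (n := p.bound + 2) i ≠ 0 := fun h' => hi (Fin.ext h')
      exact (dif_neg hi).trans (Function.update_of_ne (f := fun _ => []) this x).symm
  have e2 : Turing.haltList p.machine y = ⟨none, none,
      fun i : Fin (p.bound + 2) => Function.update (fun _ => []) 1 y (i : ℕ)⟩ := by
    unfold Turing.haltList
    congr 1
    funext i
    by_cases hi : i = (1 : Fin (p.bound + 2))
    · exact (dif_pos hi).trans (by subst hi; rfl)
    · have : Fin.val (n := p.bound + 2) i ≠ 1 := fun h' => hi (Fin.ext (by simpa using h'))
      exact (dif_neg hi).trans (Function.update_of_ne (f := fun _ => []) this y).symm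
  rw [e1, add_comm, Function.iterate_add_apply]
  refine (congrArg _ hv).trans (Eq.trans ?_ (congrArg some e2.symm))
  rfl

end StackProg

end

end StochasticGames

namespace StochasticGames

noncomputable section

/-! ## Polynomial bounds -/

/-- `c` is bounded by a polynomial in `s`. -/
def PolyBdd {α : Type} (s c : α → ℕ) : Prop := ∃ P : Polynomial ℕ, ∀ x, c x ≤ P.eval (s x)

theorem polynomial_eval_mono (P : Polynomial ℕ) {m n : ℕ} (h : m ≤ n) : P.eval m ≤ P.eval n := by
  rw [Polynomial.eval_eq_sum_range, Polynomial.eval_eq_sum_range]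
  gcongr

namespace PolyBdd

variable {α : Type} {s c d : α → ℕ}

theorem mono (h : PolyBdd s d) (hcd : ∀ x, c x ≤ d x) : PolyBdd s c :=
  h.imp fun _ hP x => (hcd x).trans (hP x)

theorem const (n : ℕ) : PolyBdd s fun _ => n := ⟨Polynomial.C n, by simp⟩

theorem self : PolyBdd s s := ⟨Polynomial.X, by simp⟩

theorem add (hc : PolyBdd s c) (hd : PolyBdd s d) : PolyBdd s fun x => c x + d x := by
  obtain ⟨P, hP⟩ := hc
  obtain ⟨Q, hQ⟩ := hd
  exact ⟨P + Q, fun x => by rw [Polynomial.eval_add]; exact add_le_add (hP x) (hQ x)⟩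

theorem mul (hc : PolyBdd s c) (hd : PolyBdd s d) : PolyBdd s fun x => c x * d x := by
  obtain ⟨P, hP⟩ := hc
  obtain ⟨Q, hQ⟩ := hd
  exact ⟨P * Q, fun x => by rw [Polynomial.eval_mul]; exact Nat.mul_le_mul (hP x) (hQ x)⟩

theorem trans (hc : PolyBdd s c) (hd : PolyBdd c d) : PolyBdd s d := by
  obtain ⟨P, hP⟩ := hc
  obtain ⟨Q, hQ⟩ := hd
  exact ⟨Q.comp P, fun x => (hQ x).trans <| by
    rw [Polynomial.eval_comp]; exact polynomial_eval_mono _ (hP x)⟩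

theorem sum {ι : Type} (t : Finset ι) {f : ι → α → ℕ} (h : ∀ i ∈ t, PolyBdd s (f i)) :
    PolyBdd s fun x => ∑ i ∈ t, f i x := by
  classical
  induction t using Finset.induction_on with
  | empty => simpa using const 0
  | insert i t hi ih =>
    simp only [Finset.sum_insert hi]
    exact (h i (Finset.mem_insert_self _ _)).add
      (ih fun j hj => h j (Finset.mem_insert_of_mem hj))

end PolyBdd

/-! ## Polynomial-time string functions -/

namespace StackProg

variable {Γ : Type}

/-- Execution within a given time. -/
def ExecLe (p : StackProg Γ) (S S' : ℕ → List Γ) (n : ℕ) : Prop := ∃ k ≤ n, Exec p S S' k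

theorem ExecLe.mono {p : StackProg Γ} {S S' : ℕ → List Γ} {n n' : ℕ} (h : ExecLe p S S' n)
    (hn : n ≤ n') : ExecLe p S S' n' :=
  let ⟨k, hk, e⟩ := h
  ⟨k, hk.trans hn, e⟩

theorem ExecLe.congr {p : StackProg Γ} {S S' S'' : ℕ → List Γ} {n n' : ℕ} (h : ExecLe p S S' n)
    (hS : S' = S'') (hn : n ≤ n') : ExecLe p S S'' n' :=
  hS ▸ h.mono hn

theorem ExecLe.seq {p q : StackProg Γ} {S S' S'' : ℕ → List Γ} {n n' : ℕ} (h : ExecLe p S S' n)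
    (h' : ExecLe q S' S'' n') : ExecLe (seq p q) S S'' (n + n') :=
  let ⟨_, hk, e⟩ := h
  let ⟨_, hk', e'⟩ := h'
  ⟨_, add_le_add hk hk', .seq e e'⟩

theorem ExecLe.pop {k : ℕ} {f : Option Γ → StackProg Γ} {S S' : ℕ → List Γ} {n : ℕ}
    (h : ExecLe (f (S k).head?) (Function.update S k (S k).tail) S' n) :
    ExecLe (pop k f) S S' (n + 1) :=
  let ⟨_, hk, e⟩ := h
  ⟨_, Nat.succ_le_succ hk, .pop e⟩

/-- Empty a stack. -/
def clear (k : ℕ) : StackProg Γ := loop k fun _ => skip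

theorem clear_exec (k : ℕ) (S : ℕ → List Γ) :
    ExecLe (clear k) S (Function.update S k []) (2 * (S k).length + 1) := by
  generalize hl : S k = l
  induction l generalizing S with
  | nil => exact ⟨1, by simp, by rw [← hl, Function.update_eq_self]; exact .loop_nil hl⟩
  | cons s l ih =>
    obtain ⟨n, hn, e⟩ := ih (Function.update S k l) (by simp)
    rw [Function.update_idem] at e
    exact ⟨1 + n + 1, by simp; omega, .loop_cons hl (.skip _) e⟩

/-- Move a stack on top of another one, reversing it. -/
def move (a b : ℕ) : StackProg Γ := loop a fun s => push b s

theorem move_exec {a b : ℕ} (hab : a ≠ b) (S : ℕ → List Γ) :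
    ExecLe (move a b) S (Function.update (Function.update S a []) b ((S a).reverse ++ S b))
      (2 * (S a).length + 1) := by
  generalize hl : S a = l
  induction l generalizing S with
  | nil =>
    refine ⟨1, by simp, ?_⟩
    rw [← hl, Function.update_eq_self]
    simp only [hl, List.reverse_nil, List.nil_append, Function.update_eq_self]
    exact .loop_nil hl
  | cons s l ih =>
    have e1 := Exec.push b s (Function.update S a l)
    obtain ⟨n, hn, e⟩ := ih (Function.update (Function.update S a l) b
      (s :: Function.update S a l b)) (by simp [hab])
    refine ⟨1 + n + 1, by simp; omega, .loop_cons hl e1 ?_⟩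
    refine Eq.subst (motive := fun T => Exec _ _ T n) ?_ e
    funext i
    by_cases h1 : i = b
    · subst h1; simp [hab.symm]
    · by_cases h2 : i = a
      · subst h2; simp [h1]
      · simp [h1, h2]

/-- Move a stack on top of another one, with the help of a temporary stack. -/
def transfer (a b t : ℕ) : StackProg Γ := seq (move a t) (move t b)

theorem transfer_exec {a b t : ℕ} (hab : a ≠ b) (hat : a ≠ t) (hbt : b ≠ t) (S : ℕ → List Γ)
    (ht : S t = []) :
    ExecLe (transfer a b t) S (Function.update (Function.update S a []) b (S a ++ S b))
      (4 * (S a).length + 2) := by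
  refine ((move_exec hat S).seq (move_exec hbt.symm _)).congr ?_ ?_
  · funext i
    by_cases h1 : i = b
    · subst h1; simp [hab.symm, hbt, ht]
    · by_cases h2 : i = a
      · subst h2; simp [h1, hat]
      · by_cases h3 : i = t
        · subst h3; simp [h1, h2, ht]
        · simp [h1, h2, h3]
  · simp [ht]; omega

/-- Copy a stack on top of another one, with the help of a temporary stack. -/
def copy (a b t : ℕ) : StackProg Γ :=
  seq (move a t) (loop t fun s => seq (push a s) (push b s))

theorem copy_back_exec {a b t : ℕ} (hab : a ≠ b) (hat : a ≠ t) (hbt : b ≠ t) (S : ℕ → List Γ) :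
    ExecLe (loop t fun s => seq (push a s) (push b s)) S
      (Function.update (Function.update (Function.update S t []) a ((S t).reverse ++ S a)) b
        ((S t).reverse ++ S b)) (3 * (S t).length + 1) := by
  generalize hl : S t = l
  induction l generalizing S with
  | nil =>
    refine ⟨1, by simp, ?_⟩
    rw [← hl, Function.update_eq_self]
    simp only [hl, List.reverse_nil, List.nil_append, Function.update_eq_self]
    exact .loop_nil hl
  | cons s l ih =>
    have e1 := Exec.seq (Exec.push a s (Function.update S t l)) (Exec.push b s _)
    obtain ⟨n, hn, e⟩ := ih (Function.update (Function.update (Function.update S t l) a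
      (s :: Function.update S t l a)) b (s :: Function.update (Function.update S t l) a
      (s :: Function.update S t l a) b)) (by simp [hat.symm, hbt.symm])
    refine ⟨1 + 1 + n + 1, by simp; omega, .loop_cons hl e1 ?_⟩
    convert e using 1
    funext i
    by_cases h1 : i = b
    · subst h1; simp [hab.symm, hbt]
    · by_cases h2 : i = a
      · subst h2; simp [h1, hat]
      · by_cases h3 : i = t
        · subst h3; simp [h1, h2]
        · simp [h1, h2, h3]

theorem copy_exec {a b t : ℕ} (hab : a ≠ b) (hat : a ≠ t) (hbt : b ≠ t) (S : ℕ → List Γ)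
    (ht : S t = []) (hb : S b = []) :
    ExecLe (copy a b t) S (Function.update S b (S a)) (5 * (S a).length + 2) := by
  refine ((move_exec hat S).seq (copy_back_exec hab hat hbt _)).congr ?_ ?_
  · funext i
    by_cases h1 : i = b
    · subst h1; simp [hab.symm, hbt, ht, hb]
    · by_cases h2 : i = a
      · subst h2; simp [h1, hat, ht]
      · by_cases h3 : i = t
        · subst h3; simp [h1, h2, ht]
        · simp [h1, h2, h3]
  · simp [ht]; omega

/-- Push a string. -/
def pushAll (k : ℕ) : List Γ → StackProg Γ
  | [] => skip
  | s :: l => seq (pushAll k l) (push k s)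

theorem pushAll_exec (k : ℕ) (l : List Γ) (S : ℕ → List Γ) :
    ExecLe (pushAll k l) S (Function.update S k (l ++ S k)) (l.length + 1) := by
  induction l with
  | nil => exact ⟨1, by simp, by simpa [pushAll] using Exec.skip (Γ := Γ) S⟩
  | cons s l ih =>
    obtain ⟨n, hn, e⟩ := ih
    refine ⟨n + 1, by simpa using hn, .seq e ?_⟩
    convert Exec.push k s _ using 1
    simp

end StackProg

open StackProg

variable {Γ α β : Type}

/-- The total length of some strings that depend on `x`. -/
def totalLength (v : List (α → List Γ)) (x : α) : ℕ := (v.map fun g => (g x).length).sum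

/-- The string `f x` can be computed in polynomial time from the strings `g x` with `g` in `v`:
wherever these strings are stored in the first `m` stacks, there is a program that writes `f x` to
stack number `m`, provided that the stacks from there on are empty. -/
structure PolyTime (v : List (α → List Γ)) (f : α → List Γ) : Prop where
  length : PolyBdd (totalLength v) fun x => (f x).length
  prog : ∀ (loc : List ℕ) (m : ℕ), (∀ k ∈ loc, k < m) →
    ∃ (p : StackProg Γ) (c : α → ℕ), PolyBdd (totalLength v) c ∧
      ∀ (x : α) (S : ℕ → List Γ), loc.map S = v.map (fun g => g x) → (∀ j, m ≤ j → S j = []) →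
        ExecLe p S (Function.update S m (f x)) (c x)

theorem length_le_totalLength {v : List (α → List Γ)} {f : α → List Γ} (hf : f ∈ v) (x : α) :
    (f x).length ≤ totalLength v x :=
  List.single_le_sum (by simp) _ (List.mem_map.2 ⟨f, hf, rfl⟩)

theorem map_update_of_lt {loc : List ℕ} {m : ℕ} (hloc : ∀ k ∈ loc, k < m) (S : ℕ → List Γ)
    (y : List Γ) : loc.map (Function.update S m y) = loc.map S :=
  List.map_congr_left fun k hk => Function.update_of_ne (hloc k hk).ne _ _

namespace PolyTime

variable {v v' : List (α → List Γ)} {f g : α → List Γ}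

theorem var (hf : f ∈ v) : PolyTime v f where
  length := PolyBdd.self.mono (length_le_totalLength hf)
  prog loc m hloc := by
    obtain ⟨i, hi, rfl⟩ := List.getElem_of_mem hf
    refine ⟨copy (loc.getD i 0) m (m + 1), fun x => 5 * (v[i] x).length + 2, ?_, ?_⟩
    · exact ((PolyBdd.const 5).mul (PolyBdd.self.mono (length_le_totalLength hf))).add
        (PolyBdd.const 2)
    · intro x S h hS
      have hl : i < loc.length := by
        have := congrArg List.length h
        simp only [List.length_map] at this
        omega
      have e : S (loc.getD i 0) = v[i] x := by
        have := congrArg (fun l => l[i]?) h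
        simpa [hl, hi] using this
      have hm : loc.getD i 0 < m := by
        rw [List.getD_eq_getElem _ _ hl]; exact hloc _ (List.getElem_mem hl)
      change ExecLe _ _ _ (5 * (v[i] x).length + 2)
      rw [← e]
      exact copy_exec hm.ne (by omega) (Nat.lt_succ_self m).ne S (hS _ (by omega)) (hS _ le_rfl)

theorem const (l : List Γ) : PolyTime v fun _ => l where
  length := PolyBdd.const _
  prog loc m _ := by
    refine ⟨pushAll m l, fun _ => l.length + 1, PolyBdd.const _, fun x S _ hS => ?_⟩
    simpa [hS m le_rfl] using pushAll_exec m l S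

/-- Composition: the string `g x` on stack `m` serves as one more input of `f`, whose output appears
on stack `m + 1` and is moved down once `g x` has been cleared. -/
theorem cut (hg : PolyTime v g) (hf : PolyTime (g :: v) f) : PolyTime v f := by
  have hsz : PolyBdd (totalLength v) (totalLength (g :: v)) := by
    exact (hg.length.add PolyBdd.self).mono fun x => by simp [totalLength]
  refine ⟨hsz.trans hf.length, fun loc m hloc => ?_⟩
  obtain ⟨p, c, hc, hp⟩ := hg.prog loc m hloc
  obtain ⟨q, d, hd, hq⟩ := hf.prog (m :: loc) (m + 1) (by
    simp only [List.mem_cons, forall_eq_or_imp]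
    exact ⟨by omega, fun k hk => (hloc k hk).trans (Nat.lt_succ_self m)⟩)
  refine ⟨seq p (seq q (seq (clear m) (transfer (m + 1) m (m + 2)))),
    fun x => c x + (d x + ((2 * (g x).length + 1) + (4 * (f x).length + 2))), ?_, ?_⟩
  · exact hc.add ((hsz.trans hd).add ((((PolyBdd.const 2).mul hg.length).add (PolyBdd.const 1)).add
      (((PolyBdd.const 4).mul (hsz.trans hf.length)).add (PolyBdd.const 2))))
  · intro x S h hS
    refine ExecLe.seq (hp x S h hS) ?_
    refine ExecLe.seq (hq x _ ?_ ?_) ?_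
    · simp [map_update_of_lt hloc, h]
    · intro j hj
      rw [Function.update_of_ne (by omega)]
      exact hS j (by omega)
    · have e1 := clear_exec m
        (Function.update (Function.update S m (g x)) (m + 1) (f x))
      have e2 := transfer_exec (a := m + 1) (b := m) (t := m + 2) (by omega) (by omega) (by omega)
        (Function.update (Function.update (Function.update S m (g x)) (m + 1) (f x)) m [])
        (by simp [hS])
      have := (e1.seq e2)
      simp only [ne_eq, Nat.ne_add_one, not_false_eq_true, Function.update_of_ne,
        Function.update_self, Nat.add_one_ne_self, List.append_nil] at this
      convert this using 1
      funext i
      by_cases h1 : i = m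
      · subst h1; simp
      · by_cases h2 : i = m + 1
        · subst h2; simp [hS]
        · simp [h1, h2]

theorem append (hf : PolyTime v f) (hg : PolyTime v g) : PolyTime v fun x => f x ++ g x := by
  refine ⟨by simpa using hf.length.add hg.length, fun loc m hloc => ?_⟩
  obtain ⟨p, c, hc, hp⟩ := hf.prog loc m hloc
  obtain ⟨q, d, hd, hq⟩ := hg.prog loc (m + 1) (fun k hk => (hloc k hk).trans (Nat.lt_succ_self m))
  refine ⟨seq p (seq q (seq (transfer m (m + 1) (m + 2)) (transfer (m + 1) m (m + 2)))),
    fun x => c x + (d x + ((4 * (f x).length + 2) + (4 * ((f x).length + (g x).length) + 2))),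
    ?_, ?_⟩
  · exact hc.add (hd.add ((((PolyBdd.const 4).mul hf.length).add (PolyBdd.const 2)).add
      (((PolyBdd.const 4).mul (hf.length.add hg.length)).add (PolyBdd.const 2))))
  · intro x S h hS
    refine ExecLe.seq (hp x S h hS) ?_
    refine ExecLe.seq (hq x _ ?_ ?_) ?_
    · simp [map_update_of_lt hloc, h]
    · intro j hj
      rw [Function.update_of_ne (by omega)]
      exact hS j (by omega)
    · have e1 := transfer_exec (a := m) (b := m + 1) (t := m + 2) (by omega) (by omega) (by omega)
        (Function.update (Function.update S m (f x)) (m + 1) (g x)) (by simp [hS])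
      have e2 := transfer_exec (a := m + 1) (b := m) (t := m + 2) (by omega) (by omega) (by omega)
        _ (by simp [hS]) |> e1.seq
      simp only [ne_eq, Nat.ne_add_one, not_false_eq_true, Function.update_of_ne,
        Function.update_self, Function.update_idem, List.append_nil,
        List.length_append] at e2
      convert e2 using 1
      funext i
      by_cases h1 : i = m
      · subst h1; simp
      · by_cases h2 : i = m + 1
        · subst h2; simp [hS]
        · simp [h1, h2]

/-- Branching needs a finite alphabet: the cost and length bounds are sums over all possible heads.
-/
theorem cases (hg : PolyTime v g) {h : Option Γ → α → List Γ} [Fintype Γ]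
    (hh : ∀ o, PolyTime v (h o)) : PolyTime v fun x => h (g x).head? x := by
  classical
  refine ⟨(PolyBdd.sum Finset.univ fun o _ => (hh o).length).mono fun x =>
    Finset.single_le_sum (f := fun o => (h o x).length) (fun _ _ => Nat.zero_le _)
      (Finset.mem_univ _), fun loc m hloc => ?_⟩
  obtain ⟨p, c, hc, hp⟩ := hg.prog loc m hloc
  choose q d hd hq using fun o => (hh o).prog loc m hloc
  refine ⟨seq p (pop m fun o => seq (clear m) (q o)),
    fun x => c x + ((2 * (g x).length + 1) + (∑ o, d o x) + 1), ?_, ?_⟩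
  · exact hc.add (((((PolyBdd.const 2).mul hg.length).add (PolyBdd.const 1)).add
      (PolyBdd.sum Finset.univ fun o _ => hd o)).add (PolyBdd.const 1))
  · intro x S hx hS
    refine ExecLe.seq (hp x S hx hS) (ExecLe.pop ?_)
    simp only [Function.update_self, Function.update_idem]
    have e1 := clear_exec m (Function.update S m (g x).tail)
    have hSm : Function.update (Function.update S m (g x).tail) m [] = S := by
      rw [Function.update_idem, ← hS m le_rfl, Function.update_eq_self]
    rw [hSm] at e1
    refine (e1.seq (hq (g x).head? x S hx hS)).mono (add_le_add ?_ ?_)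
    · simp
    · exact Finset.single_le_sum (f := fun o => d o x) (fun _ _ => Nat.zero_le _)
        (Finset.mem_univ _)

theorem tail (hf : PolyTime v f) : PolyTime v fun x => (f x).tail := by
  refine ⟨hf.length.mono fun x => by simp, fun loc m hloc => ?_⟩
  obtain ⟨p, c, hc, hp⟩ := hf.prog loc m hloc
  refine ⟨seq p (pop m fun _ => skip), fun x => c x + (1 + 1), hc.add (PolyBdd.const _), ?_⟩
  intro x S hx hS
  refine ExecLe.seq (hp x S hx hS) (ExecLe.pop ?_)
  simp only [Function.update_self, Function.update_idem]
  exact ⟨1, le_rfl, .skip _⟩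

end PolyTime

end

end StochasticGames

namespace StochasticGames

noncomputable section

open StackProg

variable {Γ α β : Type}

/-! ### Folds -/

/-- The stacks `S` below `m`, and the strings of `L` from there on. -/
def frame (S : ℕ → List Γ) (m : ℕ) (L : List (List Γ)) : ℕ → List Γ :=
  fun i => if i < m then S i else L.getD (i - m) []

theorem frame_of_lt {S : ℕ → List Γ} {m i : ℕ} (L : List (List Γ)) (h : i < m) :
    frame S m L i = S i := if_pos h

theorem frame_add (S : ℕ → List Γ) (m i : ℕ) (L : List (List Γ)) :
    frame S m L (m + i) = L.getD i [] := by
  simp [frame]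

theorem frame_of_le {S : ℕ → List Γ} {m i : ℕ} (L : List (List Γ)) (h : m ≤ i) :
    frame S m L i = L.getD (i - m) [] := if_neg (by omega)

theorem frame_nil {S : ℕ → List Γ} {m : ℕ} (hS : ∀ j, m ≤ j → S j = []) : frame S m [] = S := by
  funext i
  by_cases h : i < m
  · exact frame_of_lt _ h
  · rw [frame_of_le _ (by omega), hS i (by omega)]; rfl

theorem frame_update_self {S : ℕ → List Γ} {m : ℕ} {y : List Γ} {L : List (List Γ)} :
    frame (Function.update S m y) (m + 1) L = frame S m (y :: L) := by
  funext i
  rcases lt_trichotomy i m with h | rfl | h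
  · rw [frame_of_lt _ (by omega), frame_of_lt _ h, Function.update_of_ne h.ne]
  · rw [frame_of_lt _ (by omega), frame_of_le _ le_rfl]; simp
  · rw [frame_of_le _ (by omega), frame_of_le _ h.le]
    rw [show i - m = (i - (m + 1)) + 1 by omega]; rfl

theorem update_frame_zero {S : ℕ → List Γ} {m : ℕ} {y z : List Γ} {L : List (List Γ)} :
    Function.update (frame S m (y :: L)) m z = frame S m (z :: L) := by
  funext i
  rcases lt_trichotomy i m with h | rfl | h
  · rw [Function.update_of_ne h.ne, frame_of_lt _ h, frame_of_lt _ h]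
  · simp [frame_of_le]
  · rw [Function.update_of_ne h.ne', frame_of_le _ h.le, frame_of_le _ h.le]
    rw [show i - m = (i - (m + 1)) + 1 by omega]; rfl

theorem map_frame_of_lt {loc : List ℕ} {m : ℕ} (hloc : ∀ k ∈ loc, k < m) (S : ℕ → List Γ)
    (L : List (List Γ)) : loc.map (frame S m L) = loc.map S :=
  List.map_congr_left fun k hk => frame_of_lt _ (hloc k hk)

namespace PolyTime

variable {v : List (α → List Γ)}

/-- Several strings can be computed one after the other. -/
theorem progList {w : List (α → List Γ)} (hw : ∀ g ∈ w, PolyTime v g) (loc : List ℕ) (m : ℕ)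
    (hloc : ∀ k ∈ loc, k < m) :
    ∃ (p : StackProg Γ) (c : α → ℕ), PolyBdd (totalLength v) c ∧
      ∀ (x : α) (S : ℕ → List Γ), loc.map S = v.map (fun g => g x) → (∀ j, m ≤ j → S j = []) →
        ExecLe p S (frame S m (w.map fun g => g x)) (c x) := by
  induction w generalizing m with
  | nil =>
    exact ⟨skip, fun _ => 1, PolyBdd.const _, fun x S _ hS => by
      rw [List.map_nil, frame_nil hS]; exact ⟨1, le_rfl, .skip _⟩⟩
  | cons g w ih =>
    obtain ⟨p, c, hc, hp⟩ := (hw g (by simp)).prog loc m hloc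
    obtain ⟨q, d, hd, hq⟩ := ih (fun g' hg' => hw g' (by simp [hg'])) (m + 1)
      (fun k hk => (hloc k hk).trans (Nat.lt_succ_self m))
    refine ⟨seq p q, fun x => c x + d x, hc.add hd, fun x S h hS => ?_⟩
    refine (hp x S h hS).seq ?_
    rw [List.map_cons, ← frame_update_self]
    refine hq x _ (by rw [map_update_of_lt hloc, h]) fun j hj => ?_
    rw [Function.update_of_ne (by omega)]
    exact hS j (by omega)

end PolyTime

namespace StackProg

/-- Empty the stacks `a, …, a + k - 1`. -/
def clearRange (a : ℕ) : ℕ → StackProg Γ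
  | 0 => skip
  | k + 1 => seq (clearRange a k) (clear (a + k))

theorem clearRange_exec (a k : ℕ) (S : ℕ → List Γ) :
    ExecLe (clearRange a k) S (fun i => if a ≤ i ∧ i < a + k then [] else S i)
      (2 * (∑ i ∈ Finset.range k, (S (a + i)).length) + k + 1) := by
  induction k with
  | zero =>
    refine ⟨1, by simp, ?_⟩
    have : (fun i => if a ≤ i ∧ i < a + 0 then [] else S i) = S := by
      funext i
      rw [if_neg (by omega)]
    rw [this]
    exact .skip S
  | succ k ih =>
    refine (ih.seq (clear_exec (a + k) _)).congr ?_ ?_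
    · funext i
      by_cases h : i = a + k
      · subst h; simp
      · rw [Function.update_of_ne h]
        congr 1
        simp only [eq_iff_iff]
        omega
    · rw [if_neg (by omega), Finset.sum_range_succ]
      omega

/-- Replace the stacks `a, …, a + k - 1` by the next `k` stacks; stack `t` is used temporarily. -/
def shift (a k t : ℕ) : ℕ → StackProg Γ
  | 0 => skip
  | j + 1 => seq (shift a k t j) (seq (clear (a + j)) (transfer (a + k + j) (a + j) t))

theorem shift_exec (a k t : ℕ) (S : ℕ → List Γ) (ht : S t = []) (hat : a + 2 * k ≤ t) (j : ℕ)
    (hj : j ≤ k) :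
    ExecLe (shift a k t j) S
      (fun i => if a ≤ i ∧ i < a + j then S (i + k) else
        if a + k ≤ i ∧ i < a + k + j then [] else S i)
      (2 * (∑ i ∈ Finset.range j, (S (a + i)).length) +
        4 * (∑ i ∈ Finset.range j, (S (a + k + i)).length) + 3 * j + 1) := by
  induction j with
  | zero =>
    refine ⟨1, by simp, ?_⟩
    have : (fun i => if a ≤ i ∧ i < a + 0 then S (i + k) else
        if a + k ≤ i ∧ i < a + k + 0 then [] else S i) = S := by
      funext i
      rw [if_neg (by omega), if_neg (by omega)]
    rw [this]
    exact .skip S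
  | succ j ih =>
    refine ((ih (by omega)).seq ((clear_exec (a + j) _).seq
      (transfer_exec (a := a + k + j) (b := a + j) (t := t) (by omega) (by omega) (by omega)
        _ ?_))).congr ?_ ?_
    · rw [Function.update_of_ne (by omega), if_neg (by omega), if_neg (by omega), ht]
    · funext i
      by_cases h : i = a + j
      · subst h
        rw [Function.update_self, if_pos (by omega), Function.update_of_ne (by omega),
          Function.update_self, if_neg (by omega), if_neg (by omega), List.append_nil]
        congr 1
        omega
      · rw [Function.update_of_ne h]
        by_cases h' : i = a + k + j
        · subst h'
          rw [Function.update_self, if_neg (by omega), if_pos (by omega)]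
        · rw [Function.update_of_ne h', Function.update_of_ne h]
          have e1 : (a ≤ i ∧ i < a + (j + 1)) ↔ (a ≤ i ∧ i < a + j) := by omega
          have e2 : (a + k ≤ i ∧ i < a + k + (j + 1)) ↔ (a + k ≤ i ∧ i < a + k + j) := by omega
          simp only [e1, e2]
    · rw [if_neg (by omega), if_neg (by omega), Function.update_of_ne (by omega),
        if_neg (by omega), if_neg (by omega), Finset.sum_range_succ, Finset.sum_range_succ]
      omega

end StackProg

theorem sum_range_frame_length (S : ℕ → List Γ) (m : ℕ) (L L' : List (List Γ)) :
    ∑ i ∈ Finset.range L.length, (frame S m (L ++ L') (m + i)).length =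
      (L.map List.length).sum := by
  simp only [frame_add]
  induction L using List.reverseRecOn generalizing L' with
  | nil => simp
  | append_singleton L l ih =>
    have := ih (l :: L')
    simp only [List.append_assoc, List.singleton_append] at this ⊢
    rw [List.length_append, List.length_singleton, Finset.sum_range_succ, this]
    simp

theorem sum_range_frame_length' (S : ℕ → List Γ) (m : ℕ) (L L' : List (List Γ)) :
    ∑ i ∈ Finset.range L'.length, (frame S m (L ++ L') (m + L.length + i)).length =
      (L'.map List.length).sum := by
  rw [← sum_range_frame_length S m L' []]
  refine Finset.sum_congr rfl fun i hi => ?_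
  rw [add_assoc, frame_add, frame_add, List.getD_append_right _ _ _ _ (by omega)]
  simp

theorem shift_frame {m : ℕ} {S : ℕ → List Γ} {L L' : List (List Γ)} (h : L.length = L'.length) :
    ExecLe (shift m L.length (m + 2 * L.length) L.length) (frame S m (L ++ L')) (frame S m L')
      (2 * (L.map List.length).sum + 4 * (L'.map List.length).sum + 3 * L.length + 1) := by
  refine (shift_exec m L.length (m + 2 * L.length) (frame S m (L ++ L')) ?_ le_rfl L.length
    le_rfl).congr ?_ ?_
  · rw [frame_add, List.getD_eq_default]
    simp; omega
  · funext i
    by_cases h1 : i < m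
    · rw [if_neg (by omega), if_neg (by omega), frame_of_lt _ h1, frame_of_lt _ h1]
    · obtain ⟨i, rfl⟩ := Nat.exists_eq_add_of_le (not_lt.1 h1)
      by_cases h2 : i < L.length
      · rw [if_pos (by omega), add_assoc, frame_add, frame_add, List.getD_append_right _ _ _ _
          (by omega)]
        congr 1
        omega
      · rw [if_neg (by omega), frame_add S m i L', List.getD_eq_default L' _ (by omega)]
        split_ifs with h3
        · rfl
        · rw [frame_add, List.getD_eq_default]
          simp; omega
  · rw [sum_range_frame_length]
    conv_lhs => enter [1, 1, 2, 2, 1]; rw [h]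
    rw [sum_range_frame_length']

namespace PolyTime

variable {v : List (α → List Γ)}

/-- A string function defined by a fold whose intermediate results are polynomially bounded is
computable in polynomial time. -/
theorem foldl [Fintype Γ] {w : List (β → List Γ)} {l : α → List Γ} {init : α → β}
    {step : α → β → Γ → β} (hl : PolyTime v l) (hinit : ∀ g ∈ w, PolyTime v fun x => g (init x))
    (hstep : ∀ s, ∀ g ∈ w, PolyTime (v.map (fun h (y : α × β) => h y.1) ++
      w.map (fun h (y : α × β) => h y.2)) fun y => g (step y.1 y.2 s))
    {b : α → ℕ} (hb : PolyBdd (totalLength v) b)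
    (hbound : ∀ x l', l' <+: l x → totalLength w (l'.foldl (step x) (init x)) ≤ b x)
    {g : β → List Γ} (hg : g ∈ w) : PolyTime v fun x => g ((l x).foldl (step x) (init x)) := by
  classical
  refine ⟨hb.mono fun x => (length_le_totalLength hg _).trans (hbound x _ List.prefix_rfl),
    fun loc m hloc => ?_⟩
  obtain ⟨i, hi, rfl⟩ := List.getElem_of_mem hg
  set k := w.length with hk
  obtain ⟨p₁, c₁, hc₁, hp₁⟩ := hl.prog loc m hloc
  obtain ⟨p₂, c₂, hc₂, hp₂⟩ := progList (w := w.map fun g x => g (init x)) (v := v) (by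
    simpa using hinit) loc (m + 1) (fun k hk => (hloc k hk).trans (Nat.lt_succ_self m))
  have hloc' : ∀ j ∈ loc ++ List.range' (m + 1) k, j < m + 1 + k := by
    intro j hj
    rcases List.mem_append.1 hj with hj | hj
    · have := hloc j hj; omega
    · rw [List.mem_range'_1] at hj; omega
  choose p₃ c₃ hc₃ hp₃ using fun s => progList (w := w.map fun g (y : α × β) => g (step y.1 y.2 s))
    (by simpa using hstep s) (loc ++ List.range' (m + 1) k) (m + 1 + k) hloc'
  choose P hP using hc₃
  -- Stack `m` holds the unread letters, the next `k` stacks the components of the accumulator. The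
  -- new components are computed on the `k` stacks above and then shifted down over the old ones.
  set body : Γ → StackProg Γ := fun s =>
    seq (p₃ s) (shift (m + 1) k (m + 1 + 2 * k) k) with hbody
  -- A bound for one round that does not depend on the accumulator: its components have total length
  -- at most `b x`, and the shift costs twice the old plus four times the new length. Without such a
  -- bound on intermediate results a fold could grow exponentially.
  set C : α → ℕ := fun x => (∑ s, (P s).eval (totalLength v x + b x)) + (6 * b x + 3 * k + 1)
    with hC
  refine ⟨seq p₁ (seq p₂ (seq (loop m body)
      (seq (transfer (m + 1 + i) m (m + 1 + k)) (clearRange (m + 1) k)))),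
    fun x => c₁ x + (c₂ x + (((l x).length * (C x + 1) + 1) +
      ((4 * b x + 2) + (2 * b x + k + 1)))), ?_, ?_⟩
  · have hCb : PolyBdd (totalLength v) C := by
      refine PolyBdd.add (PolyBdd.sum _ fun s _ => ?_) ?_
      · exact (PolyBdd.self.add hb).trans ⟨P s, fun x => le_rfl⟩
      · exact (((PolyBdd.const 6).mul hb).add (PolyBdd.const _)).add (PolyBdd.const 1)
    exact hc₁.add (hc₂.add (((hl.length.mul (hCb.add (PolyBdd.const 1))).add
      (PolyBdd.const 1)).add ((((PolyBdd.const 4).mul hb).add (PolyBdd.const 2)).add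
      ((((PolyBdd.const 2).mul hb).add (PolyBdd.const _)).add (PolyBdd.const 1)))))
  intro x S hx hS
  -- The loop invariant, for an arbitrary accumulator `y`, so that the induction on the unread
  -- letters can replace `y` by the result of one step.
  have key : ∀ (r : List Γ) (y : β),
      (∀ l', l' <+: r → totalLength w (l'.foldl (step x) y) ≤ b x) →
      ExecLe (loop m body) (frame S m (r :: w.map fun g => g y))
        (frame S m ([] :: w.map fun g => g (r.foldl (step x) y))) (r.length * (C x + 1) + 1) := by
    intro r
    induction r with
    | nil =>
      intro y _
      refine ⟨1, by simp, .loop_nil ?_⟩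
      rw [frame_of_le _ le_rfl]; simp
    | cons s r ih =>
      intro y hy
      have h1 := ih (step x y s) fun l' hl' => hy (s :: l') (List.cons_prefix_cons.2 ⟨rfl, hl'⟩)
      have hy0 : totalLength w y ≤ b x := hy [] (List.nil_prefix)
      have hy1 : totalLength w (step x y s) ≤ b x := hy [s] (by simp)
      have e1 : ExecLe (body s) (frame S m (r :: w.map fun g => g y))
          (frame S m (r :: w.map fun g => g (step x y s))) (C x) := by
        have e2 := hp₃ s (x, y) (frame S m (r :: w.map fun g => g y)) (by
          rw [List.map_append, List.map_append, map_frame_of_lt hloc, hx]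
          congr 1
          · simp [List.map_map, Function.comp_def]
          · refine List.ext_getElem (by simp [hk]) fun j h1 h2 => ?_
            have hj : j < w.length := by simpa using h2
            simp only [List.getElem_map, List.getElem_range', one_mul]
            rw [show m + 1 + j = m + (j + 1) by omega, frame_add]
            simp [hj]) (by
          intro j hj
          rw [frame_of_le _ (by omega), List.getD_eq_default]
          simp; omega)
        have e3 : frame (frame S m (r :: w.map fun g => g y)) (m + 1 + k)
            ((w.map fun g (y : α × β) => g (step y.1 y.2 s)).map fun g => g (x, y)) =
            frame (Function.update S m r) (m + 1) ((w.map fun g => g y) ++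
              w.map fun g => g (step x y s)) := by
          rw [frame_update_self]
          funext j
          by_cases hj : j < m + 1 + k
          · rw [frame_of_lt _ hj]
            by_cases hj' : j < m
            · rw [frame_of_lt _ hj', frame_of_lt _ hj']
            · rw [frame_of_le _ (by omega), frame_of_le _ (by omega), ← List.cons_append,
                List.getD_append _ _ _ _ (by simp; omega)]
          · rw [frame_of_le _ (by omega), frame_of_le _ (by omega), ← List.cons_append,
              List.getD_append_right _ _ _ _ (by simp; omega), List.map_map]
            simp only [Function.comp_def, List.length_cons, List.length_map]
            congr 1
            omega
        rw [e3] at e2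
        have e4 := e2.seq (shift_frame (m := m + 1) (S := Function.update S m r)
          (L := w.map fun g => g y) (L' := w.map fun g => g (step x y s)) (by simp))
        simp only [List.length_map, frame_update_self, ← hk] at e4
        refine e4.mono (add_le_add ?_ ?_)
        · refine (hP s (x, y)).trans (le_trans ?_ (Finset.single_le_sum
            (f := fun s => (P s).eval (totalLength v x + b x)) (fun _ _ => Nat.zero_le _)
            (Finset.mem_univ s)))
          refine polynomial_eval_mono _ ?_
          have : totalLength (v.map (fun h (y : α × β) => h y.1) ++
              w.map (fun h (y : α × β) => h y.2)) (x, y) = totalLength v x + totalLength w y := by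
            simp [totalLength, Function.comp_def]
          rw [this]
          omega
        · have t0 : ((w.map fun g => g y).map List.length).sum = totalLength w y := by
            simp [totalLength, Function.comp_def]
          have t1 : ((w.map fun g => g (step x y s)).map List.length).sum =
              totalLength w (step x y s) := by
            simp [totalLength, Function.comp_def]
          rw [t0, t1]
          omega
      obtain ⟨n1, hn1, e1⟩ := e1
      obtain ⟨n2, hn2, e2⟩ := h1
      refine ⟨n1 + n2 + 1, ?_, .loop_cons (s := s) (l := r) ?_ ?_ e2⟩
      · rw [List.length_cons, add_mul]; omega
      · rw [frame_of_le _ le_rfl]; simp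
      · rwa [update_frame_zero]
  have e1 := hp₁ x S hx hS
  have e2 := hp₂ x (Function.update S m (l x)) (by rw [map_update_of_lt hloc, hx]) (by
    intro j hj
    rw [Function.update_of_ne (by omega)]
    exact hS j (by omega))
  rw [frame_update_self, List.map_map] at e2
  have e3 := key (l x) (init x) (hbound x)
  set T := frame S m ([] :: w.map fun g => g ((l x).foldl (step x) (init x))) with hT
  have e4 := transfer_exec (a := m + 1 + i) (b := m) (t := m + 1 + k) (by omega) (by omega)
    (by omega) T (by
      rw [hT, frame_of_le _ (by omega), List.getD_eq_default]
      simp; omega)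
  have e5 := clearRange_exec (m + 1) k
    (Function.update (Function.update T (m + 1 + i) []) m (T (m + 1 + i) ++ T m))
  refine e1.seq (e2.seq (e3.seq ((e4.seq e5).congr ?_ ?_)))
  · have hTi : T (m + 1 + i) = w[i] ((l x).foldl (step x) (init x)) := by
      rw [hT, add_assoc, frame_add, add_comm 1 i]
      simp [List.getElem?_eq_getElem (show i < w.length from hi)]
    have hTm : T m = [] := by rw [hT, frame_of_le _ le_rfl]; simp
    funext j
    rw [hTi, hTm, List.append_nil]
    rcases lt_trichotomy j m with h | rfl | h
    · rw [if_neg (by omega), Function.update_of_ne h.ne, Function.update_of_ne (by omega),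
        Function.update_of_ne h.ne, hT, frame_of_lt _ h]
    · rw [if_neg (by omega), Function.update_self, Function.update_self]
    · rw [Function.update_of_ne h.ne', Function.update_of_ne h.ne', hS j h.le]
      split_ifs with h1
      · rfl
      · rw [Function.update_of_ne (by omega), hT,
          frame_of_le _ h.le, List.getD_eq_default]
        simp; omega
  · have hTi : T (m + 1 + i) = w[i] ((l x).foldl (step x) (init x)) := by
      rw [hT, add_assoc, frame_add, add_comm 1 i]
      simp [List.getElem?_eq_getElem (show i < w.length from hi)]
    have t0 : ((w.map fun g => g ((l x).foldl (step x) (init x))).map List.length).sum =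
        totalLength w ((l x).foldl (step x) (init x)) := by
      simp [totalLength, Function.comp_def]
    have hb1 := hbound x (l x) List.prefix_rfl
    refine add_le_add ?_ ?_
    · rw [hTi]
      have := length_le_totalLength (List.getElem_mem hi) ((l x).foldl (step x) (init x))
      omega
    · have : ∑ j ∈ Finset.range k, (Function.update (Function.update T (m + 1 + i) []) m
          (T (m + 1 + i) ++ T m) (m + 1 + j)).length ≤
          ∑ j ∈ Finset.range k, (T (m + 1 + j)).length := by
        refine Finset.sum_le_sum fun j _ => ?_
        rw [Function.update_of_ne (by omega)]
        by_cases h : m + 1 + j = m + 1 + i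
        · rw [h, Function.update_self]; simp
        · rw [Function.update_of_ne h]
      have h2 : ∑ j ∈ Finset.range k, (T (m + 1 + j)).length =
          totalLength w ((l x).foldl (step x) (init x)) := by
        rw [← t0, hT, ← frame_update_self]
        have := sum_range_frame_length (Function.update S m []) (m + 1)
          (w.map fun g => g ((l x).foldl (step x) (init x))) []
        simpa using this
      omega

end PolyTime

/-- A function whose output string can be computed in polynomial time from its input string is
computable in polynomial time by a stack machine. -/
theorem PolyTime.tm2ComputableInPolyTime [Fintype Γ] {ea : α → List Γ} {eb : β → List Γ}
    {f : α → β} (h : PolyTime [ea] fun x => eb (f x)) :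
    Nonempty (Turing.TM2ComputableInPolyTime ea eb f) := by
  obtain ⟨p, c, ⟨P, hP⟩, hp⟩ := h.prog [0] 1 (by simp)
  -- The machine must halt with every stack but the output stack empty, so the input is cleared at
  -- the end.
  have key : ∀ x, Nonempty (Turing.TM2OutputsInTime (seq p (clear 0)).machine (ea x)
      (some (eb (f x))) ((P + (Polynomial.C 2 * Polynomial.X + Polynomial.C 1) + 1).eval
        (ea x).length)) := by
    intro x
    have e1 := hp x (Function.update (fun _ => []) 0 (ea x)) (by simp) (by
      intro j hj
      rw [Function.update_of_ne (by omega)])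
    have e2 := clear_exec 0 (Function.update (Function.update (fun _ => []) 0 (ea x)) 1
      (eb (f x)))
    obtain ⟨n, hn, e⟩ := (e1.seq e2).congr (S'' := Function.update (fun _ => []) 1 (eb (f x))) (by
      funext i
      by_cases h1 : i = 1
      · subst h1; simp
      · by_cases h0 : i = 0
        · subst h0; simp
        · simp [h0, h1]) le_rfl
    obtain ⟨h⟩ := machine_outputs e
    refine ⟨h.toEvalsTo, h.steps_le_m.trans ?_⟩
    have := hP x
    simp [totalLength] at this hn ⊢
    omega
  have h := fun x => (key x).some
  exact ⟨⟨(seq p (clear 0)).machine, Equiv.refl _, Equiv.refl _⟩, _, fun x => by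
    have e : ∀ l : List Γ, l.map (Equiv.refl Γ).invFun = l := fun l => List.map_id l
    exact cast (congrArg₂ (fun a b => Turing.TM2OutputsInTime (seq p (clear 0)).machine a (some b)
      ((P + (Polynomial.C 2 * Polynomial.X + Polynomial.C 1) + 1).eval (ea x).length))
      (e (ea x)).symm (e (eb (f x))).symm) (h x)⟩

end

end StochasticGames

namespace StochasticGames

noncomputable section

/-! ## One-step characterization of stationary equilibria -/

theorem integral_toMeasure_eq_sum {β : Type} [Fintype β] [MeasurableSpace β]
    [MeasurableSingletonClass β] (p : PMF β) (g : β → ℝ) :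
    ∫ b, g b ∂p.toMeasure = ∑ b, (p b).toReal * g b := by
  rw [PMF.integral_eq_sum]
  simp

namespace Game

variable {N : ℕ} (G : Game N)

instance : MeasurableSingletonClass G.Step := ⟨fun _ => MeasurableSet.of_discrete⟩

/-- The discount factor as a real number. -/
def gam : ℝ := G.discount.val

theorem gam_nonneg : 0 ≤ G.gam := G.discount.val.2

theorem gam_lt_one : G.gam < 1 := by
  have := G.discount_lt_one
  exact_mod_cast this

/-- The expectation of a function of the next state. -/
def nextSum (W : Fin G.numStates → ℝ) (p : G.Step) : ℝ :=
  ∑ l, ((G.trans p.1 p.2 l).val : ℝ) * W l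

/-- The reward of a round plus the discounted value of the next state. -/
def stepValue (ρ : G.Step → ℝ) (W : Fin G.numStates → ℝ) (p : G.Step) : ℝ :=
  ρ p + G.gam * G.nextSum W p

/-- The reward of a player as a real number. -/
def rew (i : Fin N) (p : G.Step) : ℝ := (G.reward p.1 p.2 i).val

theorem trans_sum_real (p : G.Step) : ∑ l, ((G.trans p.1 p.2 l).val : ℝ) = 1 := by
  have := G.trans_sum p.1 p.2
  exact_mod_cast this

theorem pmf_sum_toReal {β : Type} [Fintype β] (p : PMF β) : ∑ b, (p b).toReal = 1 := by
  have := p.tsum_coe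
  rw [tsum_fintype] at this
  rw [← ENNReal.toReal_sum fun b _ => p.apply_ne_top b, this, ENNReal.toReal_one]

theorem integral_actIn (k : Fin G.numStates) (α : PMF (Fin (G.numActions k))) (g : G.Step → ℝ) :
    ∫ y, g y ∂(G.actIn k α).toMeasure = ∑ a, (α a).toReal * g ⟨k, a⟩ := by
  have h : (G.actIn k α).toMeasure = α.toMeasure.map fun a => (⟨k, a⟩ : G.Step) :=
    (PMF.toMeasure_map (fun a => (⟨k, a⟩ : G.Step)) α (measurable_of_countable _)).symm
  rw [h, integral_map (measurable_of_countable _).aemeasurable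
      (measurable_of_countable _).aestronglyMeasurable, integral_toMeasure_eq_sum]

theorem integral_stepPMF (σ : G.Profile) (n : ℕ) (h : Fin (n + 1) → G.Step) (g : G.Step → ℝ) :
    ∫ y, g y ∂(G.stepPMF σ n h).toMeasure =
      G.nextSum (fun l => ∑ a, (σ (n + 1) h l a).toReal * g ⟨l, a⟩) (h (Fin.last n)) := by
  rw [integral_toMeasure_eq_sum]
  have e1 : ∀ y, ((G.stepPMF σ n h) y).toReal =
      ∑ l, ((G.trans (h (Fin.last n)).1 (h (Fin.last n)).2 l).val : ℝ) *
        (G.actIn l (σ (n + 1) h l) y).toReal := by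
    intro y
    rw [stepPMF, PMF.bind_apply, tsum_fintype, ENNReal.toReal_sum]
    · refine Finset.sum_congr rfl fun l _ => ?_
      rw [ENNReal.toReal_mul]
      rfl
    · exact fun l _ => ENNReal.mul_ne_top (PMF.apply_ne_top _ _) (PMF.apply_ne_top _ _)
  simp only [e1, Finset.sum_mul, nextSum]
  rw [Finset.sum_comm]
  refine Finset.sum_congr rfl fun l _ => ?_
  rw [← integral_actIn, integral_toMeasure_eq_sum, Finset.mul_sum]
  exact Finset.sum_congr rfl fun y _ => mul_assoc _ _ _

variable (s : Fin G.numStates) (σ : G.Profile)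

instance : IsProbabilityMeasure (G.playMeasure s σ) := by
  unfold playMeasure; infer_instance

theorem integrable_play (f : (ℕ → G.Step) → ℝ) (n : ℕ) (F : ((_ : Finset.Iic n) → G.Step) → ℝ)
    (hf : ∀ ω, f ω = F (Preorder.frestrictLe n ω)) : Integrable f (G.playMeasure s σ) := by
  have : f = F ∘ Preorder.frestrictLe n := funext hf
  rw [this]
  refine Integrable.comp_measurable ?_ (by fun_prop)
  exact Integrable.of_finite

theorem integral_play_zero (g : G.Step → ℝ) :
    ∫ ω, g (ω 0) ∂G.playMeasure s σ =
      ∑ a, (σ 0 (fun j => j.elim0) s a).toReal * g ⟨s, a⟩ := by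
  rw [← integral_actIn]
  have h1 : (G.playMeasure s σ).map (Preorder.frestrictLe 0) =
      (G.actIn s (σ 0 (fun j => j.elim0) s)).toMeasure.map
        (MeasurableEquiv.piUnique (fun _ : Finset.Iic 0 => G.Step)).symm := by
    rw [playMeasure, Kernel.trajMeasure, Measure.map_comp _ _ (by fun_prop),
      Kernel.traj_map_frestrictLe, Kernel.partialTraj_self, Measure.id_comp]
  have h2 : ∫ ω, g (ω 0) ∂G.playMeasure s σ =
      ∫ y, g (y ⟨0, by simp⟩) ∂(G.playMeasure s σ).map (Preorder.frestrictLe 0) := by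
    rw [integral_map (by fun_prop) (measurable_of_countable _).aestronglyMeasurable]
    rfl
  rw [h2, h1, integral_map (by fun_prop) (measurable_of_countable _).aestronglyMeasurable]
  rfl

/-- The Markov property: the joint law of the first rounds and the next one is a composition-product
with the step kernel, so the next round may be integrated out first. -/
theorem integral_play_succ (g : G.Step → ℝ) (n : ℕ) :
    ∫ ω, g (ω (n + 1)) ∂G.playMeasure s σ =
      ∫ ω, G.nextSum (fun l => ∑ a, (σ (n + 1) (fun j => ω j) l a).toReal * g ⟨l, a⟩) (ω n)
        ∂G.playMeasure s σ := by
  have h := Kernel.map_frestrictLe_trajMeasure_compProd_eq_map_trajMeasure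
    (X := fun _ => G.Step) (μ₀ := (G.actIn s (σ 0 (fun j => j.elim0) s)).toMeasure)
    (κ := G.stepKernel σ) (a := n)
  have h1 : ∫ ω, g (ω (n + 1)) ∂G.playMeasure s σ = ∫ y, g y.2 ∂((G.playMeasure s σ).map
      (fun x ↦ (Preorder.frestrictLe n x, x (n + 1)))) := by
    rw [integral_map (by fun_prop) (measurable_of_countable _).aestronglyMeasurable]
  rw [h1, playMeasure, ← h, Measure.integral_compProd Integrable.of_finite,
    integral_map (by fun_prop) (measurable_of_countable _).aestronglyMeasurable]
  refine integral_congr_ae (ae_of_all _ fun ω => ?_)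
  exact G.integral_stepPMF σ n _ g

/-- The expected reward in round `t + 1`. -/
def expRew (ρ : G.Step → ℝ) (t : ℕ) : ℝ := ∫ ω, ρ (ω t) ∂G.playMeasure s σ

theorem integrable_coord (g : G.Step → ℝ) (t : ℕ) :
    Integrable (fun ω : ℕ → G.Step => g (ω t)) (G.playMeasure s σ) :=
  G.integrable_play s σ _ t (fun y => g (y ⟨t, by simp⟩)) fun _ => rfl

theorem exists_bound (g : G.Step → ℝ) : ∃ C, ∀ p, |g p| ≤ C := by
  obtain ⟨C, hC⟩ := (Set.finite_range fun p => |g p|).bddAbove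
  exact ⟨C, fun p => hC ⟨p, rfl⟩⟩

theorem abs_expRew_le {ρ : G.Step → ℝ} {C : ℝ} (hC : ∀ p, |ρ p| ≤ C) (t : ℕ) :
    |G.expRew s σ ρ t| ≤ C := by
  have := norm_integral_le_of_norm_le_const (μ := G.playMeasure s σ)
    (f := fun ω => ρ (ω t)) (C := C) (ae_of_all _ fun ω => hC (ω t))
  simpa [expRew] using this

theorem summable_expRew (ρ : G.Step → ℝ) : Summable fun t => G.gam ^ t * G.expRew s σ ρ t := by
  obtain ⟨C, hC⟩ := G.exists_bound ρ
  refine Summable.of_norm_bounded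
    ((summable_geometric_of_lt_one G.gam_nonneg G.gam_lt_one).mul_right C) fun t => ?_
  rw [norm_mul, norm_pow, Real.norm_of_nonneg G.gam_nonneg]
  exact mul_le_mul_of_nonneg_left (G.abs_expRew_le s σ hC t) (pow_nonneg G.gam_nonneg t)

theorem payoff_eq (i : Fin N) :
    G.payoff i s σ = (1 - G.gam) * ∑' t, G.gam ^ t * G.expRew s σ (G.rew i) t := by
  rw [payoff, integral_const_mul]
  congr 1
  obtain ⟨C, hC⟩ := G.exists_bound (G.rew i)
  have hint : ∀ t, Integrable (fun ω : ℕ → G.Step => G.gam ^ t * G.rew i (ω t))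
      (G.playMeasure s σ) := fun t => (G.integrable_coord s σ _ t).const_mul _
  have := integral_tsum_of_summable_integral_norm hint (by
    refine Summable.of_nonneg_of_le (fun t => integral_nonneg fun ω => norm_nonneg _)
      (fun t => ?_) ((summable_geometric_of_lt_one G.gam_nonneg G.gam_lt_one).mul_right C)
    have := norm_integral_le_of_norm_le_const (μ := G.playMeasure s σ) (C := G.gam ^ t * C)
      (f := fun ω => ‖G.gam ^ t * G.rew i (ω t)‖) (ae_of_all _ fun ω => by
        rw [norm_norm, norm_mul, norm_pow, Real.norm_of_nonneg G.gam_nonneg]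
        exact mul_le_mul_of_nonneg_left (hC _) (pow_nonneg G.gam_nonneg t))
    refine (le_abs_self _).trans (by simpa using this))
  rw [show (∫ ω, ∑' t : ℕ, (G.discount.val : ℝ) ^ t *
    ((G.reward (ω t).1 (ω t).2 i).val : ℝ) ∂G.playMeasure s σ) = _ from this.symm]
  simp only [integral_const_mul]
  rfl

/-- If no choice from the second round on beats `W`, the discounted reward is bounded by the value
of the choice in the first round. -/
theorem tsum_expRew_le (ρ : G.Step → ℝ) (W : Fin G.numStates → ℝ)
    (h : ∀ n (h : Fin (n + 1) → G.Step) l,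
      ∑ a, (σ (n + 1) h l a).toReal * G.stepValue ρ W ⟨l, a⟩ ≤ W l) :
    ∑' t, G.gam ^ t * G.expRew s σ ρ t ≤
      ∑ a, (σ 0 (fun j => j.elim0) s a).toReal * G.stepValue ρ W ⟨s, a⟩ := by
  rw [← integral_play_zero]
  have hd : ∀ t, G.expRew s σ (G.stepValue ρ W) t =
      G.expRew s σ ρ t + G.gam * G.expRew s σ (G.nextSum W) t := by
    intro t
    simp only [expRew, stepValue]
    rw [integral_add (G.integrable_coord s σ _ t) ((G.integrable_coord s σ _ t).const_mul _),
      integral_const_mul]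
  have hstep : ∀ t, G.expRew s σ (G.stepValue ρ W) (t + 1) ≤ G.expRew s σ (G.nextSum W) t := by
    intro t
    rw [expRew, integral_play_succ]
    refine integral_mono (G.integrable_play s σ _ t (fun y =>
      G.nextSum (fun l => ∑ a, (σ (t + 1) (fun j => y ⟨j, Finset.mem_Iic.2
        (Nat.lt_succ_iff.1 j.isLt)⟩) l a).toReal * G.stepValue ρ W ⟨l, a⟩) (y ⟨t, by simp⟩))
        fun ω => rfl) (G.integrable_coord s σ _ t) fun ω => ?_
    exact Finset.sum_le_sum fun l _ => mul_le_mul_of_nonneg_left (h _ _ _) (NNReal.coe_nonneg _)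
  -- Telescoping: the expected `stepValue` of a round is its reward plus the discounted expectation
  -- of `W` at the next state, and by `hstep` the latter bounds the next expected `stepValue`. The
  -- remainder vanishes in the limit by discounting.
  have hpart : ∀ n, ∑ t ∈ Finset.range (n + 1), G.gam ^ t * G.expRew s σ ρ t ≤
      G.expRew s σ (G.stepValue ρ W) 0 - G.gam ^ (n + 1) * G.expRew s σ (G.nextSum W) n := by
    intro n
    induction n with
    | zero => simp [hd 0]
    | succ n ih =>
      rw [Finset.sum_range_succ]
      have h1 := mul_le_mul_of_nonneg_left (hstep n) (pow_nonneg G.gam_nonneg (n + 1))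
      rw [hd (n + 1)] at h1
      have h2 : G.gam ^ (n + 1 + 1) = G.gam ^ (n + 1) * G.gam := pow_succ _ _
      rw [h2]
      linarith
  have ht1 := (G.summable_expRew s σ ρ).hasSum.tendsto_sum_nat.comp (Filter.tendsto_add_atTop_nat 1)
  have ht2 : Filter.Tendsto (fun n => G.gam ^ (n + 1) * G.expRew s σ (G.nextSum W) n)
      Filter.atTop (nhds 0) := by
    obtain ⟨C, hC⟩ := G.exists_bound (G.nextSum W)
    have h0 := ((tendsto_pow_atTop_nhds_zero_of_lt_one G.gam_nonneg G.gam_lt_one).comp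
      (Filter.tendsto_add_atTop_nat 1)).mul_const C
    rw [zero_mul] at h0
    refine squeeze_zero_norm (fun n => ?_) h0
    rw [norm_mul, norm_pow, Real.norm_of_nonneg G.gam_nonneg]
    exact mul_le_mul_of_nonneg_left (G.abs_expRew_le s σ hC n) (pow_nonneg G.gam_nonneg _)
  refine le_of_tendsto_of_tendsto' ht1 (a₂ := G.expRew s σ (G.stepValue ρ W) 0 - 0)
    (tendsto_const_nhds.sub ht2) hpart |>.trans (by simp [expRew])

theorem expRew_neg (ρ : G.Step → ℝ) (t : ℕ) :
    G.expRew s σ (fun p => -ρ p) t = -G.expRew s σ ρ t := integral_neg _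

theorem nextSum_neg (W : Fin G.numStates → ℝ) (p : G.Step) :
    G.nextSum (fun l => -W l) p = -G.nextSum W p := by
  simp [nextSum]

theorem stepValue_neg (ρ : G.Step → ℝ) (W : Fin G.numStates → ℝ) (p : G.Step) :
    G.stepValue (fun p => -ρ p) (fun l => -W l) p = -G.stepValue ρ W p := by
  rw [stepValue, stepValue, nextSum_neg]; ring

/-- The reverse inequality is the upper bound for the negated rewards and values. Nothing is
required of the first round, which is what allows a deviation there. -/
theorem tsum_expRew_eq (ρ : G.Step → ℝ) (W : Fin G.numStates → ℝ)
    (h : ∀ n (h : Fin (n + 1) → G.Step) l,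
      W l = ∑ a, (σ (n + 1) h l a).toReal * G.stepValue ρ W ⟨l, a⟩) :
    ∑' t, G.gam ^ t * G.expRew s σ ρ t =
      ∑ a, (σ 0 (fun j => j.elim0) s a).toReal * G.stepValue ρ W ⟨s, a⟩ := by
  refine le_antisymm (G.tsum_expRew_le s σ ρ W fun n y l => (h n y l).ge) ?_
  have := G.tsum_expRew_le s σ (fun p => -ρ p) (fun l => -W l) fun n y l => by
    simp only [stepValue_neg, mul_neg, Finset.sum_neg_distrib, neg_le_neg_iff]
    exact (h n y l).le
  simpa only [stepValue_neg, expRew_neg, mul_neg, Finset.sum_neg_distrib, tsum_neg,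
    neg_le_neg_iff] using this

variable (x : G.Stationary)

/-- A stationary profile has a value. -/
theorem exists_value (ρ : G.Step → ℝ) :
    ∃ W : Fin G.numStates → ℝ, ∀ l, W l = ∑ a, (x l a).toReal * G.stepValue ρ W ⟨l, a⟩ := by
  have hF : ContractingWith G.discount.val
      fun (W : Fin G.numStates → ℝ) l => ∑ a, (x l a).toReal * G.stepValue ρ W ⟨l, a⟩ := by
    refine ⟨G.discount_lt_one, LipschitzWith.of_dist_le_mul fun W W' => ?_⟩
    rw [dist_pi_le_iff (by positivity)]
    intro l
    rw [Real.dist_eq, ← Finset.sum_sub_distrib]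
    have hn : ∀ p, |G.nextSum W p - G.nextSum W' p| ≤ dist W W' := by
      intro p
      rw [nextSum, nextSum, ← Finset.sum_sub_distrib]
      refine (Finset.abs_sum_le_sum_abs _ _).trans ?_
      calc _ ≤ ∑ l, ((G.trans p.1 p.2 l).val : ℝ) * dist W W' := by
            refine Finset.sum_le_sum fun l _ => ?_
            rw [← mul_sub, abs_mul, abs_of_nonneg (NNReal.coe_nonneg _)]
            exact mul_le_mul_of_nonneg_left (dist_le_pi_dist W W' l) (NNReal.coe_nonneg _)
        _ = dist W W' := by rw [← Finset.sum_mul, trans_sum_real, one_mul]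
    refine (Finset.abs_sum_le_sum_abs _ _).trans ?_
    calc _ ≤ ∑ a, (x l a).toReal * (G.gam * dist W W') := by
          refine Finset.sum_le_sum fun a _ => ?_
          rw [← mul_sub, abs_mul, abs_of_nonneg ENNReal.toReal_nonneg]
          refine mul_le_mul_of_nonneg_left ?_ ENNReal.toReal_nonneg
          rw [stepValue, stepValue, add_sub_add_left_eq_sub, ← mul_sub, abs_mul,
            abs_of_nonneg G.gam_nonneg]
          exact mul_le_mul_of_nonneg_left (hn _) G.gam_nonneg
      _ = _ := by rw [← Finset.sum_mul, pmf_sum_toReal, one_mul]; rfl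
  exact ⟨hF.fixedPoint, fun l => (congrFun hF.fixedPoint_isFixedPt l).symm⟩

/-- A stationary profile is an equilibrium iff no player gains by changing the action in one
round. -/
theorem isNash_iff : G.IsNash x.toProfile ↔ ∃ W : Fin N → Fin G.numStates → ℝ,
    (∀ i l, W i l = ∑ a, (x l a).toReal * G.stepValue (G.rew i) (W i) ⟨l, a⟩) ∧
    ∀ l a, G.stepValue (G.rew (G.ctrl l)) (W (G.ctrl l)) ⟨l, a⟩ ≤ W (G.ctrl l) l := by
  classical
  have hγ : 0 < 1 - G.gam := sub_pos.2 G.gam_lt_one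
  have hpay : ∀ (W : Fin N → Fin G.numStates → ℝ),
      (∀ i l, W i l = ∑ a, (x l a).toReal * G.stepValue (G.rew i) (W i) ⟨l, a⟩) →
      ∀ i s, G.payoff i s x.toProfile = (1 - G.gam) * W i s := by
    intro W hW i s
    rw [payoff_eq, G.tsum_expRew_eq s x.toProfile (G.rew i) (W i) fun _ _ l => hW i l, hW i s]
    rfl
  constructor
  · intro hN
    choose W hW using fun i => G.exists_value x (G.rew i)
    refine ⟨W, hW, fun l a => ?_⟩
    set i := G.ctrl l with hi
    -- The one-shot deviation: action `a` in the initial round if the state is `l`, the profile `x`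
    -- otherwise. Its payoff is the normalized `stepValue` of `a`.
    let τ : G.Profile := fun n _ k => if h : n = 0 ∧ k = l then PMF.pure (h.2 ▸ a) else x k
    have hτ : G.IsDeviation i x.toProfile τ := by
      intro n h k hk
      have : ¬ (n = 0 ∧ k = l) := by
        rintro ⟨-, rfl⟩
        exact hk rfl
      simp only [τ, dif_neg this]
      rfl
    have h1 := hN l i τ hτ
    rw [hpay W hW, payoff_eq, G.tsum_expRew_eq l τ (G.rew i) (W i) fun n y k => by
      rw [hW i k]
      simp [τ]] at h1
    have h2 := le_of_mul_le_mul_left h1 hγ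
    have h3 : τ 0 (fun j => j.elim0) l = PMF.pure a := by simp [τ]
    rw [h3] at h2
    refine le_trans (le_of_eq ?_) h2
    rw [Finset.sum_eq_single a]
    · simp
    · intro b _ hb
      simp [PMF.pure_apply, hb]
    · simp
  · rintro ⟨W, hW, hopt⟩ s i τ hτ
    -- One-round optimality where player `i` has control, and the value equation of `x` elsewhere:
    -- no choice of `τ` beats `W i` after any history.
    have hle : ∀ n h l, ∑ a, (τ n h l a).toReal * G.stepValue (G.rew i) (W i) ⟨l, a⟩ ≤ W i l := by
      intro n h l
      by_cases hl : G.ctrl l = i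
      · subst hl
        calc _ ≤ ∑ a, (τ n h l a).toReal * W (G.ctrl l) l :=
              Finset.sum_le_sum fun a _ =>
                mul_le_mul_of_nonneg_left (hopt l a) ENNReal.toReal_nonneg
          _ = _ := by rw [← Finset.sum_mul, pmf_sum_toReal, one_mul]
      · rw [hτ n h l hl]
        exact (hW i l).ge
    rw [hpay W hW, payoff_eq]
    refine mul_le_mul_of_nonneg_left ?_ hγ.le
    exact (G.tsum_expRew_le s τ _ (W i) fun n h l => hle _ h l).trans (hle 0 _ s)

end Game

end

end StochasticGames

/-! ### Closure properties of polynomial-time string functions -/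

namespace StochasticGames

noncomputable section

open Computability (Γ')
open StackProg

namespace PolyTime

section General

variable {Γ α β : Type} {v v' w : List (α → List Γ)} {f g : α → List Γ}

/-- The same program works after re-indexing the stack positions of the inputs. -/
theorem mono (hf : PolyTime v f) (h : v ⊆ v') : PolyTime v' f := by
  classical
  have hsz : PolyBdd (totalLength v') (totalLength v) := by
    refine ((PolyBdd.const v.length).mul PolyBdd.self).mono fun x => ?_
    have := List.sum_le_card_nsmul (v.map fun g => (g x).length) (totalLength v' x) (by
      simp only [List.mem_map, forall_exists_index, and_imp, forall_apply_eq_imp_iff₂]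
      exact fun g hg => length_le_totalLength (h hg) x)
    simpa [totalLength] using this
  refine ⟨hsz.trans hf.length, fun loc m hloc => ?_⟩
  by_cases hlen : loc.length = v'.length
  · have hidx : ∀ g : α → List Γ, ∃ i, g ∈ v → v'[i]? = some g := fun g => by
      by_cases hg : g ∈ v
      · obtain ⟨i, hi⟩ := List.mem_iff_getElem?.1 (h hg)
        exact ⟨i, fun _ => hi⟩
      · exact ⟨0, fun h => absurd h hg⟩
    choose idx hidx using hidx
    have hlt : ∀ g ∈ v, idx g < loc.length := fun g hg => by
      rw [hlen]
      exact (List.getElem?_eq_some_iff.1 (hidx g hg)).1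
    obtain ⟨p, c, hc, hp⟩ := hf.prog (v.map fun g => loc.getD (idx g) 0) m (by
      simp only [List.mem_map, forall_exists_index, and_imp, forall_apply_eq_imp_iff₂]
      intro g hg
      rw [List.getD_eq_getElem _ _ (hlt g hg)]
      exact hloc _ (List.getElem_mem _))
    refine ⟨p, c, hsz.trans hc, fun x S hx hS => hp x S ?_ hS⟩
    rw [List.map_map]
    refine List.map_congr_left fun g hg => ?_
    have h1 := congrArg (fun l => l[idx g]?) hx
    simpa [hidx g hg, hlt g hg] using h1
  -- With the wrong number of positions no stack content meets the hypothesis, so any program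
  -- satisfies the specification.
  · refine ⟨skip, fun _ => 0, PolyBdd.const 0, fun x S hx _ => absurd ?_ hlen⟩
    simpa using congrArg List.length hx

theorem trans (hf : PolyTime w f) (h : ∀ g ∈ w, PolyTime v g) : PolyTime v f := by
  suffices ∀ u : List (α → List Γ), (∀ g ∈ u, PolyTime v g) → PolyTime (u ++ v) f →
      PolyTime v f from this w h (hf.mono (List.subset_append_left _ _))
  intro u
  induction u with
  | nil => exact fun _ h => h
  | cons g u ih =>
    intro h hf
    simp only [List.mem_cons, forall_eq_or_imp] at h
    exact ih h.2 (cut (h.1.mono (List.subset_append_right _ _)) hf)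

/-- A program sees only strings and not the argument they come from, so program and polynomial
bounds are unchanged by substitution. -/
theorem comap {w : List (β → List Γ)} {f : β → List Γ} (hf : PolyTime w f) (h : α → β) :
    PolyTime (w.map fun g x => g (h x)) fun x => f (h x) := by
  have e : ∀ x, totalLength (w.map fun g x => g (h x)) x = totalLength w (h x) := fun x => by
    simp [totalLength, Function.comp_def]
  refine ⟨?_, fun loc m hloc => ?_⟩
  · obtain ⟨P, hP⟩ := hf.length
    exact ⟨P, fun x => by rw [e]; exact hP _⟩
  · obtain ⟨p, c, ⟨P, hP⟩, hp⟩ := hf.prog loc m hloc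
    refine ⟨p, fun x => c (h x), ⟨P, fun x => by rw [e]; exact hP _⟩, fun x S hx hS => ?_⟩
    exact hp _ S (by simpa [Function.comp_def] using hx) hS

theorem subst {w : List (β → List Γ)} {f : β → List Γ} (hf : PolyTime w f) {h : α → β}
    (hw : ∀ g ∈ w, PolyTime v fun x => g (h x)) : PolyTime v fun x => f (h x) :=
  (hf.comap h).trans (by simpa using hw)

theorem cons (a : Γ) (hf : PolyTime v f) : PolyTime v fun x => a :: f x :=
  (const [a]).append hf

theorem drop (hf : PolyTime v f) (n : ℕ) : PolyTime v fun x => (f x).drop n := by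
  induction n with
  | zero => simpa using hf
  | succ n ih => simpa using ih.tail

/-- The list `V` is abstract so that a step can be treated from the computability of its
ingredients, without reference to the concatenated list of variables in `foldl`. -/
theorem foldl' [Fintype Γ] {w : List (β → List Γ)} {l : α → List Γ} (hl : PolyTime v l)
    {step : α → β → Γ → β} {init : α → β}
    (hinit : ∀ g ∈ w, PolyTime v fun x => g (init x))
    (hstep : ∀ V : List (α × β → List Γ), (∀ h ∈ v, PolyTime V fun y => h y.1) →
      (∀ h ∈ w, PolyTime V fun y => h y.2) → ∀ s, ∀ g ∈ w,
      PolyTime V fun y => g (step y.1 y.2 s))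
    {b : α → ℕ} (hb : PolyBdd (totalLength v) b)
    (hbound : ∀ x l', l' <+: l x → totalLength w (l'.foldl (step x) (init x)) ≤ b x)
    {g : β → List Γ} (hg : g ∈ w) : PolyTime v fun x => g ((l x).foldl (step x) (init x)) :=
  foldl hl hinit (fun s g hg => hstep _
    (fun h hh => var (List.mem_append_left _ (List.mem_map.2 ⟨h, hh, rfl⟩)))
    (fun h hh => var (List.mem_append_right _ (List.mem_map.2 ⟨h, hh, rfl⟩))) s g hg) hb hbound hg

theorem flatMap [Fintype Γ] (hf : PolyTime v f) (φ : Γ → List Γ) :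
    PolyTime v fun x => (f x).flatMap φ := by
  classical
  set M := ∑ s, (φ s).length with hM
  have hφ : ∀ l : List Γ, (l.flatMap φ).length ≤ l.length * M := by
    intro l
    induction l with
    | nil => simp
    | cons s l ih =>
      have : (φ s).length ≤ M :=
        Finset.single_le_sum (f := fun s => (φ s).length) (fun _ _ => Nat.zero_le _)
          (Finset.mem_univ s)
      simp only [List.flatMap_cons, List.length_append, List.length_cons, add_mul]
      omega
  have e : ∀ (l y : List Γ), l.foldl (fun y s => y ++ φ s) y = y ++ l.flatMap φ := by
    intro l
    induction l with
    | nil => simp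
    | cons s l ih => intro y; simp [ih]
  have := foldl' (w := [fun y : List Γ => y]) hf (step := fun _ y s => y ++ φ s)
    (init := fun _ => []) (by simpa using const [])
    (fun V _ hV s => by
      simp only [List.mem_cons, List.not_mem_nil, or_false, forall_eq] at hV ⊢
      exact hV.append (const _))
    (b := fun x => (f x).length * M) (hf.length.mul (PolyBdd.const _))
    (fun x l' hl' => by
      rw [e]
      simp only [totalLength, List.map_cons, List.map_nil, List.sum_cons, List.sum_nil,
        List.nil_append, add_zero]
      exact (hφ l').trans (Nat.mul_le_mul_right _ hl'.length_le))
    (List.mem_cons_self)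
  simpa [e] using this

theorem reverse [Fintype Γ] (hf : PolyTime v f) : PolyTime v fun x => (f x).reverse := by
  have e : ∀ l y : List Γ, l.foldl (fun y s => s :: y) y = l.reverse ++ y := by
    intro l
    induction l with
    | nil => simp
    | cons s l ih => intro y; simp [ih]
  have := foldl' (w := [fun y : List Γ => y]) hf (step := fun _ y s => s :: y)
    (init := fun _ => []) (by simpa using const [])
    (fun V _ hV s => by
      simp only [List.mem_cons, List.not_mem_nil, or_false, forall_eq] at hV ⊢
      exact hV.cons _)
    (b := fun x => (f x).length) hf.length
    (fun x l' hl' => by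
      rw [e]
      simpa [totalLength] using hl'.length_le)
    (List.mem_cons_self)
  simpa [e] using this

end General

section Bits

variable {α β : Type} {v : List (α → List Γ')}

/-- Binary digits as symbols. -/
def _root_.StochasticGames.bits (l : List Bool) : List Γ' := l.map Γ'.bit

/-- Whether the truth value `c x` can be computed in polynomial time from the strings in `v`. -/
abbrev _root_.StochasticGames.PolyTimeBool (v : List (α → List Γ')) (c : α → Bool) : Prop :=
  PolyTime v fun x => [Γ'.bit (c x)]

theorem bool {c : α → Bool} (hc : PolyTimeBool v c) {f : Bool → α → List Γ'}
    (hf : ∀ b, PolyTime v (f b)) : PolyTime v fun x => f (c x) x := by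
  have := hc.cases (h := fun o => match o with
    | some (Γ'.bit b) => f b
    | _ => fun _ => []) (by
      rintro (_ | _ | _ | _ | _ | _)
      all_goals first | exact const [] | exact hf _)
  simpa using this

theorem headD {l : α → List Bool} (hl : PolyTime v fun x => bits (l x)) :
    PolyTimeBool v fun x => (l x).headD false := by
  have := hl.cases (h := fun o _ => match o with
    | some (Γ'.bit b) => [Γ'.bit b]
    | _ => [Γ'.bit false]) (fun o => const _)
  refine (congrArg (PolyTime v) (funext fun x => ?_)).mp this
  rcases h : l x with _ | ⟨b, t⟩ <;> simp [bits, h]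

theorem foldlBits {w : List (β → List Γ')} {l : α → List Bool}
    (hl : PolyTime v fun x => bits (l x)) {step : α → β → Bool → β} {init : α → β}
    (hinit : ∀ g ∈ w, PolyTime v fun x => g (init x))
    (hstep : ∀ V : List (α × β → List Γ'), (∀ h ∈ v, PolyTime V fun y => h y.1) →
      (∀ h ∈ w, PolyTime V fun y => h y.2) → ∀ s, ∀ g ∈ w,
      PolyTime V fun y => g (step y.1 y.2 s))
    {b : α → ℕ} (hb : PolyBdd (totalLength v) b)
    (hbound : ∀ x l', l' <+: l x → totalLength w (l'.foldl (step x) (init x)) ≤ b x)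
    {g : β → List Γ'} (hg : g ∈ w) : PolyTime v fun x => g ((l x).foldl (step x) (init x)) := by
  set stp : α → β → Γ' → β := fun x y s => match s with
    | Γ'.bit d => step x y d
    | _ => y with hstp
  have e : ∀ (x : α) (l : List Bool) (y : β), (bits l).foldl (stp x) y = l.foldl (step x) y :=
    fun x l y => by rw [bits, List.foldl_map]
  have := foldl' (w := w) hl (step := stp) (init := init) hinit (fun V hv hw s g hg => by
    rcases s with _ | d | _ | _ | _
    · exact hw g hg
    · exact hstep V hv hw d g hg
    · exact hw g hg
    · exact hw g hg
    · exact hw g hg) hb (fun x l' hl' => by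
      obtain ⟨l'', h, rfl⟩ : ∃ l'', l'' <+: l x ∧ l' = bits l'' := by
        obtain ⟨t, ht⟩ := hl'
        obtain ⟨l₁, l₂, h1, h2, h3⟩ := List.append_eq_map_iff.1 ht
        exact ⟨l₁, ⟨l₂, h1.symm⟩, h2.symm⟩
      rw [e]
      exact hbound x l'' h) hg
  simpa only [e] using this

end Bits

end PolyTime

end

end StochasticGames

namespace StochasticGames

noncomputable section

open Computability (Γ' encodeNat encodeNum)

/-! ### Binary numbers, least significant digit first -/

/-- The number with the given binary digits, the least significant digit first. -/
def binValue : List Bool → ℕ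
  | [] => 0
  | b :: l => b.toNat + 2 * binValue l

theorem encodeNat_two_mul_add_one (m : ℕ) : encodeNat (2 * m + 1) = true :: encodeNat m := by
  have h : ((2 * m + 1 : ℕ) : Num) = (m : Num).bit1 := by
    rw [← Num.bit1_of_bit1]
    push_cast
    rw [two_mul]
  rw [encodeNat, encodeNat, h]
  cases (m : Num) <;> rfl

theorem encodeNat_two_mul {m : ℕ} (hm : 0 < m) : encodeNat (2 * m) = false :: encodeNat m := by
  have h : ((2 * m : ℕ) : Num) = (m : Num).bit0 := by
    rw [← Num.bit0_of_bit0]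
    push_cast
    rw [two_mul]
  rw [encodeNat, encodeNat, h]
  have h0 : (m : Num) ≠ 0 := by
    intro h
    have := congrArg (fun n : Num => (n : ℕ)) h
    simp at this
    omega
  revert h0
  cases (m : Num)
  · exact fun h => absurd rfl h
  · exact fun _ => rfl

@[simp] theorem encodeNat_zero : encodeNat 0 = [] := rfl

@[simp] theorem binValue_encodeNat (n : ℕ) : binValue (encodeNat n) = n := by
  induction n using Nat.strong_induction_on with
  | _ n ih =>
    obtain ⟨m, rfl | rfl⟩ := Nat.even_or_odd' n
    · rcases Nat.eq_zero_or_pos m with rfl | hm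
      · rfl
      · rw [encodeNat_two_mul hm, binValue, ih m (by omega)]
        simp
    · rw [encodeNat_two_mul_add_one, binValue, ih m (by omega)]
      simp [add_comm]

theorem encodeNat_two_pow_mul {m : ℕ} (hm : 0 < m) (k : ℕ) :
    encodeNat (2 ^ k * m) = List.replicate k false ++ encodeNat m := by
  induction k with
  | zero => simp
  | succ k ih =>
    rw [pow_succ', mul_assoc, encodeNat_two_mul (by positivity), ih]
    rfl

theorem binValue_lt (l : List Bool) : binValue l < 2 ^ l.length := by
  induction l with
  | nil => simp [binValue]
  | cons b l ih => cases b <;> simp [binValue, pow_succ] <;> omega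

theorem lt_two_pow_length_encodeNat (n : ℕ) : n < 2 ^ (encodeNat n).length := by
  simpa using binValue_lt (encodeNat n)

/-- The digits of the successor. -/
def incBits : List Bool → List Bool
  | [] => [true]
  | false :: l => true :: l
  | true :: l => false :: incBits l

theorem encodeNat_succ (n : ℕ) : encodeNat (n + 1) = incBits (encodeNat n) := by
  induction n using Nat.strong_induction_on with
  | _ n ih =>
    obtain ⟨m, rfl | rfl⟩ := Nat.even_or_odd' n
    · rcases Nat.eq_zero_or_pos m with rfl | hm
      · rfl
      · rw [encodeNat_two_mul hm, encodeNat_two_mul_add_one, incBits]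
    · rw [encodeNat_two_mul_add_one, incBits, ← ih m (by omega), ← encodeNat_two_mul (by omega)]
      congr 1

/-- One step of the computation of `incBits`: the digits written so far and the carry. -/
def incStep (s : List Bool × Bool) (d : Bool) : List Bool × Bool :=
  (s.1 ++ [d ^^ s.2], d && s.2)

theorem foldl_incStep (l o : List Bool) (c : Bool) :
    (l.foldl incStep (o, c)).1 ++ (if (l.foldl incStep (o, c)).2 then [true] else []) =
      o ++ if c then incBits l else l := by
  induction l generalizing o c with
  | nil => cases c <;> simp [incBits]
  | cons d l ih =>
    rw [List.foldl_cons, incStep, ih]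
    cases c <;> cases d <;> simp [incBits]

theorem length_foldl_incStep (l o : List Bool) (c : Bool) :
    (l.foldl incStep (o, c)).1.length = o.length + l.length := by
  induction l generalizing o c with
  | nil => simp
  | cons d l ih => rw [List.foldl_cons, incStep, ih]; simp; omega

/-! ### Subtraction -/

/-- One step of the schoolbook subtraction: the remaining digits of the subtrahend, the borrow, and
the digits written so far. -/
def subStep (s : List Bool × Bool × List Bool) (d : Bool) : List Bool × Bool × List Bool :=
  (s.1.tail, (bif d then s.1.headD false && s.2.1 else s.1.headD false || s.2.1),
    s.2.2 ++ [(d ^^ s.1.headD false) ^^ s.2.1])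

/-- Schoolbook subtraction: the digits of the difference and the final borrow. -/
def subBits (x y : List Bool) : List Bool × Bool :=
  ((x.foldl subStep (y, false, [])).2.2, (x.foldl subStep (y, false, [])).2.1)

/-- The invariant of schoolbook subtraction: the outgoing borrow is worth `2 ^ x.length`, the
incoming one is worth 1. -/
theorem foldl_subStep (x : List Bool) : ∀ (y : List Bool) (c : Bool) (o : List Bool),
    y.length ≤ x.length → ∃ o' c', x.foldl subStep (y, c, o) = ([], c', o ++ o') ∧
      o'.length = x.length ∧
      binValue x + 2 ^ x.length * c'.toNat = binValue o' + binValue y + c.toNat := by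
  induction x with
  | nil =>
    intro y c o hy
    obtain rfl : y = [] := List.length_eq_zero_iff.1 (by simpa using hy)
    exact ⟨[], c, by simp [binValue]⟩
  | cons d x ih =>
    intro y c o hy
    have hy' : y.tail.length ≤ x.length := by simp at hy ⊢; omega
    obtain ⟨o', c', h1, h2, h3⟩ := ih y.tail
      (bif d then y.headD false && c else y.headD false || c)
      (o ++ [(d ^^ y.headD false) ^^ c]) hy'
    refine ⟨((d ^^ y.headD false) ^^ c) :: o', c', ?_, by simp [h2], ?_⟩
    · rw [List.foldl_cons, subStep, h1]
      simp
    · have hyv : binValue y = (y.headD false).toNat + 2 * binValue y.tail := by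
        cases y <;> simp [binValue]
      rw [hyv]
      simp only [binValue, List.length_cons, pow_succ]
      clear h1 hyv
      generalize y.headD false = e at *
      generalize binValue y.tail = Y at *
      generalize binValue x = X at *
      generalize binValue o' = O at *
      have h4 : 2 ^ x.length * 2 * c'.toNat = 2 * (2 ^ x.length * c'.toNat) := by ring
      rw [h4]
      generalize 2 ^ x.length * c'.toNat = P at *
      cases d <;> cases c <;> cases e <;> simp at h3 ⊢ <;> omega

theorem subBits_spec {x y : List Bool} (h : y.length ≤ x.length) :
    (subBits x y).1.length = x.length ∧
      ((subBits x y).2 = true → binValue x < binValue y) ∧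
      ((subBits x y).2 = false → binValue x = binValue (subBits x y).1 + binValue y) := by
  obtain ⟨o, c, h1, h2, h3⟩ := foldl_subStep x y false [] h
  simp only [subBits, h1, List.nil_append]
  refine ⟨h2, ?_, ?_⟩
  · rintro rfl
    have := binValue_lt o
    rw [h2] at this
    simp at h3
    omega
  · rintro rfl
    simpa using h3

/-! ### Perfect squares -/

/-- One step of the digit-by-digit computation of a square root: the remainder, the root, and
whether the number of digits read so far is odd. -/
def sqrtStep (s : List Bool × List Bool × Bool) (d : Bool) : List Bool × List Bool × Bool :=
  bif s.2.2 then
    bif (subBits (d :: s.1) (true :: false :: s.2.1)).2 then (d :: s.1, false :: s.2.1, false)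
    else ((subBits (d :: s.1) (true :: false :: s.2.1)).1, true :: s.2.1, false)
  else (d :: s.1, s.2.1, true)

/-- The state after the digits `l`, the most significant digit first, have been read, if `p` tells
whether their number is odd. -/
def sqrtState (p : Bool) (l : List Bool) : List Bool × List Bool × Bool :=
  l.foldl sqrtStep ([false, false], [], p)

/-- Whether the number of digits is odd. -/
def lengthParity (l : List Bool) : Bool := l.foldl (fun c _ => !c) false

/-- A test for perfect squares. -/
def isSquareBits (l : List Bool) : Bool :=
  !((sqrtState (lengthParity l) l.reverse).1.foldl (fun c d => c || d) false)

/-- The invariant of the digit-by-digit square root. After complete pairs of digits the number read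
is `s ^ 2 + r` with `r ≤ 2 * s`, so `s` is the integer root. In the middle of a pair it is `2 * s ^
2 + r`. Choosing `p` as the parity of the length amounts to a virtual leading zero that makes the
number of digits even. -/
theorem sqrtState_spec (p : Bool) (l : List Bool) :
    (sqrtState p l.reverse).1.length = l.length + 2 ∧
      (sqrtState p l.reverse).2.1.length ≤ l.length ∧
      (sqrtState p l.reverse).2.2 = (p ^^ lengthParity l) ∧
      ((sqrtState p l.reverse).2.2 = false →
        binValue l = binValue (sqrtState p l.reverse).2.1 ^ 2 +
          binValue (sqrtState p l.reverse).1 ∧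
        binValue (sqrtState p l.reverse).1 ≤ 2 * binValue (sqrtState p l.reverse).2.1) ∧
      ((sqrtState p l.reverse).2.2 = true →
        binValue l = 2 * binValue (sqrtState p l.reverse).2.1 ^ 2 +
          binValue (sqrtState p l.reverse).1 ∧
        binValue (sqrtState p l.reverse).1 ≤ 4 * binValue (sqrtState p l.reverse).2.1 + 1) := by
  have hpar : ∀ (l : List Bool) (c : Bool), l.foldl (fun c _ => !c) c =
      (c ^^ l.foldl (fun c _ => !c) false) := by
    intro l
    induction l with
    | nil => simp
    | cons d l ih => intro c; simp only [List.foldl_cons]; rw [ih, ih (!false)]; simp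
  induction l with
  | nil => simp [sqrtState, lengthParity, binValue]
  | cons d l ih =>
    have hp' : lengthParity (d :: l) = !lengthParity l := by
      rw [lengthParity, List.foldl_cons, hpar]
      simp [lengthParity]
    have hst : sqrtState p (d :: l).reverse = sqrtStep (sqrtState p l.reverse) d := by
      simp [sqrtState]
    rw [hst, hp']
    generalize sqrtState p l.reverse = st at ih
    obtain ⟨r, s, ph⟩ := st
    obtain ⟨h1, h2, h3, h4, h5⟩ := ih
    simp only at h1 h2 h3 h4 h5
    have hd : d.toNat ≤ 1 := Bool.toNat_le d
    cases ph with
    | false =>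
      obtain ⟨e1, e2⟩ := h4 rfl
      refine ⟨by simp [sqrtStep, h1], by simp [sqrtStep]; omega, by simp [sqrtStep, ← h3],
        by simp [sqrtStep], fun _ => ?_⟩
      simp only [sqrtStep, cond_false, binValue]
      exact ⟨by rw [e1]; ring, by omega⟩
    | true =>
      obtain ⟨e1, e2⟩ := h5 rfl
      -- The initial zeros of the remainder keep it at least as long as the subtrahend, as
      -- `subBits_spec` requires.
      have hlen : (true :: false :: s).length ≤ (d :: r).length := by simp; omega
      obtain ⟨k1, k2, k3⟩ := subBits_spec hlen
      -- The new root is `2 * s` or `2 * s + 1`, and `(2 * s + 1) ^ 2 = 4 * s ^ 2 + (4 * s + 1)`; a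
      -- borrow decides between them.
      have hv : binValue (true :: false :: s) = 4 * binValue s + 1 := by
        simp [binValue]; ring
      rw [hv] at k2 k3
      simp only [binValue] at k2 k3
      simp only [sqrtStep, cond_true]
      cases hb : (subBits (d :: r) (true :: false :: s)).2 with
      | true =>
        have := k2 hb
        refine ⟨by simp [h1], by simp; omega, by simp [← h3], fun _ => ?_, by simp⟩
        simp only [cond_true, binValue, Bool.toNat_false]
        exact ⟨by rw [e1]; ring, by omega⟩
      | false =>
        have := k3 hb
        refine ⟨by simp [k1, h1], by simp; omega, by simp [← h3], fun _ => ?_, by simp⟩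
        simp only [cond_false, binValue, Bool.toNat_true]
        refine ⟨?_, by omega⟩
        rw [e1]
        generalize binValue (subBits (d :: r) (true :: false :: s)).1 = q at *
        have : d.toNat + 2 * (2 * binValue s ^ 2 + binValue r) =
            4 * binValue s ^ 2 + (d.toNat + 2 * binValue r) := by ring
        rw [this, ‹d.toNat + 2 * binValue r = _›]
        ring

/-- From `s ^ 2 ≤ n < (s + 1) ^ 2`, the number `n` is a square only if it is `s ^ 2`, that is, if
the remainder is zero. -/
theorem isSquareBits_iff (l : List Bool) : isSquareBits l = true ↔ IsSquare (binValue l) := by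
  have hany : ∀ (l : List Bool) (c : Bool), l.foldl (fun c d => c || d) c = false ↔
      c = false ∧ binValue l = 0 := by
    intro l
    induction l with
    | nil => simp [binValue]
    | cons d l ih =>
      intro c
      rw [List.foldl_cons, ih]
      cases c <;> cases d <;> simp [binValue]
  obtain ⟨-, -, h3, h4, -⟩ := sqrtState_spec (lengthParity l) l
  rw [isSquareBits, Bool.not_eq_true', hany]
  obtain ⟨e1, e2⟩ := h4 (by simp [h3])
  rw [e1]
  generalize binValue (sqrtState (lengthParity l) l.reverse).2.1 = s at *
  generalize binValue (sqrtState (lengthParity l) l.reverse).1 = r at *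
  constructor
  · rintro ⟨-, rfl⟩
    exact ⟨s, by ring⟩
  · rintro ⟨m, hm⟩
    refine ⟨rfl, ?_⟩
    have h1 : s ≤ m := by
      by_contra h
      have : m * m < s ^ 2 := by nlinarith
      omega
    have h2 : m < s + 1 := by
      by_contra h
      have : (s + 1) * (s + 1) ≤ m * m := Nat.mul_le_mul (by omega) (by omega)
      nlinarith
    obtain rfl : m = s := by omega
    rw [sq] at hm
    omega

end

end StochasticGames

/-! ### Binary arithmetic in polynomial time -/

namespace StochasticGames

noncomputable section

open Computability (Γ' encodeNat)

/-- A list of words, each followed by a comma. -/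
def encodeWords (l : List (List Bool)) : List Γ' := l.flatMap fun u => bits u ++ [Γ'.comma]

namespace PolyTime

variable {α β : Type} {v : List (α → List Γ')}

theorem bool₂ {c d : α → Bool} (hc : PolyTimeBool v c) (hd : PolyTimeBool v d)
    (F : Bool → Bool → Bool) : PolyTimeBool v fun x => F (c x) (d x) :=
  hc.bool (f := fun b x => [Γ'.bit (F b (d x))]) fun b =>
    hd.bool (f := fun b' _ => [Γ'.bit (F b b')]) fun _ => const _

theorem ite {c : α → Bool} (hc : PolyTimeBool v c) {f g : α → List Γ'} (hf : PolyTime v f)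
    (hg : PolyTime v g) : PolyTime v fun x => bif c x then f x else g x :=
  hc.bool (f := fun b x => bif b then f x else g x) fun b => by cases b <;> assumption

theorem bits_const (l : List Bool) : PolyTime v fun _ => bits l := const _

theorem bits_tail {l : α → List Bool} (h : PolyTime v fun x => bits (l x)) :
    PolyTime v fun x => bits (l x).tail := by
  simpa [bits] using h.tail

theorem bits_cons (d : Bool) {l : α → List Bool} (h : PolyTime v fun x => bits (l x)) :
    PolyTime v fun x => bits (d :: l x) := h.cons (Γ'.bit d)

theorem bits_append {l l' : α → List Bool} (h : PolyTime v fun x => bits (l x))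
    (h' : PolyTime v fun x => bits (l' x)) : PolyTime v fun x => bits (l x ++ l' x) := by
  simpa [bits] using h.append h'

theorem foldl_bool {l : α → List Bool} (hl : PolyTime v fun x => bits (l x))
    (F : Bool → Bool → Bool) (c : Bool) : PolyTimeBool v fun x => (l x).foldl F c :=
  foldlBits (w := [fun c : Bool => [Γ'.bit c]]) hl (step := fun _ => F) (init := fun _ => c)
    (by simpa using const _) (fun V _ hw s => by
      simp only [List.mem_cons, List.not_mem_nil, or_false, forall_eq] at hw ⊢
      exact bool₂ (d := fun _ => s) hw (const _) F)
    (b := fun _ => 1) (PolyBdd.const _) (fun x l' _ => by simp [totalLength])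
    List.mem_cons_self

theorem incBits {l : α → List Bool} (hl : PolyTime v fun x => bits (l x)) :
    PolyTime v fun x => bits (incBits (l x)) := by
  have key : ∀ g ∈ [(fun s : List Bool × Bool => bits s.1), fun s => [Γ'.bit s.2]],
      PolyTime v fun x => g ((l x).foldl incStep ([], true)) := fun g hg =>
    foldlBits (w := [(fun s : List Bool × Bool => bits s.1), fun s => [Γ'.bit s.2]]) hl
      (step := fun _ => incStep) (init := fun _ => ([], true))
      (by simpa using ⟨const _, const _⟩)
      (fun V _ hw d => by
        simp only [List.forall_mem_cons, List.not_mem_nil, false_imp_iff, implies_true,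
          and_true] at hw ⊢
        refine ⟨?_, bool₂ (c := fun _ => d) (const _) hw.2 fun a b => a && b⟩
        simpa [incStep, bits] using hw.1.append
          (bool₂ (c := fun _ => d) (const _) hw.2 fun a b => a ^^ b))
      (b := fun x => (bits (l x)).length + 1) (hl.length.add (PolyBdd.const 1))
      (fun x l' hl' => by
        have := length_foldl_incStep l' [] true
        have := hl'.length_le
        simp [totalLength, bits] at *
        omega) hg
  simp only [List.forall_mem_cons, List.not_mem_nil, false_imp_iff, implies_true,
          and_true] at key
  have h := key.1.append (ite key.2 (const [Γ'.bit true]) (const []))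
  refine (congrArg (PolyTime v) (funext fun x => ?_)).mp h
  have := foldl_incStep (l x) [] true
  simp only [List.nil_append, if_true] at this
  rw [← this, bits, bits, List.map_append]
  congr 1
  cases ((l x).foldl incStep ([], true)).2 <;> rfl

theorem encodeNat_length {f : α → List Γ'} (hf : PolyTime v f) :
    PolyTime v fun x => bits (encodeNat (f x).length) := by
  have e : ∀ (l : List Γ') (n : ℕ), l.foldl (fun n _ => n + 1) n = n + l.length := by
    intro l
    induction l with
    | nil => simp
    | cons s l ih => intro n; rw [List.foldl_cons, ih, List.length_cons]; omega
  have hlen : ∀ n, (encodeNat n).length ≤ n := by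
    have h1 : ∀ l, (StochasticGames.incBits l).length ≤ l.length + 1 := by
      intro l
      induction l with
      | nil => simp [StochasticGames.incBits]
      | cons d l ih => cases d <;> simp [StochasticGames.incBits, ih]
    intro n
    induction n with
    | zero => simp
    | succ n ih =>
      rw [encodeNat_succ]
      exact (h1 _).trans (by omega)
  have := foldl' (w := [fun n : ℕ => bits (encodeNat n)]) hf (step := fun _ n _ => n + 1)
    (init := fun _ => 0) (by simpa using bits_const [])
    (fun V _ hw s => by
      simp only [List.mem_cons, List.not_mem_nil, or_false, forall_eq] at hw ⊢
      simpa only [encodeNat_succ] using incBits hw)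
    (b := fun x => (f x).length) hf.length (fun x l' hl' => by
      rw [e]
      simpa [totalLength, bits] using (hlen _).trans hl'.length_le) List.mem_cons_self
  simpa [e] using this

theorem subBits {f g : α → List Bool} (hf : PolyTime v fun x => bits (f x))
    (hg : PolyTime v fun x => bits (g x)) :
    PolyTime v (fun x => bits (subBits (f x) (g x)).1) ∧
      PolyTimeBool v (fun x => (StochasticGames.subBits (f x) (g x)).2) := by
  have hb : ∀ (l y : List Bool) (c : Bool) (o : List Bool),
      (l.foldl subStep (y, c, o)).1.length ≤ y.length ∧
      (l.foldl subStep (y, c, o)).2.2.length = o.length + l.length := by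
    intro l
    induction l with
    | nil => simp
    | cons d l ih =>
      intro y c o
      rw [List.foldl_cons, subStep]
      obtain ⟨h1, h2⟩ := ih y.tail (bif d then y.headD false && c else y.headD false || c)
        (o ++ [(d ^^ y.headD false) ^^ c])
      refine ⟨h1.trans (by simp), h2.trans ?_⟩
      simp; omega
  have key : ∀ g' ∈ [(fun s : List Bool × Bool × List Bool => bits s.1), (fun s => [Γ'.bit s.2.1]),
      fun s => bits s.2.2], PolyTime v fun x => g' ((f x).foldl subStep (g x, false, [])) :=
    fun g' hg' =>
    foldlBits (w := [(fun s : List Bool × Bool × List Bool => bits s.1),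
      (fun s => [Γ'.bit s.2.1]), fun s => bits s.2.2]) hf
      (step := fun _ => subStep) (init := fun x => (g x, false, []))
      (by simpa using ⟨hg, const _, const _⟩)
      (fun V _ hw d => by
        simp only [List.forall_mem_cons, List.not_mem_nil, false_imp_iff, implies_true,
          and_true] at hw ⊢
        refine ⟨bits_tail hw.1, ?_, bits_append hw.2.2 ?_⟩
        · exact bool₂ (headD hw.1) hw.2.1 fun a b => bif d then a && b else a || b
        · exact bool₂ (headD hw.1) hw.2.1 fun a b => (d ^^ a) ^^ b)
      (b := fun x => (bits (f x)).length + (bits (g x)).length + 1)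
      ((hf.length.add hg.length).add (PolyBdd.const 1))
      (fun x l' hl' => by
        have := hb l' (g x) false []
        have := hl'.length_le
        simp [totalLength, bits] at *
        omega) hg'
  simp only [List.forall_mem_cons, List.not_mem_nil, false_imp_iff, implies_true,
          and_true] at key
  exact ⟨key.2.2, key.2.1⟩

theorem isSquareBits {l : α → List Bool} (hl : PolyTime v fun x => bits (l x)) :
    PolyTimeBool v fun x => isSquareBits (l x) := by
  have key : PolyTime v fun x => bits (sqrtState (lengthParity (l x)) (l x).reverse).1 :=
    foldlBits (w := [(fun s : List Bool × List Bool × Bool => bits s.1), (fun s => bits s.2.1),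
      fun s => [Γ'.bit s.2.2]]) (l := fun x => (l x).reverse)
      (by simpa [bits] using hl.reverse)
      (step := fun _ => sqrtStep) (init := fun x => ([false, false], [], lengthParity (l x)))
      (by simpa using ⟨const _, const _, foldl_bool hl (fun c _ => !c) false⟩)
      (fun V _ hw d => by
        simp only [List.forall_mem_cons, List.not_mem_nil, false_imp_iff, implies_true,
          and_true] at hw ⊢
        obtain ⟨h1, h2, h3⟩ := hw
        have hd := bits_cons d h1
        obtain ⟨k1, k2⟩ := subBits hd (bits_cons true (bits_cons false h2))
        refine ⟨?_, ?_, ?_⟩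
        · refine (congrArg (PolyTime V) (funext fun y => ?_)).mp (ite h3 (ite k2 hd k1) hd)
          simp only [sqrtStep]
          cases y.2.2.2 <;> simp
          cases (StochasticGames.subBits (d :: y.2.1) (true :: false :: y.2.2.1)).2 <;> rfl
        · refine (congrArg (PolyTime V) (funext fun y => ?_)).mp
            (ite h3 (ite k2 (bits_cons false h2) (bits_cons true h2)) h2)
          simp only [sqrtStep]
          cases y.2.2.2 <;> simp
          cases (StochasticGames.subBits (d :: y.2.1) (true :: false :: y.2.2.1)).2 <;> rfl
        · refine (congrArg (PolyTime V) (funext fun y => ?_)).mp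
            (bool₂ h3 (const [Γ'.bit true]) (d := fun _ => true) fun a _ => !a)
          simp only [sqrtStep]
          cases y.2.2.2 <;> simp
          cases (StochasticGames.subBits (d :: y.2.1) (true :: false :: y.2.2.1)).2 <;> rfl)
      (b := fun x => 2 * (bits (l x)).length + 3)
      (((PolyBdd.const 2).mul hl.length).add (PolyBdd.const 3))
      (fun x l' hl' => by
        have h1 := sqrtState_spec (lengthParity (l x)) l'.reverse
        have := hl'.length_le
        rw [List.reverse_reverse] at h1
        obtain ⟨h1, h2, -⟩ := h1
        simp [totalLength, bits, sqrtState] at *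
        omega) List.mem_cons_self
  exact bool₂ (foldl_bool key (fun c d => c || d) false) (const [Γ'.bit true]) (d := fun _ => true)
    fun a _ => !a

/-- A fold over words is a fold over letters with a buffer: digits are appended to the buffer, and a
comma applies `step` to it and empties it. -/
theorem foldlWords {w : List (β → List Γ')} {l : α → List (List Bool)}
    (hl : PolyTime v fun x => encodeWords (l x)) {step : α → β → List Bool → β} {init : α → β}
    (hinit : ∀ g ∈ w, PolyTime v fun x => g (init x))
    (hstep : ∀ V : List (α × β × List Bool → List Γ'), (∀ h ∈ v, PolyTime V fun y => h y.1) →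
      (∀ h ∈ w, PolyTime V fun y => h y.2.1) → PolyTime V (fun y => bits y.2.2) → ∀ g ∈ w,
      PolyTime V fun y => g (step y.1 y.2.1 y.2.2))
    {b : α → ℕ} (hb : PolyBdd (totalLength v) b)
    (hbound : ∀ x l', l' <+: l x → totalLength w (l'.foldl (step x) (init x)) ≤ b x)
    {g : β → List Γ'} (hg : g ∈ w) : PolyTime v fun x => g ((l x).foldl (step x) (init x)) := by
  set stp : α → List Bool × β → Γ' → List Bool × β := fun x y s => match s with
    | Γ'.bit d => (y.1 ++ [d], y.2)
    | Γ'.comma => ([], step x y.2 y.1)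
    | _ => y with hstp
  have e1 : ∀ (x : α) (u c : List Bool) (y : β),
      (bits u).foldl (stp x) (c, y) = (c ++ u, y) := by
    intro x u
    induction u with
    | nil => simp [bits]
    | cons d u ih =>
      intro c y
      change (bits u).foldl (stp x) (c ++ [d], y) = _
      rw [ih]
      simp
  have e2 : ∀ (x : α) (l : List (List Bool)) (y : β),
      (encodeWords l).foldl (stp x) ([], y) = ([], l.foldl (step x) y) := by
    intro x l
    induction l with
    | nil => simp [encodeWords]
    | cons u l ih =>
      intro y
      have : encodeWords (u :: l) = bits u ++ Γ'.comma :: encodeWords l := by simp [encodeWords]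
      rw [this, List.foldl_append, e1, List.foldl_cons]
      exact ih _
  -- A prefix of the encoding may end inside a word. The accumulator then comes from the completed
  -- words, and the buffer is no longer than the prefix; this gives the bound on intermediate
  -- results.
  have e3 : ∀ (x : α) (l : List (List Bool)) (y : β) (l' : List Γ'), l' <+: encodeWords l →
      ∃ c l'', l'' <+: l ∧ c.length ≤ l'.length ∧
        l'.foldl (stp x) ([], y) = (c, l''.foldl (step x) y) := by
    intro x l
    induction l with
    | nil =>
      intro y l' hl'
      obtain rfl : l' = [] := by simpa [encodeWords] using hl'
      exact ⟨[], [], by simp⟩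
    | cons u l ih =>
      intro y l' hl'
      have : encodeWords (u :: l) = (bits u ++ [Γ'.comma]) ++ encodeWords l := by
        simp [encodeWords]
      rw [this] at hl'
      rcases List.prefix_or_prefix_of_prefix hl' (List.prefix_append _ _) with h | ⟨t, rfl⟩
      · rcases List.prefix_concat_iff.1 h with rfl | h
        · refine ⟨[], [u], by simp, by simp, ?_⟩
          rw [List.foldl_append, e1]
          rfl
        · obtain ⟨t, ht⟩ := h
          obtain ⟨l₁, l₂, h1, h2, h3⟩ := List.append_eq_map_iff.1 ht
          refine ⟨l₁, [], by simp, by simp [← h2], ?_⟩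
          have := e1 x l₁ [] y
          rw [← h2]
          simpa [bits] using this
      · obtain ⟨c, l'', h1, h2, h3⟩ := ih (step x y u) t ((List.prefix_append_right_inj _).1 hl')
        refine ⟨c, u :: l'', by simpa using h1, by simp; omega, ?_⟩
        rw [List.foldl_append, List.foldl_append, e1]
        exact h3
  have key := foldl' (w := (fun s : List Bool × β => bits s.1) :: w.map fun g s => g s.2) hl
    (step := stp) (init := fun x => ([], init x)) (by
      simp only [List.forall_mem_cons, List.forall_mem_map]
      exact ⟨const _, hinit⟩)
    (fun V hv hw s => by
      have hw' := hw
      simp only [List.forall_mem_cons, List.forall_mem_map] at hw ⊢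
      rcases s with _ | d | _ | _ | _
      · exact hw
      · exact ⟨bits_append hw.1 (const [Γ'.bit d]), hw.2⟩
      · exact hw
      · exact hw
      · refine ⟨const _, fun g hg => ?_⟩
        have := hstep ((fun y => bits y.2.2) :: (v.map (fun h y => h y.1) ++
          w.map fun h y => h y.2.1)) (fun h hh => var (by
            refine List.mem_cons_of_mem _ (List.mem_append_left _ (List.mem_map.2 ⟨h, hh, rfl⟩))))
          (fun h hh => var (by
            refine List.mem_cons_of_mem _ (List.mem_append_right _ (List.mem_map.2 ⟨h, hh, rfl⟩))))
          (var List.mem_cons_self) g hg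
        refine this.subst (h := fun y : α × List Bool × β => (y.1, y.2.2, y.2.1)) ?_
        simp only [List.forall_mem_cons, List.forall_mem_append, List.forall_mem_map]
        exact ⟨hw.1, hv, hw.2⟩)
    (b := fun x => (encodeWords (l x)).length + b x) (hl.length.add hb)
    (fun x l' hl' => by
      obtain ⟨c, l'', h1, h2, h3⟩ := e3 x (l x) (init x) l' hl'
      rw [h3]
      have h4 := hbound x l'' h1
      have := hl'.length_le
      simp [totalLength, bits, Function.comp_def] at *
      omega) (g := fun s => g s.2) (List.mem_cons_of_mem _ (List.mem_map.2 ⟨g, hg, rfl⟩))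
  simpa only [e2] using key

end PolyTime

end

end StochasticGames

/-! ### Rational sums of square roots -/

namespace StochasticGames

noncomputable section

open Polynomial in
/-- If a sum of square roots of natural numbers is rational, then so is each of them. -/
theorem isSquare_of_sum_sqrt_eq {l : List ℕ} {t : ℚ} (h : (l.map fun a : ℕ => √(a : ℝ)).sum = t) :
    ∀ a ∈ l, IsSquare a := by
  classical
  set S : Set ℝ := {x | ∃ a ∈ l, √(a : ℝ) = x} with hS
  have hfin : S.Finite := by
    have : S = (fun a : ℕ => √(a : ℝ)) '' {a | a ∈ l} := by ext; simp [hS]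
    rw [this]
    exact (List.finite_toSet l).image _
  set K := IntermediateField.adjoin ℚ S with hK
  have hint : ∀ a : ℕ, IsIntegral ℚ (√(a : ℝ)) := fun a =>
    ⟨X ^ 2 - C (a : ℚ), monic_X_pow_sub_C _ two_ne_zero, by simp⟩
  have := hfin.to_subtype
  have : FiniteDimensional ℚ K := IntermediateField.finiteDimensional_adjoin (S := S) (by
      rintro x ⟨a, -, rfl⟩
      exact hint a)
  have hmem : ∀ a ∈ l, √(a : ℝ) ∈ K := fun a ha =>
    IntermediateField.subset_adjoin _ _ ⟨a, ha, rfl⟩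
  have hd : (0 : ℚ) < Module.finrank ℚ K := by exact_mod_cast Module.finrank_pos
  -- The minimal polynomial of the root of a nonsquare is `X ^ 2 - a`, which has no linear term, so
  -- the trace vanishes; a rational root contributes itself times the degree.
  have htr : ∀ a (ha : a ∈ l), Algebra.trace ℚ K ⟨√(a : ℝ), hmem a ha⟩ =
      Module.finrank ℚ K * (if IsSquare a then (a.sqrt : ℚ) else 0) := by
    intro a ha
    split_ifs with hsq
    · obtain ⟨m, rfl⟩ := hsq
      have : (⟨√((m * m : ℕ) : ℝ), hmem _ ha⟩ : K) = algebraMap ℚ K m := by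
        apply Subtype.ext
        push_cast
        rw [Real.sqrt_mul_self (by positivity)]
      rw [this, Algebra.trace_algebraMap, Nat.sqrt_eq]
      simp
    · have hmin : minpoly ℚ (⟨√(a : ℝ), hmem a ha⟩ : K) = X ^ 2 - C (a : ℚ) := by
        symm
        refine minpoly.eq_of_irreducible_of_monic ?_ ?_ (monic_X_pow_sub_C _ two_ne_zero)
        · refine X_pow_sub_C_irreducible_of_prime Nat.prime_two fun b hb => hsq ?_
          rw [← Rat.isSquare_natCast_iff]
          exact ⟨b, by rw [← hb, sq]⟩
        · rw [← (algebraMap K ℝ).injective.eq_iff]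
          simp
      rw [trace_eq_finrank_mul_minpoly_nextCoeff, hmin,
        nextCoeff_of_natDegree_pos (by rw [natDegree_X_pow_sub_C]; norm_num),
        natDegree_X_pow_sub_C]
      simp
  have hsum : (l.map fun a => if IsSquare a then (a.sqrt : ℚ) else 0).sum = t := by
    have h1 : (l.attach.map fun a => (⟨√(a.1 : ℝ), hmem a.1 a.2⟩ : K)).sum =
        algebraMap ℚ K t := by
      apply (algebraMap K ℝ).injective
      rw [map_list_sum, List.map_map, ← IsScalarTower.algebraMap_apply ℚ K ℝ]
      refine Eq.trans ?_ h
      conv_rhs => rw [← List.attach_map_subtype_val l, List.map_map]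
      rfl
    have h2 := congrArg (Algebra.trace ℚ K) h1
    rw [map_list_sum, List.map_map, Algebra.trace_algebraMap, nsmul_eq_mul] at h2
    apply mul_left_cancel₀ hd.ne'
    rw [← h2, ← List.sum_map_mul_left]
    conv_lhs => rw [← List.attach_map_subtype_val l, List.map_map]
    congr 1
    exact List.map_congr_left fun a _ => (htr a.1 a.2).symm
  by_contra! hcon
  obtain ⟨a, ha, hsq⟩ := hcon
  have hle : ∀ a : ℕ, ((if IsSquare a then (a.sqrt : ℚ) else 0 : ℚ) : ℝ) ≤ √(a : ℝ) := by
    intro a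
    split_ifs with h
    · simpa using Real.nat_sqrt_le_real_sqrt
    · simp
  -- Taking traces replaces each irrational root by zero without changing the sum. All roots are
  -- nonnegative and a nonsquare has a positive one, so the sum would decrease.
  have hlt := List.sum_lt_sum (l := l)
    (fun a : ℕ => ((if IsSquare a then (a.sqrt : ℚ) else 0 : ℚ) : ℝ)) (fun a : ℕ => √(a : ℝ))
    (fun a _ => hle a) ⟨a, ha, by
      rw [if_neg hsq, Rat.cast_zero, Real.sqrt_pos, Nat.cast_pos]
      exact Nat.pos_of_ne_zero fun h => hsq (h ▸ ⟨0, rfl⟩)⟩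
  rw [h, ← hsum] at hlt
  apply hlt.ne
  have := map_list_sum (Rat.castHom ℝ) (l.map fun a => if IsSquare a then (a.sqrt : ℚ) else 0)
  rw [List.map_map] at this
  exact this.symm

end

end StochasticGames

namespace StochasticGames

noncomputable section

open Computability (Γ' encodeNat)

theorem sum_fin_four_mul_add_two {M : Type} [AddCommMonoid M] (n : ℕ) (F : ℕ → M) :
    ∑ l : Fin (4 * n + 2), F l =
      F 0 + (F 1 + ∑ j ∈ Finset.range n, ∑ c : Fin 4, F (4 * j + c + 2)) := by
  rw [← Fin.sum_univ_eq_sum_range fun j => ∑ c : Fin 4, F (4 * j + c + 2)]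
  rw [Fin.sum_univ_eq_sum_range F, Fin.sum_univ_eq_sum_range fun j => ∑ c : Fin 4, F (4 * j + c + 2)]
  induction n with
  | zero => simp [Finset.sum_range_succ]
  | succ n ih =>
    rw [show 4 * (n + 1) + 2 = 4 * n + 2 + 1 + 1 + 1 + 1 by ring, Finset.sum_range_succ,
      Finset.sum_range_succ, Finset.sum_range_succ, Finset.sum_range_succ, ih,
      Finset.sum_range_succ _ n, Fin.sum_univ_four]
    simp only [add_assoc]
    rfl

/-! ### The game of a sum-of-square-roots instance -/

namespace SqrtSumInstance

variable (I : SqrtSumInstance)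

/-- The length of the binary encoding. -/
def size : ℕ := I.encode.length

/-- The number of square roots. -/
def num : ℕ := I.a.length

/-- The `i`-th radicand. -/
def rad (i : ℕ) : ℕ := (I.a.getD i 1 : ℕ+)

/-- Whether all radicands are perfect squares. -/
def allSquares : Bool := I.a.all fun z => isSquareBits (encodeNat (z : ℕ))

theorem allSquares_iff : I.allSquares = true ↔ ∀ z ∈ I.a, IsSquare (z : ℕ) := by
  simp [allSquares, isSquareBits_iff]

theorem encode_eq : I.encode = encodeNats ((I.t : ℕ) :: I.a.map fun z : ℕ+ => (z : ℕ)) := by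
  simp [encode, List.map_eq_flatMap]

theorem isYes_iff : I.IsYes ↔ (I.a.map fun z : ℕ+ => √((z : ℕ) : ℝ)).sum ≤ (I.t : ℕ) := by
  simp [IsYes, List.map_eq_flatMap, List.flatMap_assoc]

theorem lt_two_pow_size {m : ℕ} (h : m = I.t ∨ ∃ z ∈ I.a, m = (z : ℕ)) : m < 2 ^ I.size := by
  refine (lt_two_pow_length_encodeNat m).trans_le (Nat.pow_le_pow_right two_pos ?_)
  have hm : m ∈ (I.t : ℕ) :: I.a.map fun z : ℕ+ => (z : ℕ) := by
    rcases h with h | ⟨z, hz, h⟩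
    · simp [h]
    · exact List.mem_cons_of_mem _ (List.mem_map.2 ⟨z, hz, h.symm⟩)
  rw [size, encode_eq, encodeNats, List.length_flatMap]
  refine le_trans ?_ (List.single_le_sum (by simp) _ (List.mem_map.2 ⟨m, hm, rfl⟩))
  simp

theorem rad_lt (i : ℕ) : I.rad i < 2 ^ I.size := by
  rw [rad]
  by_cases h : i < I.a.length
  · rw [List.getD_eq_getElem _ _ h]
    exact I.lt_two_pow_size (Or.inr ⟨_, List.getElem_mem h, rfl⟩)
  · rw [List.getD_eq_default _ _ (not_lt.1 h)]
    exact lt_of_le_of_lt I.t.pos (I.lt_two_pow_size (Or.inl rfl))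

theorem rad_pos (i : ℕ) : 0 < I.rad i := (I.a.getD i 1).pos

end SqrtSumInstance

/-- The reward to player `i` for action `z` in state `c` of the square root gadget of `a`, scaled
down by `2 ^ s`. -/
def gadgetReward (s a : ℕ) : (c z i : ℕ) → Frac
  | 0, 0, 1 => (5, 8)
  -- The denominator `156025 = 395 ^ 2` below makes the value of B for player 2 equal to `4 / 237 *
  -- √a / 2 ^ s`. Here `49375 = 156025 * 25 / 79`, which gives the ratio `79 / 25` required by
  -- `GadgetEq.value`.
  | 0, 0, 2 => (a, 2 ^ (2 * s) * 49375)
  | 0, 1, 1 => (1, 1)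
  | 1, 0, 0 => (16, 25)
  | 1, 0, 1 => (1, 2)
  | 1, 0, 2 => (a, 2 ^ (2 * s) * 156025)
  | 1, 1, 2 => (1, 1)
  | 2, 1, 1 => (1, 1)
  | 3, 0, 0 => (7, 25)
  | 3, 0, 1 => (1, 2)
  | 3, 0, 2 => (1, 1)
  | 3, 1, 0 => (1, 1)
  | _, _, _ => (0, 1)

/-- The probability that play leaves the gadget after action `z` in its state `c`. -/
def gadgetExit : (c z : ℕ) → Frac
  | 0, 0 => (1, 2)
  | 1, 0 => (1, 1)
  | 3, 0 => (1, 1)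
  | _, _ => (0, 1)

/-- The transition probabilities inside the gadget. -/
def gadgetTrans : (c z c' : ℕ) → Frac
  | 0, 0, 3 => (1, 2)
  | 0, 1, 1 => (1, 1)
  | 1, 1, 0 => (1, 1)
  | 2, 0, 1 => (1, 1)
  | 2, 1, 3 => (1, 1)
  | 3, 1, 2 => (1, 1)
  | _, _, _ => (0, 1)

/-- The players who control the states of the gadget. -/
def gadgetCtrl : ℕ → Fin 4
  | 0 => 0
  | 2 => 2
  | _ => 1

namespace SqrtSumInstance

variable (I : SqrtSumInstance)

/-- Rewards: state `0` compares, state `1` is absorbing, and the states from `2` on form the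
gadgets. -/
def stateReward : (k z i : ℕ) → Frac
  -- Compared with twice the sum of the roots over the same denominator: `237` comes from the gadget
  -- value and `num + 1` from the uniform lottery. The added bit breaks ties when all radicands are
  -- squares.
  | 0, 0, 2 => (2 * I.t + I.allSquares.toNat, 2 ^ I.size * (237 * I.num.succPNat))
  | k + 2, z, i => gadgetReward I.size (I.rad (k / 4)) (k % 4) z i
  | _, _, _ => (0, 1)

/-- Transition probabilities. -/
def stateTrans : (k z l : ℕ) → Frac
  | 0, 1, 1 => (1, I.num.succPNat)
  -- The lottery enters each gadget at its state B, whose value for player 2 is the square root.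
  | 0, 1, l + 2 => if l % 4 = 1 then (1, I.num.succPNat) else (0, 1)
  | 0, _, 1 => (1, 1)
  | 1, _, 1 => (1, 1)
  | k + 2, z, 1 => gadgetExit (k % 4) z
  | k + 2, z, l + 2 => if l / 4 = k / 4 then gadgetTrans (k % 4) z (l % 4) else (0, 1)
  | _, _, _ => (0, 1)

/-- The players who control the states. -/
def stateCtrl : ℕ → Fin 4
  | 0 => 2
  | 1 => 3
  | k + 2 => gadgetCtrl (k % 4)

end SqrtSumInstance

theorem Frac.val_mk (m : ℕ) (d : ℕ+) : Frac.val (m, d) = m / (d : ℕ) := rfl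

@[simp] theorem Frac.val_zero : Frac.val (0, 1) = 0 := by simp [Frac.val]

@[simp] theorem Frac.val_one : Frac.val (1, 1) = 1 := by simp [Frac.val]

theorem Frac.val_le_one {m : ℕ} {d : ℕ+} (h : m ≤ d) : Frac.val (m, d) ≤ 1 := by
  rw [Frac.val_mk]
  exact div_le_one_of_le₀ (by exact_mod_cast h) (by positivity)

theorem gadgetReward_le_one {s a : ℕ} (ha : a ≤ 2 ^ (2 * s)) (c z i : ℕ) :
    (gadgetReward s a c z i).val ≤ 1 := by
  unfold gadgetReward
  split <;> (apply Frac.val_le_one; simp only [PNat.mul_coe, PNat.pow_coe, PNat.val_ofNat]; omega)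

theorem gadgetTrans_sum (c : Fin 4) (z : Fin 2) :
    (gadgetExit c z).val + ∑ c' : Fin 4, (gadgetTrans c z c').val = 1 := by
  fin_cases c <;> fin_cases z <;> simp [Fin.sum_univ_four, gadgetExit, gadgetTrans]
  simp [Frac.val, ← two_mul]

namespace SqrtSumInstance

variable (I : SqrtSumInstance)

theorem stateReward_le_one (k z i : ℕ) : (I.stateReward k z i).val ≤ 1 := by
  unfold stateReward
  split
  · apply Frac.val_le_one
    have h := I.lt_two_pow_size (Or.inl rfl)
    have h1 := Bool.toNat_le I.allSquares
    simp only [PNat.mul_coe, PNat.pow_coe, PNat.val_ofNat, Nat.succPNat_coe]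
    calc 2 * (I.t : ℕ) + I.allSquares.toNat ≤ 2 ^ I.size * 2 := by omega
      _ ≤ 2 ^ I.size * (237 * (I.num + 1)) := Nat.mul_le_mul_left _ (by omega)
  · apply gadgetReward_le_one
    rw [two_mul, pow_add]
    exact (I.rad_lt _).le.trans (Nat.le_mul_of_pos_left _ (by positivity))
  · simp

/-- The homomorphism `φ` serves two uses of each sum: in `ℝ≥0` to check that the probabilities add
up to 1, and in `ℝ` to compute expected values. -/
theorem sum_stateTrans_mul_zero_zero {R : Type} [Semiring R] (φ : ℝ≥0 →+* R) (w : ℕ → R) :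
    ∑ l : Fin (4 * I.num + 2), φ (I.stateTrans 0 0 l).val * w l = w 1 := by
  rw [sum_fin_four_mul_add_two I.num fun l => φ (I.stateTrans 0 0 l).val * w l]
  simp [stateTrans]

theorem sum_stateTrans_mul_zero_one {R : Type} [Semiring R] (φ : ℝ≥0 →+* R) (w : ℕ → R) :
    ∑ l : Fin (4 * I.num + 2), φ (I.stateTrans 0 1 l).val * w l =
      φ (I.num + 1)⁻¹ * (w 1 + ∑ j ∈ Finset.range I.num, w (4 * j + 3)) := by
  rw [sum_fin_four_mul_add_two I.num fun l => φ (I.stateTrans 0 1 l).val * w l, mul_add,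
    Finset.mul_sum]
  simp [stateTrans, Fin.sum_univ_four, Frac.val_mk]

theorem sum_stateTrans_mul_one {R : Type} [Semiring R] (φ : ℝ≥0 →+* R) (z : ℕ) (w : ℕ → R) :
    ∑ l : Fin (4 * I.num + 2), φ (I.stateTrans 1 z l).val * w l = w 1 := by
  rw [sum_fin_four_mul_add_two I.num fun l => φ (I.stateTrans 1 z l).val * w l]
  simp [stateTrans]

theorem sum_stateTrans_mul_gadget {R : Type} [Semiring R] (φ : ℝ≥0 →+* R) {j : ℕ}
    (hj : j < I.num) (c : Fin 4) (z : ℕ) (w : ℕ → R) :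
    ∑ l : Fin (4 * I.num + 2), φ (I.stateTrans (4 * j + c + 2) z l).val * w l =
      φ (gadgetExit c z).val * w 1 +
        ∑ c' : Fin 4, φ (gadgetTrans c z c').val * w (4 * j + c' + 2) := by
  have h1 : ∀ (j : ℕ) (c : Fin 4), (4 * j + c) / 4 = j := fun j c => by omega
  have h2 : ∀ (j : ℕ) (c : Fin 4), (4 * j + c) % 4 = c := fun j c => by omega
  rw [sum_fin_four_mul_add_two I.num fun l => φ (I.stateTrans (4 * j + c + 2) z l).val * w l]
  simp only [stateTrans, h1, h2, Frac.val_zero, map_zero, zero_mul, zero_add]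
  congr 1
  rw [Finset.sum_eq_single j]
  · simp
  · intro j' _ hj'
    simp [hj']
  · exact fun h => absurd (Finset.mem_range.2 hj) h

theorem stateCases {P : ℕ → Prop} (h0 : P 0) (h1 : P 1)
    (h : ∀ j < I.num, ∀ c : Fin 4, P (4 * j + c + 2)) : ∀ k < 4 * I.num + 2, P k := by
  rintro (_ | _ | k) hk
  · exact h0
  · exact h1
  · have := h (k / 4) (by omega) ⟨k % 4, by omega⟩
    rwa [Nat.div_add_mod] at this

theorem sum_stateTrans (z : Fin 2) : ∀ k < 4 * I.num + 2,
    ∑ l : Fin (4 * I.num + 2), (I.stateTrans k z l).val = 1 := by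
  refine I.stateCases (P := fun k => ∑ l : Fin (4 * I.num + 2), (I.stateTrans k z l).val = 1) ?_ ?_ fun j hj c => ?_
  · fin_cases z
    · simpa using I.sum_stateTrans_mul_zero_zero (RingHom.id _) fun _ => 1
    · have h : ((I.num : ℝ≥0) + 1) ≠ 0 := by positivity
      have := I.sum_stateTrans_mul_zero_one (RingHom.id _) fun _ => 1
      simp only [RingHom.id_apply, mul_one, Finset.sum_const, Finset.card_range, nsmul_eq_mul] at this
      rw [add_comm 1, inv_mul_cancel₀ h] at this
      exact this
  · simpa using I.sum_stateTrans_mul_one (RingHom.id _) z fun _ => 1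
  · have := I.sum_stateTrans_mul_gadget (RingHom.id _) hj c z fun _ => 1
    simp only [RingHom.id_apply, mul_one, gadgetTrans_sum] at this
    exact this

/-- The game of a sum-of-square-roots instance. -/
def game : Game 4 where
  numStates := 4 * I.num + 2
  discount := (1, 2)
  discount_lt_one := by
    rw [Frac.val_mk]
    exact NNReal.coe_lt_coe.1 (by norm_num)
  ctrl k := stateCtrl k
  numActions _ := 2
  numActions_pos _ := two_pos
  reward k z i := I.stateReward k z i
  reward_le_one k z i := I.stateReward_le_one k z i
  trans k z l := I.stateTrans k z l
  trans_sum k z := I.sum_stateTrans z k k.2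

end SqrtSumInstance

end

end StochasticGames

/-! ### One-step values of the constructed game -/

namespace StochasticGames

noncomputable section

open Computability (Γ' encodeNat)

theorem sum_map_eq_sum_range_getD {β M : Type} [AddCommMonoid M] (l : List β) (d : β)
    (f : β → M) : (l.map f).sum = ∑ j ∈ Finset.range l.length, f (l.getD j d) := by
  induction l with
  | nil => simp
  | cons b l ih => simp [Finset.sum_range_succ', ih, add_comm]

theorem pmf_fin_two (p : PMF (Fin 2)) : (p 1).toReal = 1 - (p 0).toReal := by
  have := Game.pmf_sum_toReal p
  rw [Fin.sum_univ_two] at this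
  linarith

/-- The value of a step in the gadget, from the values `u` of its states. -/
def gadgetStep (s a : ℕ) (u : Fin 4 → ℝ) (i : Fin 4) (c z : ℕ) : ℝ :=
  (gadgetReward s a c z i).val + 1 / 2 * ∑ c' : Fin 4, (gadgetTrans c z c').val * u c'

namespace SqrtSumInstance

variable (I : SqrtSumInstance)

/-- The value of a step, from the values `w` of the states. -/
def stepValue (w : ℕ → ℝ) (i : Fin 4) (k z : ℕ) : ℝ :=
  (I.stateReward k z i).val +
    1 / 2 * ∑ l : Fin (4 * I.num + 2), ((I.stateTrans k z l).val : ℝ) * w l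

theorem stepValue_zero_zero (w : ℕ → ℝ) (i : Fin 4) : I.stepValue w i 0 0 =
    (if i = 2 then (2 * I.t + I.allSquares.toNat) / (2 ^ I.size * (237 * (I.num + 1))) else 0 : ℝ) +
      1 / 2 * w 1 := by
  have h : ∑ l : Fin (4 * I.num + 2), ((I.stateTrans 0 0 l).val : ℝ) * w l = _ :=
    I.sum_stateTrans_mul_zero_zero NNReal.toRealHom w
  rw [stepValue, h]
  congr 1
  fin_cases i <;> simp [stateReward, Frac.val_mk]

theorem stepValue_zero_one (w : ℕ → ℝ) (i : Fin 4) : I.stepValue w i 0 1 =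
    1 / 2 * ((I.num + 1 : ℝ)⁻¹ * (w 1 + ∑ j ∈ Finset.range I.num, w (4 * j + 3))) := by
  have h : ∑ l : Fin (4 * I.num + 2), ((I.stateTrans 0 1 l).val : ℝ) * w l = _ :=
    I.sum_stateTrans_mul_zero_one NNReal.toRealHom w
  rw [stepValue, h]
  simp [stateReward]

theorem stepValue_one (w : ℕ → ℝ) (i : Fin 4) (z : ℕ) : I.stepValue w i 1 z = 1 / 2 * w 1 := by
  have h : ∑ l : Fin (4 * I.num + 2), ((I.stateTrans 1 z l).val : ℝ) * w l = _ :=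
    I.sum_stateTrans_mul_one NNReal.toRealHom z w
  rw [stepValue, h]
  simp [stateReward]

theorem stepValue_gadget {w : ℕ → ℝ} (hw : w 1 = 0) (i c : Fin 4) (z : ℕ) {j : ℕ}
    (hj : j < I.num) : I.stepValue w i (4 * j + c + 2) z =
      gadgetStep I.size (I.rad j) (fun c => w (4 * j + c + 2)) i c z := by
  have h1 : (4 * j + c : ℕ) / 4 = j := by omega
  have h2 : (4 * j + c : ℕ) % 4 = c := by omega
  have h : ∑ l : Fin (4 * I.num + 2), ((I.stateTrans (4 * j + c + 2) z l).val : ℝ) * w l = _ :=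
    I.sum_stateTrans_mul_gadget NNReal.toRealHom hj c z w
  rw [stepValue, h, hw, mul_zero, zero_add,
    gadgetStep, stateReward, h1, h2]
  rfl

/-- The probability of the first action. -/
def quit {I : SqrtSumInstance} (x : I.game.Stationary) (k : Fin (4 * I.num + 2)) : ℝ :=
  ((show PMF (Fin 2) from x k) 0).toReal

theorem quit_nonneg {I : SqrtSumInstance} (x : I.game.Stationary) (k) : 0 ≤ quit x k :=
  ENNReal.toReal_nonneg

theorem quit_le_one {I : SqrtSumInstance} (x : I.game.Stationary) (k) : quit x k ≤ 1 :=
  ENNReal.toReal_le_of_le_ofReal zero_le_one (by simpa using PMF.coe_le_one _ _)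

/-- The one-shot criterion for two actions per state. The values are indexed by `ℕ` so that `4 * j +
c + 2` can be used without bounds. -/
theorem isNash_iff {I : SqrtSumInstance} (x : I.game.Stationary) :
    I.game.IsNash x.toProfile ↔ ∃ w : Fin 4 → ℕ → ℝ,
      (∀ i (k : Fin (4 * I.num + 2)), w i k =
        quit x k * I.stepValue (w i) i k 0 + (1 - quit x k) * I.stepValue (w i) i k 1) ∧
      ∀ (k : Fin (4 * I.num + 2)) (z : Fin 2),
        I.stepValue (w (stateCtrl k)) (stateCtrl k) k z ≤ w (stateCtrl k) k := by
  have hg : I.game.gam = 1 / 2 := by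
    change ((Frac.val (1, 2) : ℝ≥0) : ℝ) = 1 / 2
    simp [Frac.val]
  have hstep : ∀ (w : ℕ → ℝ) (i : Fin 4) (k : Fin (4 * I.num + 2)) (z : Fin 2),
      I.game.stepValue (I.game.rew i) (fun l => w l.val) ⟨k, z⟩ = I.stepValue w i k z := by
    intro w i k z
    rw [Game.stepValue, hg]
    rfl
  have hsum : ∀ (w : ℕ → ℝ) (i : Fin 4) (k : Fin (4 * I.num + 2)),
      ∑ a, (x k a).toReal * I.game.stepValue (I.game.rew i) (fun l => w l.val) ⟨k, a⟩ =
        quit x k * I.stepValue w i k 0 + (1 - quit x k) * I.stepValue w i k 1 := by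
    intro w i k
    rw [quit, ← pmf_fin_two]
    refine (Fin.sum_univ_two (f := fun a : Fin 2 => ((show PMF (Fin 2) from x k) a).toReal *
      I.game.stepValue (I.game.rew i) (fun l => w l.val) ⟨k, a⟩)).trans ?_
    rw [hstep, hstep]
    rfl
  rw [Game.isNash_iff]
  constructor
  · rintro ⟨W, hW, hopt⟩
    obtain ⟨w, rfl⟩ : ∃ w : Fin 4 → ℕ → ℝ, W = fun i l => w i l.val :=
      ⟨fun i k => if h : k < 4 * I.num + 2 then W i ⟨k, h⟩ else 0, by
        funext i l
        simp only
        rw [dif_pos (show (l : ℕ) < 4 * I.num + 2 from l.2)]⟩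
    refine ⟨w, fun i k => (hW i k).trans (hsum (w i) i k), fun k z => ?_⟩
    rw [← hstep]
    exact hopt k z
  · rintro ⟨w, hw, hopt⟩
    refine ⟨fun i l => w i l.val, fun i k => (hw i k).trans (hsum (w i) i k).symm, fun k z => ?_⟩
    exact le_of_eq_of_le (hstep _ _ k z) (hopt k z)

/-- The reward to player `2` for leaving the gadget. -/
def bonus (j : ℕ) : ℝ := I.rad j / (2 ^ (2 * I.size) * 156025)

theorem bonus_pos (j : ℕ) : 0 < I.bonus j := by
  have := I.rad_pos j
  unfold bonus
  positivity

theorem bonus_le (j : ℕ) : I.bonus j ≤ 1 / 6241 := by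
  rw [bonus, div_le_div_iff₀ (by positivity) (by norm_num)]
  have h1 : I.rad j ≤ 2 ^ (2 * I.size) :=
    (I.rad_lt j).le.trans (Nat.pow_le_pow_right two_pos (by omega))
  have h2 : (I.rad j : ℝ) ≤ 2 ^ (2 * I.size) := by exact_mod_cast h1
  linarith

/-- Since `156025 = 395 ^ 2`, the root comes out with the rational factor `20 / (3 * 395) = 4 /
237`. -/
theorem sqrt_bonus (j : ℕ) : 20 / 3 * √(I.bonus j) = 4 / 237 * √(I.rad j : ℝ) / 2 ^ I.size := by
  rw [bonus, Real.sqrt_div (by positivity), mul_comm 2, pow_mul,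
    show ((2 : ℝ) ^ I.size) ^ 2 * 156025 = (2 ^ I.size * 395) ^ 2 by ring,
    Real.sqrt_sq (by positivity)]
  field_simp
  ring

/-- The comparison is never tied. -/
theorem compare :
    I.IsYes ∧ 2 * ∑ j ∈ Finset.range I.num, √(I.rad j : ℝ) < 2 * I.t + I.allSquares.toNat ∨
    ¬ I.IsYes ∧ (2 * I.t + I.allSquares.toNat : ℝ) < 2 * ∑ j ∈ Finset.range I.num,
      √(I.rad j : ℝ) := by
  have hS : (I.a.map fun z : ℕ+ => √((z : ℕ) : ℝ)).sum =
      ∑ j ∈ Finset.range I.num, √(I.rad j : ℝ) := sum_map_eq_sum_range_getD _ _ _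
  rw [isYes_iff, ← hS]
  cases h : I.allSquares with
  -- The sum is an integer `s`, and `s ≤ t` is equivalent to `2 * s < 2 * t + 1`, which excludes
  -- equality by parity.
  | true =>
    obtain ⟨s, hs⟩ : ∃ s : ℕ, (I.a.map fun z : ℕ+ => √((z : ℕ) : ℝ)).sum = s := by
      have h := I.allSquares_iff.1 h
      revert h
      generalize I.a = l
      intro h
      induction l with
      | nil => exact ⟨0, by simp⟩
      | cons z l ih =>
        obtain ⟨s, hs⟩ := ih fun z hz => h z (List.mem_cons_of_mem _ hz)
        obtain ⟨m, hm⟩ := h z List.mem_cons_self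
        refine ⟨m + s, ?_⟩
        rw [List.map_cons, List.sum_cons, hs, hm]
        push_cast
        rw [Real.sqrt_mul_self (by positivity)]
    rw [hs]
    rcases le_or_gt s I.t with hst | hst
    · refine Or.inl ⟨by exact_mod_cast hst, ?_⟩
      have : (s : ℝ) ≤ I.t := by exact_mod_cast hst
      simp
      linarith
    · have : (I.t : ℝ) + 1 ≤ s := by exact_mod_cast hst
      refine Or.inr ⟨by linarith, ?_⟩
      simp
      linarith
  -- A tie would make the sum rational and hence all radicands squares.
  | false =>
    have hne : (I.a.map fun z : ℕ+ => √((z : ℕ) : ℝ)).sum ≠ (I.t : ℕ) := by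
      intro hs
      have h1 := isSquare_of_sum_sqrt_eq (l := I.a.map fun z : ℕ+ => (z : ℕ)) (t := (I.t : ℕ)) (by
        rw [List.map_map]
        simpa [Function.comp_def] using hs)
      have : I.allSquares = true := I.allSquares_iff.2 fun z hz =>
        h1 _ (List.mem_map.2 ⟨z, hz, rfl⟩)
      simp [h] at this
    rcases lt_or_gt_of_ne hne with hlt | hlt
    · exact Or.inl ⟨hlt.le, by simpa using hlt⟩
    · exact Or.inr ⟨not_le.2 hlt, by simpa using hlt⟩

end SqrtSumInstance

end

end StochasticGames

/-! ### Equilibria of the constructed game -/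

namespace StochasticGames

noncomputable section

open Computability (Γ' encodeNat)

namespace SqrtSumInstance

variable (I : SqrtSumInstance)

theorem gadgetStep_zero (j : ℕ) (u : Fin 4 → ℝ) (i c : Fin 4) :
    gadgetStep I.size (I.rad j) u i c 0 =
      (![![0, 5 / 8, 79 / 25 * I.bonus j, 0], ![16 / 25, 1 / 2, I.bonus j, 0], ![0, 0, 0, 0],
        ![7 / 25, 1 / 2, 1, 0]] : Fin 4 → Fin 4 → ℝ) c i +
      (![u 3 / 4, 0, u 1 / 2, 0] : Fin 4 → ℝ) c := by
  rw [gadgetStep]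
  congr 1
  · fin_cases c <;> fin_cases i <;> simp [gadgetReward, Frac.val_mk, bonus]
    field_simp
    ring
  · rw [Fin.sum_univ_four]
    fin_cases c <;> simp [gadgetTrans, Frac.val_mk] <;> ring

theorem gadgetStep_one (j : ℕ) (u : Fin 4 → ℝ) (i c : Fin 4) :
    gadgetStep I.size (I.rad j) u i c 1 =
      (![![0, 1, 0, 0], ![0, 0, 1, 0], ![0, 1, 0, 0], ![1, 0, 0, 0]] : Fin 4 → Fin 4 → ℝ) c i +
      ![u 1, u 0, u 3, u 2] c / 2 := by
  rw [gadgetStep]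
  congr 1
  · fin_cases c <;> fin_cases i <;> simp [gadgetReward, Frac.val_mk]
  · rw [Fin.sum_univ_four]
    fin_cases c <;> simp [gadgetTrans, Frac.val_mk] <;> ring

/-- This connects the reward tables with the equations solved above. Player 3 controls no state of a
gadget, so only the value equation remains for that player. -/
theorem gadgetEq_iff {j : ℕ} {y : Fin 4 → ℝ} (hy0 : ∀ c, 0 ≤ y c) (hy1 : ∀ c, y c ≤ 1)
    {u : Fin 4 → Fin 4 → ℝ} :
    ((∀ i c : Fin 4, u i c = y c * gadgetStep I.size (I.rad j) (u i) i c 0 +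
      (1 - y c) * gadgetStep I.size (I.rad j) (u i) i c 1) ∧
    (∀ (c : Fin 4) (z : Fin 2),
      gadgetStep I.size (I.rad j) (u (gadgetCtrl c)) (gadgetCtrl c) c z ≤
        u (gadgetCtrl c) c)) ↔
    GadgetEq (79 / 25 * I.bonus j) (I.bonus j) (y 0) (y 1) (y 2) (y 3)
      (fun i => u i.castSucc 0) (fun i => u i.castSucc 1) (fun i => u i.castSucc 2)
      (fun i => u i.castSucc 3) ∧
    ∀ c : Fin 4, u 3 c = y c * gadgetStep I.size (I.rad j) (u 3) 3 c 0 +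
      (1 - y c) * gadgetStep I.size (I.rad j) (u 3) 3 c 1 := by
  constructor
  · rintro ⟨h, hopt⟩
    have hq := fun c => hopt c 0
    have hc := fun c => hopt c 1
    simp only [Fin.val_zero, Fin.val_one, gadgetStep_zero, gadgetStep_one] at h hq hc
    refine ⟨⟨hy0 0, hy1 0, hy0 1, hy1 1, hy0 2, hy1 2, hy0 3, hy1 3, ?_, ?_, ?_, ?_, ?_, ?_, ?_,
      ?_, ?_, ?_, ?_, ?_, ?_, ?_, ?_, ?_, ?_, ?_, ?_, ?_⟩, fun c => ?_⟩
    · exact (h 0 0).trans (by simp)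
    · exact (h 1 0).trans (by simp)
    · exact (h 2 0).trans (by simp)
    · exact (h 0 1).trans (by simp)
    · exact (h 1 1).trans (by simp)
    · exact (h 2 1).trans (by simp)
    · exact (h 0 2).trans (by simp)
    · exact (h 1 2).trans (by simp)
    · exact (h 2 2).trans (by simp)
    · exact (h 0 3).trans (by simp)
    · exact (h 1 3).trans (by simp)
    · exact (h 2 3).trans (by simp)
    · exact le_of_eq_of_le (by simp [gadgetCtrl]) (hq 0)
    · exact le_of_eq_of_le (by simp [gadgetCtrl]) (hc 0)
    · exact le_of_eq_of_le (by simp [gadgetCtrl]) (hq 1)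
    · exact le_of_eq_of_le (by simp [gadgetCtrl]) (hc 1)
    · exact le_of_eq_of_le (by simp [gadgetCtrl]) (hq 2)
    · exact le_of_eq_of_le (by simp [gadgetCtrl]) (hc 2)
    · exact le_of_eq_of_le (by simp [gadgetCtrl]) (hq 3)
    · exact le_of_eq_of_le (by simp [gadgetCtrl]) (hc 3)
    · simpa only [gadgetStep_zero, gadgetStep_one] using h 3 c
  · rintro ⟨h, h3⟩
    have hA0 : u 0 0 = y 0 * (u 0 3 / 4) + (1 - y 0) * (u 0 1 / 2) := h.hA0
    have hA1 : u 1 0 = y 0 * (5 / 8 + u 1 3 / 4) + (1 - y 0) * (1 + u 1 1 / 2) := h.hA1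
    have hA2 : u 2 0 = y 0 * (79 / 25 * I.bonus j + u 2 3 / 4) + (1 - y 0) * (u 2 1 / 2) := h.hA2
    have hB0 : u 0 1 = y 1 * (16 / 25) + (1 - y 1) * (u 0 0 / 2) := h.hB0
    have hB1 : u 1 1 = y 1 * (1 / 2) + (1 - y 1) * (u 1 0 / 2) := h.hB1
    have hB2 : u 2 1 = y 1 * I.bonus j + (1 - y 1) * (1 + u 2 0 / 2) := h.hB2
    have hC0 : u 0 2 = y 2 * (u 0 1 / 2) + (1 - y 2) * (u 0 3 / 2) := h.hC0
    have hC1 : u 1 2 = y 2 * (u 1 1 / 2) + (1 - y 2) * (1 + u 1 3 / 2) := h.hC1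
    have hC2 : u 2 2 = y 2 * (u 2 1 / 2) + (1 - y 2) * (u 2 3 / 2) := h.hC2
    have hD0 : u 0 3 = y 3 * (7 / 25) + (1 - y 3) * (1 + u 0 2 / 2) := h.hD0
    have hD1 : u 1 3 = y 3 * (1 / 2) + (1 - y 3) * (u 1 2 / 2) := h.hD1
    have hD2 : u 2 3 = y 3 * 1 + (1 - y 3) * (u 2 2 / 2) := h.hD2
    have optAq : u 0 3 / 4 ≤ u 0 0 := h.optAq
    have optAc : u 0 1 / 2 ≤ u 0 0 := h.optAc
    have optBq : 1 / 2 ≤ u 1 1 := h.optBq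
    have optBc : u 1 0 / 2 ≤ u 1 1 := h.optBc
    have optCq : u 2 1 / 2 ≤ u 2 2 := h.optCq
    have optCc : u 2 3 / 2 ≤ u 2 2 := h.optCc
    have optDq : 1 / 2 ≤ u 1 3 := h.optDq
    have optDc : u 1 2 / 2 ≤ u 1 3 := h.optDc
    refine ⟨fun i c => ?_, fun c z => ?_⟩
    · fin_cases i
      · simp only [gadgetStep_zero, gadgetStep_one]
        fin_cases c
        · exact hA0.trans (by simp)
        · exact hB0.trans (by simp)
        · exact hC0.trans (by simp)
        · exact hD0.trans (by simp)
      · simp only [gadgetStep_zero, gadgetStep_one]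
        fin_cases c
        · exact hA1.trans (by simp)
        · exact hB1.trans (by simp)
        · exact hC1.trans (by simp)
        · exact hD1.trans (by simp)
      · simp only [gadgetStep_zero, gadgetStep_one]
        fin_cases c
        · exact hA2.trans (by simp)
        · exact hB2.trans (by simp)
        · exact hC2.trans (by simp)
        · exact hD2.trans (by simp)
      · exact h3 c
    · fin_cases z
      · refine le_of_eq_of_le (I.gadgetStep_zero j _ _ c) ?_
        fin_cases c
        · exact le_of_eq_of_le (by simp [gadgetCtrl]) optAq
        · exact le_of_eq_of_le (by simp [gadgetCtrl]) optBq
        · exact le_of_eq_of_le (by simp [gadgetCtrl]) optCq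
        · exact le_of_eq_of_le (by simp [gadgetCtrl]) optDq
      · refine le_of_eq_of_le (I.gadgetStep_one j _ _ c) ?_
        fin_cases c
        · exact le_of_eq_of_le (by simp [gadgetCtrl]) optAc
        · exact le_of_eq_of_le (by simp [gadgetCtrl]) optBc
        · exact le_of_eq_of_le (by simp [gadgetCtrl]) optCc
        · exact le_of_eq_of_le (by simp [gadgetCtrl]) optDc

/-- In every stationary equilibrium, the first action in state `0` tells whether the instance is a
yes-instance. -/
theorem quit_zero_of_isNash {x : I.game.Stationary} (hx : I.game.IsNash x.toProfile) :
    (I.IsYes → quit x 0 = 1) ∧ (¬ I.IsYes → quit x 0 = 0) := by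
  obtain ⟨w, hw, hopt⟩ := (isNash_iff x).1 hx
  -- At the absorbing state the value equation is `w = w / 2`.
  have hw1 : ∀ i, w i 1 = 0 := by
    intro i
    have := hw i ⟨1, by omega⟩
    simp only [stepValue_one] at this
    linarith
  have hu : ∀ j < I.num, w 2 (4 * j + 3) = 4 / 237 * √(I.rad j : ℝ) / 2 ^ I.size := by
    intro j hj
    have hlt : ∀ c : Fin 4, 4 * j + c + 2 < 4 * I.num + 2 := fun c => by omega
    have h := (I.gadgetEq_iff (j := j) (y := fun c => quit x ⟨4 * j + c + 2, hlt c⟩)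
      (u := fun i c => w i (4 * j + c + 2)) (fun c => quit_nonneg _ _)
      fun c => quit_le_one _ _).1 ⟨fun i c => by
        have := hw i ⟨4 * j + c + 2, hlt c⟩
        rwa [I.stepValue_gadget (hw1 i) _ _ _ hj, I.stepValue_gadget (hw1 i) _ _ _ hj] at this,
      fun c z => by
        have := hopt ⟨4 * j + c + 2, hlt c⟩ z
        have hc : stateCtrl (4 * j + c + 2) = gadgetCtrl c := by
          rw [stateCtrl, show (4 * j + c : ℕ) % 4 = c by omega]
        rwa [hc, I.stepValue_gadget (hw1 _) _ _ _ hj] at this⟩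
    rw [← sqrt_bonus]
    exact h.1.value (I.bonus_pos j) (I.bonus_le j) rfl
  have e := hw 2 0
  have o0 := hopt 0 0
  have o1 := hopt 0 1
  have hz : I.stepValue (w 2) 2 0 1 =
      2 * (∑ j ∈ Finset.range I.num, √(I.rad j : ℝ)) / (2 ^ I.size * (237 * (I.num + 1))) := by
    rw [stepValue_zero_one, hw1, Finset.sum_congr rfl fun j hj => hu j (Finset.mem_range.1 hj),
      ← Finset.sum_div, ← Finset.mul_sum]
    field_simp
    ring
  simp only [Fin.val_zero, Fin.val_one, stateCtrl, hz, stepValue_zero_zero, if_true, hw1, mul_zero,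
    add_zero] at e o0 o1
  have hpos : (0 : ℝ) < 2 ^ I.size * (237 * (I.num + 1)) := by positivity
  have hq0 := quit_nonneg x 0
  have hq1 := quit_le_one x 0
  generalize w 2 0 = W at *
  generalize quit x 0 = q at *
  rcases I.compare with ⟨hy, hlt⟩ | ⟨hy, hlt⟩
  · refine ⟨fun _ => ?_, fun h => absurd hy h⟩
    by_contra hne
    have := eq_right_of_optimal hq0 (lt_of_le_of_ne hq1 hne) e o0 o1
    exact absurd ((div_lt_div_iff_of_pos_right hpos).2 hlt) (by linarith)
  · refine ⟨fun h => absurd h hy, fun _ => ?_⟩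
    by_contra hne
    have := eq_left_of_optimal (lt_of_le_of_ne hq0 (Ne.symm hne)) hq1 e o0 o1
    exact absurd ((div_lt_div_iff_of_pos_right hpos).2 hlt) (by linarith)

/-- No gadget leads to another gadget or back to state `0`, so equilibria of the gadgets can be
chosen independently, and the comparison is then a best response to their values. -/
theorem exists_isNash : ∃ x : I.game.Stationary, I.game.IsNash x.toProfile := by
  classical
  choose p q r s A B C D h using fun j => exists_gadgetEq (I.bonus_pos j) (I.bonus_le j) rfl
  set Y : ℕ → Fin 4 → ℝ := fun j => ![p j, q j, r j, s j] with hY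
  -- Player 3 receives no rewards and is given the value zero throughout.
  set U : ℕ → Fin 4 → Fin 4 → ℝ := fun j i c =>
    Fin.snoc (α := fun _ => ℝ) ((![A j, B j, C j, D j] : Fin 4 → Fin 3 → ℝ) c) 0 i with hU
  have hY0 : ∀ j c, 0 ≤ Y j c := fun j c => by
    fin_cases c
    exacts [(h j).p0, (h j).q0, (h j).r0, (h j).w0]
  have hY1 : ∀ j c, Y j c ≤ 1 := fun j c => by
    fin_cases c
    exacts [(h j).p1, (h j).q1, (h j).r1, (h j).w1]
  have hU3 : ∀ j c, U j 3 c = 0 := fun j c => Fin.snoc_last (α := fun _ => ℝ) _ _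
  have key := fun j => (I.gadgetEq_iff (hY0 j) (hY1 j) (u := U j)).2 ⟨by
      have hA : ∀ c, (fun i : Fin 3 => U j i.castSucc c) =
          (![A j, B j, C j, D j] : Fin 4 → Fin 3 → ℝ) c := fun c => by
        funext i
        exact Fin.snoc_castSucc (α := fun _ => ℝ) _ _ _
      rw [hA, hA, hA, hA]
      exact h j, fun c => by
      rw [gadgetStep_zero, gadgetStep_one, hU3]
      fin_cases c <;> simp [hU3]⟩
  set y : ℕ → ℝ := fun k => match k with
    | 0 => if I.IsYes then 1 else 0
    | 1 => 1
    | k + 2 => Y (k / 4) ⟨k % 4, Nat.mod_lt _ four_pos⟩ with hy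
  have hy0 : ∀ k, 0 ≤ y k := by
    rintro (_ | _ | k)
    · simp only [hy]; split_ifs <;> norm_num
    · exact zero_le_one
    · exact hY0 _ _
  have hy1 : ∀ k, y k ≤ 1 := by
    rintro (_ | _ | k)
    · simp only [hy]; split_ifs <;> norm_num
    · exact le_rfl
    · exact hY1 _ _
  have hpmf : ∀ t : ℝ, 0 ≤ t → t ≤ 1 → ∃ P : PMF (Fin 2), (P 0).toReal = t := by
    intro t ht0 ht1
    refine ⟨PMF.ofFintype ![ENNReal.ofReal t, ENNReal.ofReal (1 - t)] ?_, ?_⟩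
    · rw [Fin.sum_univ_two]
      simp only [Matrix.cons_val_zero, Matrix.cons_val_one]
      rw [← ENNReal.ofReal_add ht0 (sub_nonneg.2 ht1)]
      simp
    · simp [ht0]
  choose X hX using fun k => hpmf (y k) (hy0 k) (hy1 k)
  set v : Fin 4 → ℕ → ℝ := fun i k => match k with
    | 0 => 0
    | 1 => 0
    | k + 2 => U (k / 4) i ⟨k % 4, Nat.mod_lt _ four_pos⟩ with hv
  set w : Fin 4 → ℕ → ℝ := fun i k => if k = 0 then
    y 0 * I.stepValue (v i) i 0 0 + (1 - y 0) * I.stepValue (v i) i 0 1 else v i k with hw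
  have hw0 : ∀ i, w i 0 = y 0 * I.stepValue (w i) i 0 0 + (1 - y 0) * I.stepValue (w i) i 0 1 := by
    intro i
    have e0 : I.stepValue (v i) i 0 0 = I.stepValue (w i) i 0 0 := by
      simp [stepValue_zero_zero, hw]
    have e1 : I.stepValue (v i) i 0 1 = I.stepValue (w i) i 0 1 := by
      simp [stepValue_zero_one, hw]
    rw [← e0, ← e1]
    exact if_pos rfl
  have hw1 : ∀ i, w i 1 = 0 := fun i => rfl
  have hwU : ∀ i j (c : Fin 4), w i (4 * j + c + 2) = U j i c := by
    intro i j c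
    have h1 : (4 * j + c : ℕ) / 4 = j := by omega
    have h2 : (4 * j + c : ℕ) % 4 = c := by omega
    simp [hw, hv, h1, h2]
  have hyY : ∀ j (c : Fin 4), y (4 * j + c + 2) = Y j c := by
    intro j c
    have h1 : (4 * j + c : ℕ) / 4 = j := by omega
    have h2 : (4 * j + c : ℕ) % 4 = c := by omega
    simp [hy, h1, h2]
  have hctrl : ∀ j (c : Fin 4), stateCtrl (4 * j + c + 2) = gadgetCtrl c := by
    intro j c
    rw [stateCtrl, show (4 * j + c : ℕ) % 4 = c by omega]
  have hB : ∀ j, U j 2 1 = 4 / 237 * √(I.rad j : ℝ) / 2 ^ I.size := fun j =>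
    ((h j).value (I.bonus_pos j) (I.bonus_le j) rfl).trans (I.sqrt_bonus j)
  refine ⟨fun k => X k, (isNash_iff _).2 ⟨w, ?_, ?_⟩⟩
  · have hq : ∀ k, quit (I := I) (fun k => X k) k = y k := fun k => hX k
    intro i k
    rw [hq]
    refine I.stateCases (P := fun k => w i k = y k * I.stepValue (w i) i k 0 +
      (1 - y k) * I.stepValue (w i) i k 1) (hw0 i) ?_ (fun j hj c => ?_) k k.2
    · simp [stepValue_one, hw1]
    · rw [I.stepValue_gadget (hw1 i) _ _ _ hj, I.stepValue_gadget (hw1 i) _ _ _ hj, hyY]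
      simp only [hwU]
      exact (key j).1 i c
  · intro k z
    refine I.stateCases (P := fun k => I.stepValue (w (stateCtrl k)) (stateCtrl k) k z ≤
      w (stateCtrl k) k) ?_ ?_ (fun j hj c => ?_) k k.2
    · have hz : I.stepValue (w 2) 2 0 1 = 2 * (∑ j ∈ Finset.range I.num, √(I.rad j : ℝ)) /
          (2 ^ I.size * (237 * (I.num + 1))) := by
        have : ∀ j, w 2 (4 * j + 3) = 4 / 237 * √(I.rad j : ℝ) / 2 ^ I.size := fun j =>
          (hwU 2 j 1).trans (hB j)
        simp only [stepValue_zero_one, hw1, this]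
        rw [← Finset.sum_div, ← Finset.mul_sum]
        field_simp
        ring
      have hpos : (0 : ℝ) < 2 ^ I.size * (237 * (I.num + 1)) := by positivity
      have e := hw0 2
      change I.stepValue (w 2) 2 0 z ≤ w 2 0
      rw [e, hz]
      have h0 : I.stepValue (w 2) 2 0 0 = (2 * I.t + I.allSquares.toNat) /
          (2 ^ I.size * (237 * (I.num + 1))) := by simp [stepValue_zero_zero, hw1]
      have hz' : I.stepValue (w 2) 2 0 z = if z = 0 then (2 * I.t + I.allSquares.toNat : ℝ) /
          (2 ^ I.size * (237 * (I.num + 1))) else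
          2 * (∑ j ∈ Finset.range I.num, √(I.rad j : ℝ)) /
          (2 ^ I.size * (237 * (I.num + 1))) := by
        fin_cases z
        · exact h0
        · exact hz
      rw [hz', h0]
      rcases I.compare with ⟨hyes, hlt⟩ | ⟨hyes, hlt⟩
      · have := ((div_lt_div_iff_of_pos_right hpos).2 hlt).le
        simp only [hy, if_pos hyes]
        split_ifs <;> linarith
      · have := ((div_lt_div_iff_of_pos_right hpos).2 hlt).le
        simp only [hy, if_neg hyes]
        split_ifs <;> linarith
    · simp [stepValue_one, hw1]
    · rw [hctrl, I.stepValue_gadget (hw1 _) _ _ _ hj]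
      simp only [hwU]
      exact (key j).2 c z

end SqrtSumInstance

end

end StochasticGames

namespace StochasticGames

noncomputable section

open Computability (Γ' encodeNat)

/-! ### The code of the game -/

theorem encodeNats_append (l l' : List ℕ) : encodeNats (l ++ l') = encodeNats l ++ encodeNats l' :=
  List.flatMap_append

theorem encodeNats_flatMap {ι : Type} (L : List ι) (f : ι → List ℕ) :
    encodeNats (L.flatMap f) = L.flatMap fun i => encodeNats (f i) :=
  List.flatMap_assoc

theorem encodeNats_cons (m : ℕ) (l : List ℕ) :
    encodeNats (m :: l) = bits (encodeNat m) ++ Γ'.comma :: encodeNats l := by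
  simp [encodeNats, bits]

@[simp] theorem encodeNats_nil : encodeNats [] = [] := rfl

theorem encodeNats_eq_encodeWords (l : List ℕ) : encodeNats l = encodeWords (l.map encodeNat) := by
  rw [encodeNats, encodeWords, List.flatMap_map]
  rfl

/-- A string written `n` times. -/
def copies (n : ℕ) (u : List Γ') : List Γ' := (List.replicate n u).flatten

theorem copies_succ (n : ℕ) (u : List Γ') : copies (n + 1) u = u ++ copies n u := by
  simp [copies, List.replicate_succ]

theorem copies_add (m n : ℕ) (u : List Γ') : copies (m + n) u = copies m u ++ copies n u := by
  simp only [copies, List.replicate_add, List.flatten_append]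

theorem length_copies (n : ℕ) (u : List Γ') : (copies n u).length = n * u.length := by
  simp [copies]

theorem flatMap_range_const {n : ℕ} {F : ℕ → List Γ'} {u : List Γ'} (h : ∀ j < n, F j = u) :
    (List.range n).flatMap F = copies n u := by
  rw [copies, List.flatMap_def]
  congr 1
  exact List.eq_replicate_iff.2 ⟨by simp, by simpa using h⟩

theorem flatMap_finRange (n : ℕ) (F : ℕ → List Γ') :
    (List.finRange n).flatMap (fun l : Fin n => F l) = (List.range n).flatMap F := by
  rw [← List.map_coe_finRange_eq_range, List.flatMap_map]

theorem flatMap_finRange_states (n : ℕ) (F : ℕ → List Γ') :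
    (List.finRange (4 * n + 2)).flatMap (fun l : Fin (4 * n + 2) => F l) =
      F 0 ++ (F 1 ++ (List.range n).flatMap fun j =>
        (List.finRange 4).flatMap fun c : Fin 4 => F (4 * j + c + 2)) := by
  rw [flatMap_finRange]
  induction n with
  | zero => simp [List.range_succ]
  | succ n ih =>
    rw [show 4 * (n + 1) + 2 = 4 * n + 2 + 1 + 1 + 1 + 1 by ring, List.range_succ, List.range_succ,
      List.range_succ, List.range_succ, List.range_succ (n := n)]
    simp only [List.flatMap_append, ih]
    simp [List.finRange_succ]

/-- Four zero probabilities. -/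
def zeroBlock : List Γ' := encodeNats [0, 1, 0, 1, 0, 1, 0, 1]

theorem flatMap_finRange_four (F : Fin 4 → List Γ') :
    (List.finRange 4).flatMap F = F 0 ++ (F 1 ++ (F 2 ++ F 3)) := by
  simp [List.finRange_succ]

theorem flatMap_finRange_four_zero {F : Fin 4 → List Γ'} (h : ∀ c, F c = encodeNats [0, 1]) :
    (List.finRange 4).flatMap F = zeroBlock := by
  rw [flatMap_finRange_four, h, h, h, h]
  rfl

/-- The code of the reward in a gadget whose radicand has the binary digits `u`. -/
def rewardStr (s : ℕ) (u : List Bool) (c : Fin 4) (z : Fin 2) (i : Fin 4) : List Γ' :=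
  if c = 0 ∧ z = 0 ∧ i = 2 then
    bits u ++ Γ'.comma :: (bits (List.replicate (2 * s) false) ++ encodeNats [49375])
  else if c = 1 ∧ z = 0 ∧ i = 2 then
    bits u ++ Γ'.comma :: (bits (List.replicate (2 * s) false) ++ encodeNats [156025])
  else encodeNats (gadgetReward 0 0 c z i).code

/-- With the least significant digit first, a factor `2 ^ k` is a prefix of zeros. Hence the scaled
denominators need no multiplication. -/
theorem encodeNats_two_pow_mul {m : ℕ} (hm : 0 < m) (k : ℕ) :
    encodeNats [2 ^ k * m] = bits (List.replicate k false) ++ encodeNats [m] := by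
  simp [encodeNats_cons, encodeNat_two_pow_mul hm, bits]

theorem rewardStr_eq (s a : ℕ) (c : Fin 4) (z : Fin 2) (i : Fin 4) :
    rewardStr s (encodeNat a) c z i = encodeNats (gadgetReward s a c z i).code := by
  have h : ∀ m : ℕ+, encodeNats (Frac.code (a, 2 ^ (2 * s) * m)) =
      bits (encodeNat a) ++ Γ'.comma ::
        (bits (List.replicate (2 * s) false) ++ encodeNats [(m : ℕ)]) := by
    intro m
    rw [Frac.code, encodeNats_cons, ← encodeNats_two_pow_mul m.pos]
    rfl
  fin_cases c <;> fin_cases z <;> fin_cases i <;> simp [rewardStr, gadgetReward, h]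

/-- The code of the four states of a gadget between other gadgets. -/
def gadgetStr (s : ℕ) (u : List Bool) (pre post : List Γ') : List Γ' :=
  (List.finRange 4).flatMap fun c : Fin 4 => encodeNats [(gadgetCtrl c : ℕ), 2] ++
    (List.finRange 2).flatMap fun z : Fin 2 => (List.finRange 4).flatMap (rewardStr s u c z) ++
      (encodeNats [0, 1] ++ (encodeNats (gadgetExit c z).code ++ (pre ++
        ((List.finRange 4).flatMap (fun c' : Fin 4 => encodeNats (gadgetTrans c z c').code) ++ post))))

namespace SqrtSumInstance

variable (I : SqrtSumInstance)

/-- The code of a state. -/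
def stateStr (k : ℕ) : List Γ' :=
  encodeNats [(stateCtrl k : ℕ), 2] ++ (List.finRange 2).flatMap fun z : Fin 2 =>
    (List.finRange 4).flatMap (fun i : Fin 4 => encodeNats (I.stateReward k z i).code) ++
      (List.finRange (4 * I.num + 2)).flatMap fun l : Fin (4 * I.num + 2) => encodeNats (I.stateTrans k z l).code

theorem encodeNats_code : encodeNats (0 :: 0 :: I.game.code) =
    encodeNats [0, 0, 4 * I.num + 2, 1, 2] ++ (I.stateStr 0 ++ (I.stateStr 1 ++
      (List.range I.num).flatMap fun j =>
        (List.finRange 4).flatMap fun c : Fin 4 => I.stateStr (4 * j + c + 2))) := by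
  rw [← flatMap_finRange_states I.num I.stateStr]
  have h : ∀ k : Fin (4 * I.num + 2), encodeNats (I.game.stateCode k) = I.stateStr k := by
    intro k
    have e : I.game.stateCode k = [(stateCtrl k : ℕ), 2] ++
      (List.finRange (I.game.numActions k)).flatMap (I.game.actionCode k) := rfl
    rw [e, encodeNats_append, encodeNats_flatMap]
    refine congrArg₂ _ rfl (List.flatMap_congr fun z _ => ?_)
    have e' : I.game.actionCode k z = ((List.finRange 4).flatMap fun i =>
      (I.game.reward k z i).code) ++ (List.finRange I.game.numStates).flatMap fun l =>
      (I.game.trans k z l).code := rfl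
    rw [e', encodeNats_append, encodeNats_flatMap, encodeNats_flatMap]
    rfl
  have h' : 0 :: 0 :: I.game.code = [0, 0, 4 * I.num + 2, 1, 2] ++
    (List.finRange I.game.numStates).flatMap I.game.stateCode := rfl
  rw [h', encodeNats_append, encodeNats_flatMap]
  exact congrArg _ (List.flatMap_congr fun k _ => h k)

/-- Transitions to other gadgets have probability zero, so each action's row consists of zero blocks
except for the block of gadget `j`. -/
theorem stateStr_gadget {j : ℕ} (hj : j < I.num) :
    ((List.finRange 4).flatMap fun c : Fin 4 => I.stateStr (4 * j + c + 2)) =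
      gadgetStr I.size (encodeNat (I.rad j)) (copies j zeroBlock)
        (copies (I.num - 1 - j) zeroBlock) := by
  have h1 : ∀ (j : ℕ) (c : Fin 4), (4 * j + c : ℕ) / 4 = j := fun j c => by omega
  have h2 : ∀ (j : ℕ) (c : Fin 4), (4 * j + c : ℕ) % 4 = c := fun j c => by omega
  refine List.flatMap_congr fun c _ => ?_
  rw [stateStr]
  refine congrArg₂ _ ?_ (List.flatMap_congr fun z _ => congrArg₂ _ ?_ ?_)
  · rw [stateCtrl, h2]
  · refine List.flatMap_congr fun i _ => ?_
    rw [rewardStr_eq, stateReward, h1, h2]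
  · rw [flatMap_finRange_states I.num fun l => encodeNats (I.stateTrans (4 * j + c + 2) z l).code]
    simp only [stateTrans, h1, h2]
    refine congrArg₂ _ rfl (congrArg₂ _ rfl ?_)
    obtain ⟨m, hm⟩ : ∃ m, I.num = j + (1 + m) := ⟨I.num - 1 - j, by omega⟩
    rw [hm, List.range_add, List.range_add, List.flatMap_append, List.map_append,
      List.flatMap_append]
    refine congrArg₂ _ ?_ (congrArg₂ _ ?_ ?_)
    · refine flatMap_range_const fun j' hj' => ?_
      simp only [if_neg hj'.ne]
      rfl
    · simp
    · rw [show j + (1 + m) - 1 - j = m by omega, List.map_map, List.flatMap_map]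
      refine flatMap_range_const fun j' _ => ?_
      simp only [Function.comp_apply, if_neg (show j + (1 + j') ≠ j by omega)]
      rfl

theorem stateStr_one : I.stateStr 1 = encodeNats [3, 2] ++ copies 2
    (zeroBlock ++ (encodeNats [0, 1, 1, 1] ++ copies I.num zeroBlock)) := by
  have h : ∀ z : Fin 2, (List.finRange 4).flatMap
      (fun i : Fin 4 => encodeNats (I.stateReward 1 z i).code) ++
      (List.finRange (4 * I.num + 2)).flatMap (fun l : Fin (4 * I.num + 2) => encodeNats (I.stateTrans 1 z l).code) =
      zeroBlock ++ (encodeNats [0, 1, 1, 1] ++ copies I.num zeroBlock) := by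
    intro z
    refine congrArg₂ _ (flatMap_finRange_four_zero fun i => by simp [stateReward, Frac.code]) ?_
    rw [flatMap_finRange_states I.num fun l => encodeNats (I.stateTrans 1 z l).code,
      show encodeNats [0, 1, 1, 1] = encodeNats [0, 1] ++ encodeNats [1, 1] from rfl,
      List.append_assoc]
    exact congrArg₂ _ rfl (congrArg₂ _ rfl (flatMap_range_const fun _ _ =>
      flatMap_finRange_four_zero fun _ => rfl))
  rw [stateStr]
  simp only [h]
  rfl

theorem stateStr_zero : I.stateStr 0 = encodeNats [2, 2, 0, 1, 0, 1] ++
    (Γ'.bit I.allSquares :: (bits (encodeNat I.t) ++ Γ'.comma ::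
      (bits (List.replicate I.size false) ++ (bits (encodeNat (237 * (I.num + 1))) ++ Γ'.comma ::
      (encodeNats [0, 1, 0, 1, 1, 1] ++ (copies I.num zeroBlock ++ (zeroBlock ++
      (encodeNats [0, 1] ++ (encodeNats [1, I.num + 1] ++ copies I.num (encodeNats [0, 1] ++
        (encodeNats [1, I.num + 1] ++ encodeNats [0, 1, 0, 1]))))))))))) := by
  -- The added bit is the lowest digit. Positivity of `t` matters here, as the code of 0 is empty.
  have hn : encodeNat (2 * I.t + I.allSquares.toNat) = I.allSquares :: encodeNat I.t := by
    cases I.allSquares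
    · exact encodeNat_two_mul I.t.pos
    · exact encodeNat_two_mul_add_one _
  have e0 : (List.finRange (4 * I.num + 2)).flatMap
      (fun l : Fin (4 * I.num + 2) => encodeNats (I.stateTrans 0 0 l).code) =
      encodeNats [0, 1] ++ (encodeNats [1, 1] ++ copies I.num zeroBlock) := by
    rw [flatMap_finRange_states I.num fun l => encodeNats (I.stateTrans 0 0 l).code]
    exact congrArg₂ _ rfl (congrArg₂ _ rfl (flatMap_range_const fun _ _ =>
      flatMap_finRange_four_zero fun _ => rfl))
  have e1 : (List.finRange (4 * I.num + 2)).flatMap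
      (fun l : Fin (4 * I.num + 2) => encodeNats (I.stateTrans 0 1 l).code) =
      encodeNats [0, 1] ++ (encodeNats [1, I.num + 1] ++ copies I.num (encodeNats [0, 1] ++
        (encodeNats [1, I.num + 1] ++ encodeNats [0, 1, 0, 1]))) := by
    rw [flatMap_finRange_states I.num fun l => encodeNats (I.stateTrans 0 1 l).code]
    refine congrArg₂ _ rfl (congrArg₂ _ rfl (flatMap_range_const fun j _ => ?_))
    have h : ∀ (c : Fin 4), (4 * j + c : ℕ) % 4 = c := fun c => by omega
    simp only [stateTrans, h, flatMap_finRange_four]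
    simp [Frac.code, encodeNats_cons]
  have r0 : (List.finRange 4).flatMap (fun i : Fin 4 => encodeNats (I.stateReward 0 0 i).code) =
      encodeNats [0, 1, 0, 1] ++ (Γ'.bit I.allSquares :: (bits (encodeNat I.t) ++ Γ'.comma ::
      (bits (List.replicate I.size false) ++ (bits (encodeNat (237 * (I.num + 1))) ++ Γ'.comma ::
      encodeNats [0, 1])))) := by
    have h : encodeNats (Frac.code (2 * I.t + I.allSquares.toNat,
        2 ^ I.size * (237 * I.num.succPNat))) = Γ'.bit I.allSquares :: (bits (encodeNat I.t) ++
        Γ'.comma :: (bits (List.replicate I.size false) ++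
        (bits (encodeNat (237 * (I.num + 1))) ++ [Γ'.comma]))) := by
      rw [Frac.code, encodeNats_cons, hn]
      have : (((2 ^ I.size * (237 * I.num.succPNat) : ℕ+)) : ℕ) =
        2 ^ I.size * (237 * (I.num + 1)) := rfl
      rw [this, encodeNats_two_pow_mul (by positivity), encodeNats_cons]
      rfl
    have h4 : List.finRange 4 = [0, 1, 2, 3] := rfl
    rw [h4]
    change encodeNats [0, 1] ++ (encodeNats [0, 1] ++ (encodeNats (Frac.code (_, _)) ++
      (encodeNats [0, 1] ++ []))) = _
    rw [h]
    simp [encodeNats_cons, bits]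
  have r1 : (List.finRange 4).flatMap (fun i : Fin 4 => encodeNats (I.stateReward 0 1 i).code) =
    zeroBlock := flatMap_finRange_four_zero fun i => by simp [stateReward, Frac.code]
  rw [stateStr]
  have h2 : List.finRange 2 = [0, 1] := rfl
  rw [h2]
  simp only [List.flatMap_cons, List.flatMap_nil, Fin.val_zero, Fin.val_one, e0, e1, r0, r1]
  simp [encodeNats_cons, bits, stateCtrl, zeroBlock]

/-- The code of the game, as a string. -/
theorem encodeNats_game : encodeNats (0 :: 0 :: I.game.code) =
    encodeNats [0, 0, 4 * I.num + 2, 1, 2] ++ (I.stateStr 0 ++ (I.stateStr 1 ++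
      (List.range I.num).flatMap fun j => gadgetStr I.size (encodeNat (I.rad j))
        (copies j zeroBlock) (copies (I.num - 1 - j) zeroBlock))) := by
  rw [encodeNats_code]
  refine congrArg _ (congrArg _ (congrArg _ (List.flatMap_congr fun j hj => ?_)))
  exact I.stateStr_gadget (List.mem_range.1 hj)

end SqrtSumInstance

end

end StochasticGames

namespace StochasticGames

noncomputable section

open Computability (Γ' encodeNat)

/-! ### The code of the game in polynomial time -/

theorem encodeWords_cons (u : List Bool) (l : List (List Bool)) :
    encodeWords (u :: l) = bits u ++ Γ'.comma :: encodeWords l := by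
  simp [encodeWords]

theorem length_le_length_encodeWords (l : List (List Bool)) :
    l.length ≤ (encodeWords l).length := by
  induction l with
  | nil => simp
  | cons u l ih => rw [encodeWords_cons]; simp; omega

theorem length_getD_le_length_encodeWords (l : List (List Bool)) (i : ℕ) :
    (l.getD i []).length ≤ (encodeWords l).length := by
  induction l generalizing i with
  | nil => simp
  | cons u l ih =>
    rw [encodeWords_cons]
    cases i with
    | zero => simp [bits]
    | succ i =>
      have := ih i
      simp only [List.getD_cons_succ, List.length_append, List.length_cons] at this ⊢
      omega

theorem length_encodeWords_le_of_prefix {l l' : List (List Bool)} (h : l' <+: l) :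
    (encodeWords l').length ≤ (encodeWords l).length := by
  obtain ⟨t, rfl⟩ := h
  simp [encodeWords]

/-- Commas count the words in unary, so writing a fixed string once per word is a letter-by-letter
substitution. -/
theorem flatMap_encodeWords (l : List (List Bool)) (u : List Γ') :
    (encodeWords l).flatMap (fun s => if s = Γ'.comma then u else []) = copies l.length u := by
  induction l with
  | nil => rfl
  | cons w l ih =>
    have h : (bits w).flatMap (fun s => if s = Γ'.comma then u else []) = [] := by
      simp only [bits, List.flatMap_map, List.flatMap_eq_nil_iff]
      intro b _
      simp
    rw [encodeWords_cons, List.flatMap_append, h, List.flatMap_cons, ih, List.length_cons,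
      copies_succ]
    simp

theorem drop_copies (n : ℕ) (u : List Γ') : (copies n u).drop u.length = copies (n - 1) u := by
  cases n with
  | zero => simp [copies]
  | succ n => rw [copies_succ]; simp

theorem length_flatMap_range_le {n M : ℕ} {F : ℕ → List Γ'} (h : ∀ i < n, (F i).length ≤ M) :
    ((List.range n).flatMap F).length ≤ n * M := by
  induction n with
  | zero => simp
  | succ n ih =>
    rw [List.range_succ, List.flatMap_append, List.length_append, add_mul, one_mul]
    have h1 := ih fun i hi => h i (by omega)
    have h2 := h n (by omega)
    simpa using add_le_add h1 h2

namespace PolyTime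

variable {α : Type} {v : List (α → List Γ')}

theorem flatMap_list {ι : Type} (L : List ι) {f : ι → α → List Γ'} (h : ∀ c, PolyTime v (f c)) :
    PolyTime v fun x => L.flatMap fun c => f c x := by
  induction L with
  | nil => exact const []
  | cons c L ih => simpa using (h c).append ih

theorem cons_bit {c : α → Bool} {f : α → List Γ'} (hc : PolyTimeBool v c) (hf : PolyTime v f) :
    PolyTime v fun x => Γ'.bit (c x) :: f x := hc.append hf

theorem copies_const {l : α → List (List Bool)} (hl : PolyTime v fun x => encodeWords (l x))
    (u : List Γ') : PolyTime v fun x => copies (l x).length u := by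
  simpa only [flatMap_encodeWords] using hl.flatMap fun s => if s = Γ'.comma then u else []

theorem copies {l : α → List (List Bool)} (hl : PolyTime v fun x => encodeWords (l x))
    {f : α → List Γ'} (hf : PolyTime v f) : PolyTime v fun x => copies (l x).length (f x) := by
  have e : ∀ (x : α) (l : List (List Bool)) (o : List Γ'),
      l.foldl (fun o _ => o ++ f x) o = o ++ StochasticGames.copies l.length (f x) := by
    intro x l
    induction l with
    | nil => simp [StochasticGames.copies]
    | cons u l ih => intro o; rw [List.foldl_cons, ih, List.length_cons, copies_succ]; simp
  have := foldlWords (w := [fun o : List Γ' => o]) hl (step := fun x o _ => o ++ f x)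
    (init := fun _ => []) (by simpa using const [])
    (fun V hV hw _ => by
      simp only [List.mem_cons, List.not_mem_nil, or_false, forall_eq] at hw ⊢
      exact hw.append (hf.subst (h := fun y : α × List Γ' × List Bool => y.1) hV))
    (b := fun x => (encodeWords (l x)).length * (f x).length) (hl.length.mul hf.length)
    (fun x l' hl' => by
      rw [e]
      simp only [totalLength, List.map_cons, List.map_nil, List.sum_cons, List.sum_nil,
        List.nil_append, add_zero, length_copies]
      exact Nat.mul_le_mul_right _ (hl'.length_le.trans (length_le_length_encodeWords _)))
    List.mem_cons_self
  simpa [e] using this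

theorem encodeNats_singleton {m : α → ℕ} (h : PolyTime v fun x => bits (encodeNat (m x))) :
    PolyTime v fun x => encodeNats [m x] := by
  simpa [encodeNats_cons] using h.append (const [Γ'.comma])

theorem gadgetStr {s : α → ℕ} {u : α → List Bool} {f g : α → List Γ'}
    (hs : PolyTime v fun x => bits (List.replicate (s x) false))
    (hu : PolyTime v fun x => bits (u x)) (hf : PolyTime v f) (hg : PolyTime v g) :
    PolyTime v fun x => gadgetStr (s x) (u x) (f x) (g x) := by
  have hr : ∀ c z i, PolyTime v fun x => rewardStr (s x) (u x) c z i := by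
    intro c z i
    have hm : ∀ m : ℕ, PolyTime v fun x => bits (u x) ++ Γ'.comma ::
        (bits (List.replicate (2 * s x) false) ++ encodeNats [m]) := by
      intro m
      refine hu.append ((PolyTime.append ?_ (const _)).cons _)
      simpa only [two_mul, List.replicate_add] using bits_append hs hs
    unfold rewardStr
    split_ifs
    · exact hm _
    · exact hm _
    · exact const _
  refine flatMap_list _ fun c => (const _).append (flatMap_list _ fun z => ?_)
  exact (flatMap_list _ fun i => hr c z i).append ((const _).append ((const _).append
    (hf.append ((const _).append hg))))

/-- A single fold over the radicands. Its two counters, the gadgets before and the gadgets left, are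
stored in unary as strings of zero blocks, which are just the strings needed in the code. -/
theorem flatMap_gadgetStr {s : α → ℕ} {l : α → List (List Bool)}
    (hs : PolyTime v fun x => bits (List.replicate (s x) false))
    (hl : PolyTime v fun x => encodeWords (l x)) :
    PolyTime v fun x => (List.range (l x).length).flatMap fun j =>
      StochasticGames.gadgetStr (s x) ((l x).getD j []) (StochasticGames.copies j zeroBlock)
        (StochasticGames.copies ((l x).length - 1 - j) zeroBlock) := by
  set step : α → ℕ × ℕ × List Γ' → List Bool → ℕ × ℕ × List Γ' := fun x y u =>
    (y.1 + 1, y.2.1 - 1, y.2.2 ++ StochasticGames.gadgetStr (s x) u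
      (StochasticGames.copies y.1 zeroBlock) (StochasticGames.copies (y.2.1 - 1) zeroBlock))
    with hstep
  have e : ∀ (x : α) (l : List (List Bool)) (j r : ℕ) (o : List Γ'),
      l.foldl (step x) (j, r, o) = (j + l.length, r - l.length, o ++
        (List.range l.length).flatMap fun i => StochasticGames.gadgetStr (s x) (l.getD i [])
          (StochasticGames.copies (j + i) zeroBlock)
          (StochasticGames.copies (r - 1 - i) zeroBlock)) := by
    intro x l
    induction l with
    | nil => simp
    | cons u l ih =>
      intro j r o
      rw [List.foldl_cons, hstep]
      simp only
      rw [ih, List.length_cons, List.range_succ_eq_map, List.flatMap_cons, List.flatMap_map,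
        List.append_assoc]
      refine Prod.ext (by simp only; omega) (Prod.ext (by simp only; omega) ?_)
      simp only [List.getD_cons_zero, List.getD_cons_succ, add_zero, Nat.sub_zero,
        Nat.succ_eq_add_one, add_assoc, add_comm 1, Nat.sub_sub]
  -- A uniform length bound, read off from the polynomial-time computability of `gadgetStr` with its
  -- four arguments as independent variables.
  obtain ⟨P, hP⟩ : ∃ P : Polynomial ℕ, ∀ (k : ℕ) (u : List Bool) (f g : List Γ'),
      (StochasticGames.gadgetStr k u f g).length ≤
        P.eval (k + (u.length + (f.length + g.length))) := by
    obtain ⟨P, hP⟩ := (gadgetStr (α := ℕ × List Bool × List Γ' × List Γ')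
      (v := [fun y => bits (List.replicate y.1 false), fun y => bits y.2.1, fun y => y.2.2.1,
        fun y => y.2.2.2]) (s := fun y => y.1) (u := fun y => y.2.1) (f := fun y => y.2.2.1)
      (g := fun y => y.2.2.2) (var (by simp)) (var (by simp)) (var (by simp))
      (var (by simp))).length
    exact ⟨P, fun k u f g => by simpa [totalLength, bits] using hP (k, u, f, g)⟩
  set E : α → ℕ := fun x => (encodeWords (l x)).length with hE
  set K : α → ℕ := fun x => s x + (E x + (E x * zeroBlock.length + E x * zeroBlock.length)) with hK
  have hsl : PolyBdd (totalLength v) s := by simpa [bits] using hs.length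
  have hKb : PolyBdd (totalLength v) K := hsl.add (hl.length.add
    ((hl.length.mul (PolyBdd.const _)).add (hl.length.mul (PolyBdd.const _))))
  have := foldlWords (w := [(fun y : ℕ × ℕ × List Γ' => StochasticGames.copies y.1 zeroBlock),
      (fun y => StochasticGames.copies y.2.1 zeroBlock), fun y => y.2.2]) hl (step := step)
    (init := fun x => (0, (l x).length, [])) (by
      simp only [List.forall_mem_cons, List.not_mem_nil, false_imp_iff, implies_true, and_true]
      exact ⟨const _, copies_const hl _, const _⟩)
    (fun V hV hw hu => by
      simp only [List.forall_mem_cons, List.not_mem_nil, false_imp_iff, implies_true,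
        and_true] at hw ⊢
      obtain ⟨h1, h2, h3⟩ := hw
      -- Decrementing a unary counter means dropping one block; with truncated subtraction this is
      -- also right at zero.
      have h2' := h2.drop zeroBlock.length
      simp only [drop_copies] at h2'
      refine ⟨?_, h2', h3.append (gadgetStr
        (hs.subst (h := fun y : α × (ℕ × ℕ × List Γ') × List Bool => y.1) hV) hu h1 h2')⟩
      simp only [hstep, copies_add]
      exact h1.append (const _))
    (b := fun x => E x * zeroBlock.length + (E x * zeroBlock.length + E x * P.eval (K x)))
    ((hl.length.mul (PolyBdd.const _)).add ((hl.length.mul (PolyBdd.const _)).add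
      (hl.length.mul (hKb.trans ⟨P, fun _ => le_rfl⟩))))
    (fun x l' hl' => by
      have h1 : l'.length ≤ (l x).length := hl'.length_le
      have h2 : (l x).length ≤ E x := length_le_length_encodeWords _
      rw [e]
      simp only [totalLength, List.map_cons, List.map_nil, List.sum_cons, List.sum_nil, add_zero,
        length_copies, List.nil_append, zero_add]
      refine add_le_add (Nat.mul_le_mul_right _ (by omega))
        (add_le_add (Nat.mul_le_mul_right _ (by omega)) ?_)
      refine (length_flatMap_range_le (M := P.eval (K x)) fun i hi => ?_).trans
        (Nat.mul_le_mul_right _ (by omega))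
      refine (hP _ _ _ _).trans (polynomial_eval_mono _ ?_)
      simp only [length_copies, hK]
      refine Nat.add_le_add_left (add_le_add ?_ (add_le_add (Nat.mul_le_mul_right _ (by omega))
        (Nat.mul_le_mul_right _ (by omega)))) _
      exact (length_getD_le_length_encodeWords _ _).trans (length_encodeWords_le_of_prefix hl'))
    (g := fun y => y.2.2) (by simp)
  simpa only [e, List.nil_append, zero_add] using this

end PolyTime

namespace SqrtSumInstance

/-- The binary digits of the radicands. -/
def radWords (I : SqrtSumInstance) : List (List Bool) := I.a.map fun z : ℕ+ => encodeNat (z : ℕ)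

theorem encode_eq_encodeWords (I : SqrtSumInstance) :
    I.encode = encodeWords (encodeNat I.t :: I.radWords) := by
  rw [encode_eq, encodeNats_eq_encodeWords, radWords, List.map_cons, List.map_map]
  rfl

/-- The input is split by a fold over its words, with a flag that tells whether the first word, the
bound `t`, has been read. -/
theorem polyTime_parts : PolyTime [encode] (fun I => bits (encodeNat I.t)) ∧
    PolyTime [encode] fun I => encodeWords I.radWords := by
  set step : List Bool × List Γ' × Bool → List Bool → List Bool × List Γ' × Bool := fun y u =>
    bif y.2.2 then (y.1, y.2.1 ++ (bits u ++ [Γ'.comma]), true) else (u, y.2.1, true) with hstep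
  have e1 : ∀ (l : List (List Bool)) (c : List Bool) (o : List Γ'),
      l.foldl step (c, o, true) = (c, o ++ encodeWords l, true) := by
    intro l
    induction l with
    | nil => simp [encodeWords]
    | cons u l ih =>
      intro c o
      rw [List.foldl_cons]
      simp only [hstep, cond_true]
      rw [ih, encodeWords_cons]
      simp
  have hin : PolyTime [encode] fun I => encodeWords (encodeNat I.t :: I.radWords) := by
    simp only [← encode_eq_encodeWords]
    exact PolyTime.var (by simp)
  have key : ∀ g ∈ [(fun y : List Bool × List Γ' × Bool => bits y.1), (fun y => y.2.1),
      fun y => [Γ'.bit y.2.2]], PolyTime [encode] fun I : SqrtSumInstance =>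
      g ((encodeNat I.t :: I.radWords).foldl step ([], [], false)) := fun g hg =>
    PolyTime.foldlWords (w := [(fun y : List Bool × List Γ' × Bool => bits y.1), (fun y => y.2.1),
      fun y => [Γ'.bit y.2.2]]) hin (step := fun _ => step) (init := fun _ => ([], [], false))
      (by simpa using ⟨PolyTime.bits_const [], PolyTime.const _, PolyTime.const _⟩)
      (fun V _ hw hu => by
        simp only [List.forall_mem_cons, List.not_mem_nil, false_imp_iff, implies_true,
          and_true] at hw ⊢
        obtain ⟨h1, h2, h3⟩ := hw
        refine ⟨?_, ?_, ?_⟩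
        · refine (congrArg (PolyTime V) (funext fun y => ?_)).mp (PolyTime.ite h3 h1 hu)
          simp only [hstep]
          cases y.2.1.2.2 <;> rfl
        · refine (congrArg (PolyTime V) (funext fun y => ?_)).mp
            (PolyTime.ite h3 (h2.append (hu.append (PolyTime.const [Γ'.comma]))) h2)
          simp only [hstep]
          cases y.2.1.2.2 <;> rfl
        · refine (congrArg (PolyTime V) (funext fun y => ?_)).mp (PolyTime.const [Γ'.bit true])
          simp only [hstep]
          cases y.2.1.2.2 <;> rfl)
      (b := fun I => (encode I).length + 1)
      ((PolyBdd.self.mono (length_le_totalLength (by simp))).add (PolyBdd.const 1))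
      (fun I l' hl' => by
        have h1 := length_encodeWords_le_of_prefix hl'
        rw [← encode_eq_encodeWords] at h1
        cases l' with
        | nil => simp [totalLength, bits]
        | cons u l' =>
          have h2 : (u :: l').foldl step ([], [], false) = (u, encodeWords l', true) := by
            rw [List.foldl_cons]
            simp only [hstep, cond_false]
            exact e1 l' u []
          rw [h2]
          rw [encodeWords_cons] at h1
          simp [totalLength, bits] at h1 ⊢
          omega) hg
  have h : ∀ I : SqrtSumInstance, (encodeNat I.t :: I.radWords).foldl step ([], [], false) =
      (encodeNat I.t, encodeWords I.radWords, true) := by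
    intro I
    rw [List.foldl_cons]
    simp only [hstep, cond_false]
    exact e1 _ _ []
  simp only [List.forall_mem_cons, List.not_mem_nil, false_imp_iff, implies_true, and_true,
    h] at key
  exact ⟨key.1, key.2.1⟩

theorem polyTime_allSquares : PolyTimeBool [encode] allSquares := by
  have e : ∀ (l : List ℕ+) (c : Bool), (l.map fun z : ℕ+ => encodeNat (z : ℕ)).foldl
      (fun c u => c && isSquareBits u) c =
      (c && l.all fun z => isSquareBits (encodeNat (z : ℕ))) := by
    intro l
    induction l with
    | nil => simp
    | cons z l ih =>
      intro c
      rw [List.map_cons, List.foldl_cons, ih, List.all_cons, Bool.and_assoc]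
  have := PolyTime.foldlWords (w := [fun c : Bool => [Γ'.bit c]]) polyTime_parts.2
    (step := fun _ c u => c && isSquareBits u) (init := fun _ => true)
    (by simpa using PolyTime.const _)
    (fun V _ hw hu => by
      simp only [List.mem_cons, List.not_mem_nil, or_false, forall_eq] at hw ⊢
      exact PolyTime.bool₂ hw (PolyTime.isSquareBits hu) fun a b => a && b)
    (b := fun _ => 1) (PolyBdd.const _) (fun x l' _ => by simp [totalLength])
    List.mem_cons_self
  simp only [radWords, e, Bool.true_and] at this
  exact this

theorem polyTime_code : PolyTime [encode] fun I => encodeNats (0 :: 0 :: I.game.code) := by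
  have hvar : PolyTime [encode] encode := PolyTime.var (by simp)
  obtain ⟨ht, hl⟩ := polyTime_parts
  have hlen : ∀ I : SqrtSumInstance, I.radWords.length = I.num := fun I => by simp [radWords, num]
  have hz : PolyTime [encode] fun I => bits (List.replicate I.size false) := by
    have := hvar.flatMap fun _ => [Γ'.bit false]
    refine (congrArg (PolyTime _) (funext fun I => ?_)).mp this
    rw [size]
    generalize I.encode = l
    induction l with
    | nil => rfl
    | cons s l ih =>
      rw [List.flatMap_cons, ih]
      simp [bits, List.replicate_succ]
  have hcopies : ∀ u, PolyTime [encode] fun I => copies I.num u := fun u => by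
    simpa only [hlen] using PolyTime.copies_const hl u
  -- An affine function of the number of radicands is the length of a string that can be written
  -- down; counting its letters gives the binary digits without multiplication.
  have hnum : ∀ c d, PolyTime [encode] fun I => bits (encodeNat (c * I.num + d)) := fun c d => by
    have := ((hcopies (List.replicate c Γ'.comma)).append
      (PolyTime.const (List.replicate d Γ'.comma))).encodeNat_length
    simpa [length_copies, mul_comm] using this
  have hinv : PolyTime [encode] fun I => encodeNats [1, I.num + 1] := by
    have h := PolyTime.encodeNats_singleton (hnum 1 1)
    refine (congrArg (PolyTime _) (funext fun I => ?_)).mp ((PolyTime.const (encodeNats [1])).append h)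
    rw [one_mul]
    rfl
  have hstates : PolyTime [encode] fun I => encodeNats [0, 0, 4 * I.num + 2, 1, 2] := by
    have h := PolyTime.encodeNats_singleton (hnum 4 2)
    refine (congrArg (PolyTime _) (funext fun I => ?_)).mp
      ((PolyTime.const (encodeNats [0, 0])).append (h.append (PolyTime.const (encodeNats [1, 2]))))
    rw [← encodeNats_append, ← encodeNats_append]
    rfl
  have h237 : PolyTime [encode] fun I => bits (encodeNat (237 * (I.num + 1))) := hnum 237 237
  simp only [encodeNats_game]
  refine hstates.append (PolyTime.append ?_ (PolyTime.append ?_ ?_))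
  · simp only [stateStr_zero]
    refine (PolyTime.const _).append (PolyTime.cons_bit polyTime_allSquares (ht.append (PolyTime.cons _ (hz.append (h237.append (PolyTime.cons _
        ((PolyTime.const _).append ((hcopies _).append ((PolyTime.const _).append
          ((PolyTime.const _).append (hinv.append ?_)))))))))))
    simpa only [hlen] using PolyTime.copies hl
      ((PolyTime.const (encodeNats [0, 1])).append (hinv.append
        (PolyTime.const (encodeNats [0, 1, 0, 1]))))
  · simp only [stateStr_one]
    have h := (PolyTime.const zeroBlock).append
      ((PolyTime.const (encodeNats [0, 1, 1, 1])).append (hcopies zeroBlock))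
    refine (PolyTime.const _).append ((congrArg (PolyTime _) (funext fun I => ?_)).mp (h.append h))
    simp [copies]
  · have h := PolyTime.flatMap_gadgetStr hz hl
    refine (congrArg (PolyTime _) (funext fun I => ?_)).mp h
    rw [hlen]
    refine List.flatMap_congr fun j hj => ?_
    have hj' : j < I.a.length := List.mem_range.1 hj
    congr 1
    simp [radWords, rad, hj']

end SqrtSumInstance

end

end StochasticGames

theorem theorem3 : StochasticGames.SqrtSumHard (StochasticGames.stationaryNash 4) := by
  refine ⟨fun I => ⟨I.game, (⟨0, 0⟩ : Σ _ : Fin (4 * I.num + 2), Fin 2)⟩,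
    StochasticGames.PolyTime.tm2ComputableInPolyTime
      StochasticGames.SqrtSumInstance.polyTime_code, fun I => ⟨?_, ?_⟩⟩
  · obtain ⟨x, hx⟩ := I.exists_isNash
    exact ⟨fun p => (x p.1 p.2).toReal, x, hx, fun _ => rfl⟩
  · rintro v ⟨x, hx, hv⟩
    have h := I.quit_zero_of_isNash hx
    have hv0 := hv (⟨0, 0⟩ : Σ _ : Fin (4 * I.num + 2), Fin 2)
    exact ⟨fun hy => hv0.trans (h.1 hy), fun hy => hv0.trans (h.2 hy)⟩
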